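/- Let $V=\mathbb{C}^8$ with the symmetric bilinear form $(x|y)=\sum_{i=0}^7 x_iy_i$, let $\phi=(\tfrac12,\dots,\tfrac12)$, and let $P=\{a\in\mathbb{Z}^8\cup(\phi+\mathbb{Z}^8) : (\phi|a)\in\mathbb{Z}\}$ be the $E_8$ root lattice. A $C_3$-frame is a set $\{\pm a_0,\pm a_1,\pm a_2\}\subset V$ such that $(a_i|a_j)=\delta_{ij}$, $a_i\pm a_j\in P$ for $i<j$, and $2a_i\in P$. Let $[z]$ be a nonzero entire function on $\mathbb{C}$ such that $$[\beta\pm\gamma][z\pm\alpha]+[\gamma\pm\alpha][z\pm\beta]+[\alpha\pm\beta][z\pm\gamma]=0\qquad(z,\alpha,\beta,\gamma\in\mathbb{C}),$$ where a double sign denotes the product of the two factors, e.g. $[\alpha\pm\beta]=[\alpha+\beta][\alpha-\beta]$, $[(a\pm b|x)]=[(a+b|x)][(a-b|x)]$ and $\tau(x\pm v)=\tau(x+v)\tau(x-v)$. Let $\Omega=\{\omega\in\mathbb{C}:[\omega]=0\}$ be its group of periods, and fix $\delta\in\mathbb{C}\setminus\{0\}$ with $\mathbb{Z}\delta\cap\Omega=\{0\}$.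 For $\kappa,c\in\mathbb{C}$ put $H_\kappa=\{x\in V:(\phi|x)=\kappa\}$ and $D_c=\bigsqcup_{n\in\mathbb{Z}}H_{c+n\delta}$. Identities between meromorphic functions are understood as equalities of meromorphic functions (i.e. on a dense open set). A meromorphic function $\tau$ on $D_c$ is an ORG $\tau$-function if $$[(a_1\pm a_2|x)]\,\tau(x\pm a_0\delta)+[(a_2\pm a_0|x)]\,\tau(x\pm a_1\delta)+[(a_0\pm a_1|x)]\,\tau(x\pm a_2\delta)=0$$ for all $C_3$-frames $\{\pm a_0,\pm a_1,\pm a_2\}$ and all $x$ for which the points $x\pm a_i\delta$ lie in $D_c$. It is a hypergeometric $\tau$-function if moreover $\tau|_{H_{c+n\delta}}=0$ for all $n<0$ and $\tau|_{H_c}\not\equiv0$. **Theorem.** Let $\omega\in\Omega$, and let $\tau^{(0)}$ and $\tau^{(1)}$ be nonzero meromorphic functions on $H_\omega$ and $H_{\omega+\delta}$, respectively. Suppose that $$\frac{\tau^{(0)}(x\pm a_1\delta)}{\tau^{(0)}(x\pm a_2\delta)}=\frac{[(a_0\pm a_1|x)]}{[(a_0\pm a_2|x)]}\qquad(x\in H_\omega)$$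 for every $C_3$-frame $\{\pm a_0,\pm a_1,\pm a_2\}$ with $(\phi|a_0)=1$, $(\phi|a_1)=(\phi|a_2)=0$, and that $$[(a_1\pm a_2|x)]\tau^{(0)}(x-a_0\delta)\tau^{(1)}(x+a_0\delta)+[(a_2\pm a_0|x)]\tau^{(0)}(x-a_1\delta)\tau^{(1)}(x+a_1\delta)+[(a_0\pm a_1|x)]\tau^{(0)}(x-a_2\delta)\tau^{(1)}(x+a_2\delta)=0\qquad(x\in H_{\omega+\delta/2})$$ for every $C_3$-frame $\{\pm a_0,\pm a_1,\pm a_2\}$ with $(\phi|a_0)=(\phi|a_1)=(\phi|a_2)=\tfrac12$. Then there exists a unique hypergeometric $\tau$-function $\tau$ on $D_\omega$ such that $\tau|_{H_\omega}=\tau^{(0)}$ and $\tau|_{H_{\omega+\delta}}=\tau^{(1)}$. -/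

import Mathlib

open Filter Topology

namespace ORG

/-- The complex vector space `V = ℂ⁸`. The symmetric bilinear form `(a|x) = ∑ i, a i * x i`
(no complex conjugation) is Mathlib's dot product `a ⬝ᵥ x`. -/
abbrev V : Type := Fin 8 → ℂ

/-- The vector `φ = (1/2, …, 1/2)`. -/
noncomputable def phi : V := fun _ => 1 / 2

/-- The root lattice `P = Q(E₈)`: vectors of `ℤ⁸ ∪ (φ + ℤ⁸)` with integral pairing with `φ`. -/
def latticeP : Set V :=
  {a | ((∃ m : Fin 8 → ℤ, ∀ i, a i = (m i : ℂ)) ∨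
        (∃ m : Fin 8 → ℤ, ∀ i, a i = phi i + (m i : ℂ))) ∧
      ∃ k : ℤ, phi ⬝ᵥ a = (k : ℂ)}

/-- `{±a 0, …, ±a (l-1)}` is a `C_l`-frame relative to `P`. -/
structure IsCFrame {l : ℕ} (a : Fin l → V) : Prop where
  orthonormal : ∀ i j, a i ⬝ᵥ a j = if i = j then 1 else 0
  add_mem : ∀ i j, i < j → a i + a j ∈ latticeP
  sub_mem : ∀ i j, i < j → a i - a j ∈ latticeP
  two_mem : ∀ i, (2 : ℂ) • a i ∈ latticeP

/-- `br z = [z]` is a nonzero entire function satisfying the three-term relation. -/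
structure IsThreeTerm (br : ℂ → ℂ) : Prop where
  entire : Differentiable ℂ br
  nonzero : ∃ z, br z ≠ 0
  three_term : ∀ z α β γ : ℂ,
    br (β + γ) * br (β - γ) * (br (z + α) * br (z - α)) +
    br (γ + α) * br (γ - α) * (br (z + β) * br (z - β)) +
    br (α + β) * br (α - β) * (br (z + γ) * br (z - γ)) = 0

/-- The set `Ω` of zeros of `[z]`, whose elements are called the periods of `[z]`. -/
def periods (br : ℂ → ℂ) : Set ℂ := {ω | br ω = 0}

/-- `[(a ± b | x)] = [(a + b | x)] [(a - b | x)]`. -/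
noncomputable def brPM (br : ℂ → ℂ) (a b x : V) : ℂ :=
  br ((a + b) ⬝ᵥ x) * br ((a - b) ⬝ᵥ x)

/-- `τ(x ± v) = τ(x + v) τ(x - v)`. -/
def tauPM (τ : V → ℂ) (x v : V) : ℂ := τ (x + v) * τ (x - v)

/-- The hyperplane `H_κ = {x ∈ V | (φ|x) = κ}`. -/
def hyperplane (κ : ℂ) : Set V := {x | phi ⬝ᵥ x = κ}

/-- The domain `D_c`, the union of the parallel hyperplanes `H_{c + n δ}`, `n ∈ ℤ`. -/
def domainD (c δ : ℂ) : Set V := ⋃ n : ℤ, hyperplane (c + (n : ℂ) * δ)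

/-- The property `p` holds on a relatively open dense subset of `S`.
Identities between meromorphic functions on `S` are understood in this sense, which does not
depend on the values given to representatives at poles and points of indeterminacy. -/
def Generically (S : Set V) (p : V → Prop) : Prop :=
  ∃ U : Set V, IsOpen U ∧ S ⊆ closure (S ∩ U) ∧ ∀ x ∈ S ∩ U, p x

/-- The values of `τ` on `S` represent a meromorphic function on `S`, for `S` a hyperplane or a
discrete union of parallel hyperplanes: near each point of `S` it is a quotient `F / G` of
holomorphic functions with `G` not identically zero on any neighbourhood of the point in `S`.
(A holomorphic function near a point of an affine subspace is the same as the restriction of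
a holomorphic function near that point of `V`.) The values of the representative on the thin set
`G = 0`, or outside `S`, are immaterial; two representatives give the same meromorphic function
on `S` if they agree generically on `S`. -/
def IsMeromorphicOn (S : Set V) (τ : V → ℂ) : Prop :=
  ∀ p ∈ S, ∃ F G : V → ℂ, AnalyticAt ℂ F p ∧ AnalyticAt ℂ G p ∧
    (∃ᶠ x in 𝓝[S] p, G x ≠ 0) ∧
    ∀ᶠ x in 𝓝[S] p, G x ≠ 0 → τ x = F x / G x

/-- Equality of meromorphic functions on `S`. -/
def MeroEq (S : Set V) (f g : V → ℂ) : Prop := Generically S fun x => f x = g x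

/-- A meromorphic ORG `τ`-function on `D`: a meromorphic function satisfying the non-autonomous
Hirota equations for all `C₃`-frames `{±a 0, ±a 1, ±a 2}`, as identities of meromorphic functions
in those `x` for which the six points `x ± δ a i` belong to `D`. -/
structure IsMeromorphicORGTau (br : ℂ → ℂ) (δ : ℂ) (D : Set V) (τ : V → ℂ) : Prop where
  meromorphic : IsMeromorphicOn D τ
  hirota : ∀ a : Fin 3 → V, IsCFrame a →
    Generically {x | ∀ i, x + δ • a i ∈ D ∧ x - δ • a i ∈ D} fun x =>
      brPM br (a 1) (a 2) x * tauPM τ x (δ • a 0) +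
      brPM br (a 2) (a 0) x * tauPM τ x (δ • a 1) +
      brPM br (a 0) (a 1) x * tauPM τ x (δ • a 2) = 0

/-- A hypergeometric `τ`-function on `D_c`: a meromorphic ORG `τ`-function whose components
`τ⁽ⁿ⁾ = τ|_{H_{c+nδ}}` satisfy `τ⁽ⁿ⁾ = 0` for `n < 0` and `τ⁽⁰⁾ ≢ 0`. -/
structure IsHypergeometricTau (br : ℂ → ℂ) (δ c : ℂ) (τ : V → ℂ) : Prop where
  org : IsMeromorphicORGTau br δ (domainD c δ) τ
  neg_eq_zero : ∀ n : ℤ, n < 0 → MeroEq (hyperplane (c + (n : ℂ) * δ)) τ 0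
  zero_ne_zero : ¬ MeroEq (hyperplane c) τ 0

end ORG

/-! A Hirota equation does not depend on the signs or the order of its frame. Up to these, the
pairings of a frame with `φ` are (1/2,1/2,1/2), (0,0,0), (1,0,0) or (1,1,0)
(`IsCFrame.classification`). An equation of type (1,0,0) centred on `H_κ` meets `H_{κ±δ}` only
through `τ(x+δa) τ(x-δa)`. So once `τ` is known on `H_{κ-δ}` and `H_κ`, and is nonzero on the
former, the equation can be solved for `τ` on `H_{κ+δ}`. One base frame therefore defines all
components recursively (`nextTau`, `tauSeq`) and gives uniqueness. It remains to show that every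
other frame is then satisfied as well, and that the recursion never divides by zero.

Other frames: the (1/2,1/2,1/2) equations linking `H_{κ-δ}` and `H_κ` carry a (1,0,0) equation on
`H_κ` to the one for the frame reflected in a root `r ⊥ φ` with `(r|a) = 1/2` (`IsTypeOne.move`).
These moves connect all frames of type (1,0,0) (`IsTypeOneClosed.all`). Indeed `a ↦ 2a - φ`
identifies the possible `a` with the roots orthogonal to `φ` (an `E₇` system), a move goes between
roots of inner product 1, and finite checks give connectedness together with enough loops at the
base root to realise the reflections fixing `a`. Types (0,0,0) and (1,1,0) follow by Plücker
elimination against a fourth vector. A combination of three (1,0,0) equations yields the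
(1/2,1/2,1/2) equations linking `H_κ` and `H_{κ+δ}` (`hirotaType_half`), so the induction continues.

Nonvanishing: in type (1,1,0) one has `a 0 + a 1 = φ`, so the third coefficient contains `[κ]`,
which is nonzero for `κ = ω + nδ` with `n ≥ 1`. If `τ` vanished on `H_{κ+δ}`, a single nonzero term
would be left (`generically_ne_zero_of_hirotaType_two`). At `κ = ω` the same coefficient vanishes
because `ω` is a period, which is what makes these equations compatible with `τ = 0` on `H_{ω-δ}`.
The (1,0,0) equations on `H_ω` are the assumed ratio identities for `τ₀`. -/

namespace ORG

/-! ### Generic identities -/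

/-- The filter of sets containing a relatively open dense subset of `S`. -/
def genericFilter (S : Set V) : Filter V where
  sets := {A | Generically S (· ∈ A)}
  univ_sets := ⟨Set.univ, isOpen_univ, by simpa using subset_closure, fun _ _ => trivial⟩
  sets_of_superset := fun ⟨U, hU, hd, h⟩ hAB => ⟨U, hU, hd, fun x hx => hAB (h x hx)⟩
  inter_sets := by
    rintro A B ⟨U, hU, hUd, hA⟩ ⟨W, hW, hWd, hB⟩
    refine ⟨U ∩ W, hU.inter hW, fun x hx => ?_,
      fun x hx => ⟨hA x ⟨hx.1, hx.2.1⟩, hB x ⟨hx.1, hx.2.2⟩⟩⟩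
    rw [mem_closure_iff]
    intro N hN hxN
    obtain ⟨y, hyN, hyS, hyU⟩ := mem_closure_iff.1 (hUd hx) N hN hxN
    obtain ⟨z, hz, hzS, hzW⟩ := mem_closure_iff.1 (hWd hyS) (N ∩ U) (hN.inter hU) ⟨hyN, hyU⟩
    exact ⟨z, hz.1, hzS, hz.2, hzW⟩

theorem generically_iff {S : Set V} {p : V → Prop} :
    Generically S p ↔ ∀ᶠ x in genericFilter S, p x := Iff.rfl

theorem eventually_mem_genericFilter (S : Set V) : ∀ᶠ x in genericFilter S, x ∈ S :=
  ⟨Set.univ, isOpen_univ, by simpa using subset_closure, fun _ hx => hx.1⟩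

theorem Generically.of_forall {S : Set V} {p : V → Prop} (h : ∀ x ∈ S, p x) : Generically S p :=
  generically_iff.2 ((eventually_mem_genericFilter S).mono h)

theorem Generically.inter_open {S N : Set V} {p : V → Prop} (h : Generically S p)
    (hN : IsOpen N) : Generically (S ∩ N) p := by
  obtain ⟨U, hU, hd, h⟩ := h
  refine ⟨U, hU, fun x hx => ?_, fun x hx => h x ⟨hx.1.1, hx.2⟩⟩
  rw [mem_closure_iff]
  intro M hM hxM
  obtain ⟨y, hy, hyS, hyU⟩ := mem_closure_iff.1 (hd hx.1) (M ∩ N) (hM.inter hN) ⟨hxM, hx.2⟩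
  exact ⟨y, hy.1, ⟨hyS, hy.2⟩, hyU⟩

/-- The union of the local witnesses, each cut down to its own neighbourhood, is a global witness.
-/
theorem Generically.of_local {S : Set V} {p : V → Prop}
    (h : ∀ x ∈ S, ∃ N : Set V, IsOpen N ∧ x ∈ N ∧ Generically (S ∩ N) p) : Generically S p := by
  choose! N hN hxN U hU hd hp using h
  refine ⟨⋃ x ∈ S, N x ∩ U x, isOpen_biUnion fun x hx => (hN x hx).inter (hU x hx), ?_, ?_⟩
  · intro x hx
    refine closure_mono ?_ (hd x hx ⟨hx, hxN x hx⟩)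
    rintro y ⟨⟨hyS, hyN⟩, hyU⟩
    exact ⟨hyS, Set.mem_biUnion hx ⟨hyN, hyU⟩⟩
  · rintro y ⟨hyS, hy⟩
    obtain ⟨x, hx, hyN, hyU⟩ := Set.mem_iUnion₂.1 hy
    exact hp x hx y ⟨⟨hyS, hyN⟩, hyU⟩

theorem Generically.frequently {S N : Set V} {p : V → Prop} {x : V}
    (h : Generically (S ∩ N) p) (hxS : x ∈ S) (hxN : x ∈ N) : ∃ᶠ y in 𝓝[S] x, p y := by
  obtain ⟨U, hU, hd, h⟩ := h
  rw [frequently_iff]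
  intro A hA
  obtain ⟨M, hM, hxM, hMA⟩ := mem_nhdsWithin.1 hA
  obtain ⟨y, hyM, hyS, hyU⟩ := mem_closure_iff.1 (hd ⟨hxS, hxN⟩) M hM hxM
  exact ⟨y, hMA ⟨hyM, hyS.1⟩, h y ⟨hyS, hyU⟩⟩

theorem Generically.false_elim {S : Set V} {x : V} (h : Generically S fun _ => False)
    (hx : x ∈ S) : False := by
  have := Generically.frequently (N := Set.univ) (x := x) (by simpa using h) hx trivial
  simp at this

/-! ### Hyperplanes -/

theorem phi_dot_phi : phi ⬝ᵥ phi = 2 := by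
  simp [phi, dotProduct]; norm_num

/-- The projection of `V` onto the hyperplane `H_κ` along `φ`. -/
noncomputable def proj (κ : ℂ) (x : V) : V := x + ((κ - phi ⬝ᵥ x) / 2) • phi

theorem proj_mem (κ : ℂ) (x : V) : proj κ x ∈ hyperplane κ := by
  simp only [proj, hyperplane, Set.mem_ofPred_eq, dotProduct_add, dotProduct_smul, phi_dot_phi,
    smul_eq_mul]
  ring

theorem proj_of_mem {κ : ℂ} {x : V} (h : x ∈ hyperplane κ) : proj κ x = x := by
  simp only [hyperplane, Set.mem_ofPred_eq] at h
  simp [proj, h]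

theorem differentiable_dot (v : V) : Differentiable ℂ fun x : V => v ⬝ᵥ x := by
  unfold dotProduct; fun_prop

theorem analyticAt_dot (v : V) (p : V) : AnalyticAt ℂ (fun x : V => v ⬝ᵥ x) p := by
  have : (fun x : V => v ⬝ᵥ x) =
      fun x => ∑ i, v i * (ContinuousLinearMap.proj (R := ℂ) (φ := fun _ : Fin 8 => ℂ) i) x := rfl
  rw [this]
  exact Finset.analyticAt_fun_sum _ fun i _ =>
    analyticAt_const.mul (ContinuousLinearMap.analyticAt _ _)

theorem analyticAt_proj (κ : ℂ) (p : V) : AnalyticAt ℂ (proj κ) p := by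
  unfold proj
  exact analyticAt_id.add
    (((analyticAt_const.sub (analyticAt_dot phi p)).div_const).smul analyticAt_const)

theorem continuous_proj (κ : ℂ) : Continuous (proj κ) :=
  continuous_iff_continuousAt.2 fun p => (analyticAt_proj κ p).continuousAt

theorem isPreconnected_hyperplane (κ : ℂ) : IsPreconnected (hyperplane κ) := by
  apply Convex.isPreconnected
  intro x hx y hy a b _ _ hab
  simp only [hyperplane, Set.mem_ofPred_eq] at *
  rw [dotProduct_add, dotProduct_smul, dotProduct_smul, hx, hy, ← add_smul, hab, one_smul]

/-- Translation by `v` is a homeomorphism from `H_κ` onto `H_κ'`. This is how facts at the points `x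
± δ a` are collected at the common centre `x`. -/
theorem Generically.shift {κ κ' : ℂ} {p : V → Prop} (h : Generically (hyperplane κ') p) (v : V)
    (hv : κ + phi ⬝ᵥ v = κ') : Generically (hyperplane κ) fun x => p (x + v) := by
  obtain ⟨U, hU, hd, h⟩ := h
  have hmem : ∀ x, x ∈ hyperplane κ → x + v ∈ hyperplane κ' := by
    intro x hx
    simp only [hyperplane, Set.mem_ofPred_eq, dotProduct_add] at *
    rw [hx, hv]
  refine ⟨(· + v) ⁻¹' U, hU.preimage (by fun_prop), fun x hx => ?_,
    fun x hx => h _ ⟨hmem x hx.1, hx.2⟩⟩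
  rw [mem_closure_iff]
  intro N hN hxN
  obtain ⟨y, hyN, hyS, hyU⟩ := mem_closure_iff.1 (hd (hmem x hx)) ((· - v) ⁻¹' N)
    (hN.preimage (by fun_prop)) (by simpa using hxN)
  refine ⟨y - v, hyN, ?_, by simpa using hyU⟩
  simp only [hyperplane, Set.mem_ofPred_eq, dotProduct_sub] at *
  rw [hyS, ← hv]; ring

/-! ### Local structure of meromorphic functions on a hyperplane -/

/-- Composition with `proj κ` turns a germ along the hyperplane into a germ on a ball of `V`, where
the identity theorem applies: vanishing near one point of the ball spreads to the whole ball. -/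
theorem analyticAt_proj_zero_or {κ : ℂ} {p : V} (hp : p ∈ hyperplane κ) {F : V → ℂ}
    (hF : AnalyticAt ℂ F p) :
    (∀ᶠ x in 𝓝 p, F (proj κ x) = 0) ∨
      ∃ N : Set V, IsOpen N ∧ p ∈ N ∧ Generically (hyperplane κ ∩ N) fun x => F x ≠ 0 := by
  have hFp : AnalyticAt ℂ (fun x => F (proj κ x)) p :=
    AnalyticAt.fun_comp (by rwa [proj_of_mem hp]) (analyticAt_proj κ p)
  obtain ⟨ε, hε, hball⟩ := Metric.eventually_nhds_iff_ball.1 hFp.eventually_analyticAt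
  have hA : AnalyticOnNhd ℂ (fun x => F (proj κ x)) (Metric.ball p ε) := hball
  by_cases hz : ∃ q ∈ Metric.ball p ε, ∀ᶠ x in 𝓝 q, F (proj κ x) = 0
  · left
    obtain ⟨q, hq, hz⟩ := hz
    have := hA.eqOn_zero_of_preconnected_of_eventuallyEq_zero
      (convex_ball p ε).isPreconnected hq hz
    exact Filter.mem_of_superset (Metric.ball_mem_nhds p hε) this
  · right
    push Not at hz
    refine ⟨Metric.ball p ε, Metric.isOpen_ball, Metric.mem_ball_self hε,
      Metric.ball p ε ∩ (fun x => F (proj κ x)) ⁻¹' {0}ᶜ,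
      hA.continuousOn.isOpen_inter_preimage Metric.isOpen_ball isOpen_compl_singleton, ?_, ?_⟩
    · rintro x ⟨hxH, hxB⟩
      rw [mem_closure_iff]
      intro N hN hxN
      have hnhd : proj κ ⁻¹' (N ∩ Metric.ball p ε) ∈ 𝓝 x :=
        ((hN.inter Metric.isOpen_ball).preimage (continuous_proj κ)).mem_nhds
          (by rw [Set.mem_preimage, proj_of_mem hxH]; exact ⟨hxN, hxB⟩)
      obtain ⟨y, hy, hyF⟩ := ((not_eventually.1 (hz x hxB)).and_eventually hnhd).exists
      refine ⟨proj κ y, hyF.1, ⟨proj_mem κ y, hyF.2⟩, hyF.2, ?_⟩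
      simpa [proj_of_mem (proj_mem κ y)] using hy
    · rintro x ⟨⟨hxH, -⟩, -, hx⟩
      simpa [proj_of_mem hxH] using hx

theorem generically_ne_of_frequently {κ : ℂ} {p : V} (hp : p ∈ hyperplane κ) {F : V → ℂ}
    (hF : AnalyticAt ℂ F p) (h : ∃ᶠ x in 𝓝[hyperplane κ] p, F x ≠ 0) :
    ∃ N : Set V, IsOpen N ∧ p ∈ N ∧ Generically (hyperplane κ ∩ N) fun x => F x ≠ 0 := by
  refine (analyticAt_proj_zero_or hp hF).resolve_left fun h0 => ?_
  refine h ?_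
  filter_upwards [nhdsWithin_le_nhds h0, self_mem_nhdsWithin] with x hx hxH
  simpa [proj_of_mem hxH] using hx

theorem frequently_mul_ne_zero {κ : ℂ} {p : V} (hp : p ∈ hyperplane κ) {F G : V → ℂ}
    (hF : AnalyticAt ℂ F p) (hG : AnalyticAt ℂ G p)
    (hF0 : ∃ᶠ x in 𝓝[hyperplane κ] p, F x ≠ 0) (hG0 : ∃ᶠ x in 𝓝[hyperplane κ] p, G x ≠ 0) :
    ∃ᶠ x in 𝓝[hyperplane κ] p, F x * G x ≠ 0 := by
  obtain ⟨N, hN, hpN, h1⟩ := generically_ne_of_frequently hp hF hF0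
  obtain ⟨M, hM, hpM, h2⟩ := generically_ne_of_frequently hp hG hG0
  have h1' := h1.inter_open hM
  have h2' := h2.inter_open hN
  rw [Set.inter_assoc] at h1' h2'
  rw [Set.inter_comm M N] at h2'
  refine Generically.frequently (N := N ∩ M) ?_ hp ⟨hpN, hpM⟩
  rw [generically_iff] at *
  filter_upwards [h1', h2'] with x ha hb using mul_ne_zero ha hb

/-- The two alternatives hold locally by `analyticAt_proj_zero_or`. They define two open sets that
cover the hyperplane and do not meet on it, so connectedness leaves only one of them. -/
theorem IsMeromorphicOn.zero_or_ne_zero {κ : ℂ} {f : V → ℂ}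
    (hf : IsMeromorphicOn (hyperplane κ) f) :
    Generically (hyperplane κ) (fun x => f x = 0) ∨
      Generically (hyperplane κ) (fun x => f x ≠ 0) := by
  have hloc : ∀ p ∈ hyperplane κ, ∃ N : Set V, IsOpen N ∧ p ∈ N ∧
      (Generically (hyperplane κ ∩ N) (fun x => f x = 0) ∨
        Generically (hyperplane κ ∩ N) (fun x => f x ≠ 0)) := by
    intro p hp
    obtain ⟨F, G, hF, hG, hG0, hrep⟩ := hf p hp
    obtain ⟨N, hN, hpN, hNG⟩ := generically_ne_of_frequently hp hG hG0
    obtain ⟨M, hM, hpM, hMrep⟩ := mem_nhdsWithin.1 hrep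
    rcases analyticAt_proj_zero_or hp hF with hz | ⟨L, hL, hpL, hLF⟩
    · obtain ⟨L, hLz, hL, hpL⟩ := eventually_nhds_iff.1 hz
      refine ⟨N ∩ (M ∩ L), hN.inter (hM.inter hL), ⟨hpN, hpM, hpL⟩, Or.inl ?_⟩
      have := hNG.inter_open (hM.inter hL)
      rw [Set.inter_assoc] at this
      rw [generically_iff] at *
      filter_upwards [this, eventually_mem_genericFilter _] with x hx hxm
      have h1 := hMrep ⟨hxm.2.2.1, hxm.1⟩ hx
      have h2 := hLz x hxm.2.2.2
      rw [proj_of_mem hxm.1] at h2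
      rw [h1, h2, zero_div]
    · refine ⟨N ∩ (M ∩ L), hN.inter (hM.inter hL), ⟨hpN, hpM, hpL⟩, Or.inr ?_⟩
      have h1 := hNG.inter_open (hM.inter hL)
      have h2 := hLF.inter_open (hN.inter hM)
      rw [Set.inter_assoc] at h1 h2
      rw [show L ∩ (N ∩ M) = N ∩ (M ∩ L) by ac_rfl] at h2
      rw [generically_iff] at *
      filter_upwards [h1, h2, eventually_mem_genericFilter _] with x hG hF hxm
      have h1 := hMrep ⟨hxm.2.2.1, hxm.1⟩ hG
      rw [h1]
      exact div_ne_zero hF hG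
  set u : Set V := ⋃₀ {N | IsOpen N ∧ Generically (hyperplane κ ∩ N) (fun x => f x = 0)}
  set v : Set V := ⋃₀ {N | IsOpen N ∧ Generically (hyperplane κ ∩ N) (fun x => f x ≠ 0)}
  have hcover : hyperplane κ ⊆ u ∪ v := by
    intro p hp
    obtain ⟨N, hN, hpN, h | h⟩ := hloc p hp
    · exact Or.inl ⟨N, ⟨hN, h⟩, hpN⟩
    · exact Or.inr ⟨N, ⟨hN, h⟩, hpN⟩
  by_cases hu : (hyperplane κ ∩ u).Nonempty
  · by_cases hv : (hyperplane κ ∩ v).Nonempty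
    · exfalso
      obtain ⟨p, hp, ⟨N, ⟨hN, hN0⟩, hpN⟩, M, ⟨hM, hM0⟩, hpM⟩ :=
        isPreconnected_hyperplane κ u v (isOpen_sUnion fun N h => h.1)
          (isOpen_sUnion fun N h => h.1) hcover hu hv
      have h1 := hN0.inter_open hM
      have h2 := hM0.inter_open hN
      rw [Set.inter_assoc] at h1 h2
      rw [Set.inter_comm M N] at h2
      refine Generically.false_elim (S := hyperplane κ ∩ (N ∩ M)) (x := p) ?_ ⟨hp, hpN, hpM⟩
      rw [generically_iff] at *
      filter_upwards [h1, h2] with x ha hb using hb ha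
    · left
      refine Generically.of_local fun p hp => ?_
      rcases hcover hp with ⟨N, ⟨hN, h⟩, hpN⟩ | h
      · exact ⟨N, hN, hpN, h⟩
      · exact absurd ⟨p, hp, h⟩ hv
  · right
    refine Generically.of_local fun p hp => ?_
    rcases hcover hp with h | ⟨N, ⟨hN, h⟩, hpN⟩
    · exact absurd ⟨p, hp, h⟩ hu
    · exact ⟨N, hN, hpN, h⟩

theorem IsMeromorphicOn.generically_ne_zero {κ : ℂ} {f : V → ℂ}
    (hf : IsMeromorphicOn (hyperplane κ) f) (h : ¬ MeroEq (hyperplane κ) f 0) :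
    Generically (hyperplane κ) (fun x => f x ≠ 0) :=
  hf.zero_or_ne_zero.resolve_left h

theorem hyperplane_nonempty (κ : ℂ) : (hyperplane κ).Nonempty := ⟨proj κ 0, proj_mem κ 0⟩

/-! ### Closure properties of meromorphic functions -/

theorem isMeromorphicOn_of_analytic {S : Set V} {f : V → ℂ}
    (hf : ∀ p ∈ S, AnalyticAt ℂ f p) : IsMeromorphicOn S f := fun p hp => by
  refine ⟨f, fun _ => 1, hf p hp, analyticAt_const, ?_, Eventually.of_forall fun x _ => by simp⟩
  have : (𝓝[S] p).NeBot := mem_closure_iff_nhdsWithin_neBot.1 (subset_closure hp)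
  exact (Eventually.of_forall fun _ => one_ne_zero).frequently

theorem IsMeromorphicOn.congr {S : Set V} {f g : V → ℂ} (hf : IsMeromorphicOn S f)
    (h : ∀ x ∈ S, g x = f x) : IsMeromorphicOn S g := fun p hp => by
  obtain ⟨F, G, hF, hG, h0, hr⟩ := hf p hp
  refine ⟨F, G, hF, hG, h0, ?_⟩
  filter_upwards [hr, self_mem_nhdsWithin] with x hx hxS
  rw [h x hxS]; exact hx

theorem IsMeromorphicOn.mul {κ : ℂ} {f g : V → ℂ} (hf : IsMeromorphicOn (hyperplane κ) f)
    (hg : IsMeromorphicOn (hyperplane κ) g) :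
    IsMeromorphicOn (hyperplane κ) fun x => f x * g x := fun p hp => by
  obtain ⟨F, G, hF, hG, h0, hr⟩ := hf p hp
  obtain ⟨F', G', hF', hG', h0', hr'⟩ := hg p hp
  refine ⟨fun x => F x * F' x, fun x => G x * G' x, hF.mul hF', hG.mul hG',
    frequently_mul_ne_zero hp hG hG' h0 h0', ?_⟩
  filter_upwards [hr, hr'] with x hx hx' hne
  rw [hx (left_ne_zero_of_mul hne), hx' (right_ne_zero_of_mul hne), div_mul_div_comm]

theorem IsMeromorphicOn.add {κ : ℂ} {f g : V → ℂ} (hf : IsMeromorphicOn (hyperplane κ) f)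
    (hg : IsMeromorphicOn (hyperplane κ) g) :
    IsMeromorphicOn (hyperplane κ) fun x => f x + g x := fun p hp => by
  obtain ⟨F, G, hF, hG, h0, hr⟩ := hf p hp
  obtain ⟨F', G', hF', hG', h0', hr'⟩ := hg p hp
  refine ⟨fun x => F x * G' x + G x * F' x, fun x => G x * G' x,
    (hF.mul hG').add (hG.mul hF'), hG.mul hG',
    frequently_mul_ne_zero hp hG hG' h0 h0', ?_⟩
  filter_upwards [hr, hr'] with x hx hx' hne
  rw [hx (left_ne_zero_of_mul hne), hx' (right_ne_zero_of_mul hne),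
    div_add_div _ _ (left_ne_zero_of_mul hne) (right_ne_zero_of_mul hne)]

theorem IsMeromorphicOn.div {κ : ℂ} {f g : V → ℂ} (hf : IsMeromorphicOn (hyperplane κ) f)
    (hg : IsMeromorphicOn (hyperplane κ) g)
    (hne : Generically (hyperplane κ) fun x => g x ≠ 0) :
    IsMeromorphicOn (hyperplane κ) fun x => f x / g x := fun p hp => by
  obtain ⟨F, G, hF, hG, h0, hr⟩ := hf p hp
  obtain ⟨F', G', hF', hG', h0', hr'⟩ := hg p hp
  have hF'0 : ∃ᶠ x in 𝓝[hyperplane κ] p, F' x ≠ 0 := by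
    obtain ⟨N, hN, hpN, hNG⟩ := generically_ne_of_frequently hp hG' h0'
    have h2 := hne.inter_open hN
    have : ∃ᶠ x in 𝓝[hyperplane κ] p, g x ≠ 0 ∧ G' x ≠ 0 := by
      refine Generically.frequently (N := N) ?_ hp hpN
      rw [generically_iff] at *
      exact h2.and hNG
    refine (this.and_eventually hr').mono ?_
    rintro x ⟨⟨h1, h2⟩, h3⟩ h4
    rw [h3 h2, h4, zero_div] at h1
    exact h1 rfl
  -- The factor `G'` is kept above and below, so that a nonzero denominator guarantees `G' x ≠ 0`,
  -- without which `g = F'/G'` is not available.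
  refine ⟨fun x => F x * G' x * G' x, fun x => G x * (F' x * G' x), (hF.mul hG').mul hG',
    hG.mul (hF'.mul hG'), frequently_mul_ne_zero hp hG (hF'.mul hG') h0
      (frequently_mul_ne_zero hp hF' hG' hF'0 h0'), ?_⟩
  filter_upwards [hr, hr'] with x hx hx' hne
  have h1 := left_ne_zero_of_mul hne
  have h2 := left_ne_zero_of_mul (right_ne_zero_of_mul hne)
  have h3 := right_ne_zero_of_mul (right_ne_zero_of_mul hne)
  rw [hx h1, hx' h3]
  field_simp

theorem IsMeromorphicOn.shift {κ κ' : ℂ} {f : V → ℂ} (hf : IsMeromorphicOn (hyperplane κ') f)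
    (v : V) (hv : κ + phi ⬝ᵥ v = κ') : IsMeromorphicOn (hyperplane κ) fun x => f (x + v) := by
  intro p hp
  have hmem : ∀ x, x ∈ hyperplane κ ↔ x + v ∈ hyperplane κ' := by
    intro x
    simp only [hyperplane, Set.mem_ofPred_eq, dotProduct_add, ← hv, add_left_inj]
  obtain ⟨F, G, hF, hG, h0, hr⟩ := hf (p + v) ((hmem p).1 hp)
  have hadd : AnalyticAt ℂ (fun x : V => x + v) p := analyticAt_id.add analyticAt_const
  have ht : map (fun x : V => x + v) (𝓝[hyperplane κ] p) = 𝓝[hyperplane κ'] (p + v) := by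
    have : (fun x : V => x + v) '' hyperplane κ = hyperplane κ' := by
      ext y
      constructor
      · rintro ⟨x, hx, rfl⟩; exact (hmem x).1 hx
      · intro hy; exact ⟨y - v, (hmem _).2 (by simpa using hy), by simp⟩
    rw [← this]
    exact (Homeomorph.addRight v).isEmbedding.map_nhdsWithin_eq (hyperplane κ) p
  rw [← ht] at h0 hr
  exact ⟨fun x => F (x + v), fun x => G (x + v),
    AnalyticAt.fun_comp (f := fun x : V => x + v) hF hadd,
    AnalyticAt.fun_comp (f := fun x : V => x + v) hG hadd,
    frequently_map.1 h0, eventually_map.1 hr⟩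


/-! ### The three-term relation -/

theorem exists_mul_ne_zero {f g : ℂ → ℂ} (hf : Differentiable ℂ f) (hg : Differentiable ℂ g)
    (hf0 : ∃ z, f z ≠ 0) (hg0 : ∃ z, g z ≠ 0) : ∃ z, f z * g z ≠ 0 := by
  by_contra! h
  rcases AnalyticOnNhd.eq_zero_or_eq_zero_of_mul_eq_zero (U := Set.univ)
    (fun z _ => hf.analyticAt z) (fun z _ => hg.analyticAt z) (fun z _ => h z)
    isPreconnected_univ with h0 | h0
  · exact hf0.elim fun z hz => hz (h0 z trivial)
  · exact hg0.elim fun z hz => hz (h0 z trivial)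

namespace IsThreeTerm

variable {br : ℂ → ℂ}

theorem exists_ne_zero (h : IsThreeTerm br) (s t : ℂ) :
    ∃ z, br (z + s) * br (z + t) ≠ 0 := by
  obtain ⟨z₀, hz₀⟩ := h.nonzero
  have hd : ∀ s, Differentiable ℂ fun z => br (z + s) := fun s =>
    h.entire.comp (differentiable_id.add_const s)
  exact exists_mul_ne_zero (hd s) (hd t) ⟨z₀ - s, by simpa using hz₀⟩ ⟨z₀ - t, by simpa using hz₀⟩

theorem map_zero (h : IsThreeTerm br) : br 0 = 0 := by
  have := h.three_term 0 0 0 0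
  simp only [add_zero, sub_zero] at this
  have : br 0 ^ 4 = 0 := by linear_combination this / 3
  exact pow_eq_zero_iff (by norm_num) |>.1 this

/-- With two parameters equal to `β` and the third `β + w`, the term containing `[0]` drops out and
the rest is `[z±β] [2β+w] ([-w] + [w]) = 0`. The choice of `β` makes `2β + w = z₀`, a point where
the bracket is nonzero. -/
theorem map_neg (h : IsThreeTerm br) (w : ℂ) : br (-w) = -br w := by
  obtain ⟨z₀, hz₀⟩ := h.nonzero
  set β : ℂ := (z₀ - w) / 2
  obtain ⟨z, hz⟩ := h.exists_ne_zero β (-β)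
  have := h.three_term z (β + w) β β
  rw [sub_self, h.map_zero, show β + (β + w) = z₀ by simp only [β]; ring,
    show β - (β + w) = -w by ring, show β + w + β = z₀ by simp only [β]; ring,
    show β + w - β = w by ring] at this
  have h2 : (br (z + β) * br (z + -β)) * (br z₀ * (br (-w) + br w)) = 0 := by
    rw [← sub_eq_add_neg z β]
    linear_combination this
  have h3 := (mul_eq_zero.1 ((mul_eq_zero.1 h2).resolve_left hz)).resolve_left hz₀
  exact eq_neg_of_add_eq_zero_left h3

/-- Taking `z = κ - α` and `γ = ω - α` puts a factor `[κ]` or `[ω]` into two of the terms. The third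
is `[α±β] [z₀] [κ-ω]`, since `α` is chosen with `κ + ω - 2α = z₀`. -/
theorem map_sub_eq_zero (h : IsThreeTerm br) {κ ω : ℂ} (hκ : br κ = 0) (hω : br ω = 0) :
    br (κ - ω) = 0 := by
  by_contra hne
  obtain ⟨z₀, hz₀⟩ := h.nonzero
  set α : ℂ := (κ + ω - z₀) / 2
  obtain ⟨β, hβ⟩ := h.exists_ne_zero α (-α)
  have := h.three_term (κ - α) α β (ω - α)
  rw [show κ - α + α = κ by ring, show ω - α + α = ω by ring, hκ, hω,
    show κ - α + (ω - α) = z₀ by simp only [α]; ring,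
    show κ - α - (ω - α) = κ - ω by ring, show α - β = -(β + -α) by ring, h.map_neg,
    add_comm α β] at this
  have h2 : (br (β + α) * br (β + -α)) * (br z₀ * br (κ - ω)) = 0 := by
    linear_combination -this
  exact mul_ne_zero hβ (mul_ne_zero hz₀ hne) h2

theorem analyticAt_comp_dot (h : IsThreeTerm br) (v p : V) :
    AnalyticAt ℂ (fun x : V => br (v ⬝ᵥ x)) p :=
  AnalyticAt.fun_comp (f := fun x : V => v ⬝ᵥ x) (h.entire.analyticAt _) (analyticAt_dot v p)

/-- Let `w` be the component of `v` orthogonal to `φ`. The hypothesis says `(v|w) ≠ 0`, so moving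
along `w` inside the hyperplane makes `(v|x)` take every complex value. -/
theorem generically_ne_zero (h : IsThreeTerm br) (κ : ℂ) {v : V}
    (hv : (phi ⬝ᵥ v) ^ 2 ≠ 2 * (v ⬝ᵥ v)) :
    Generically (hyperplane κ) fun x => br (v ⬝ᵥ x) ≠ 0 := by
  refine (isMeromorphicOn_of_analytic fun p _ =>
    h.analyticAt_comp_dot v p).zero_or_ne_zero.resolve_left fun hz => ?_
  obtain ⟨z₀, hz₀⟩ := h.nonzero
  obtain ⟨U, hU, hd, hz⟩ := hz
  have hall : ∀ x ∈ hyperplane κ, br (v ⬝ᵥ x) = 0 := by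
    intro x hx
    have hc : IsClosed {x : V | br (v ⬝ᵥ x) = 0} :=
      isClosed_eq (h.entire.continuous.comp (differentiable_dot v).continuous) continuous_const
    exact hc.closure_subset_iff.2 (fun y hy => hz y hy) (hd hx)
  set w : V := v - ((phi ⬝ᵥ v) / 2) • phi with hw
  have hvw : v ⬝ᵥ w ≠ 0 := by
    have : v ⬝ᵥ w = (2 * (v ⬝ᵥ v) - (phi ⬝ᵥ v) ^ 2) / 2 := by
      simp only [hw, dotProduct_sub, dotProduct_smul, smul_eq_mul, dotProduct_comm v phi]; ring
    rw [this]
    exact div_ne_zero (sub_ne_zero.2 hv.symm) two_ne_zero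
  -- The point of `H_κ` at which `(v|x) = z₀`.
  have hx : (κ / 2) • phi + ((z₀ - κ / 2 * (phi ⬝ᵥ v)) / (v ⬝ᵥ w)) • w ∈ hyperplane κ := by
    simp only [hyperplane, Set.mem_ofPred_eq, dotProduct_add, dotProduct_smul, smul_eq_mul,
      phi_dot_phi, hw, dotProduct_sub]
    ring
  refine hz₀ ?_
  rw [← hall _ hx]
  congr 1
  simp only [dotProduct_add, dotProduct_smul, smul_eq_mul, dotProduct_comm v phi]
  field_simp
  ring

end IsThreeTerm

/-! ### Hirota equations -/

/-- The left-hand side of the Hirota equation for the frame `a` at the point `x`. -/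
noncomputable def hirota (br : ℂ → ℂ) (δ : ℂ) (τ : V → ℂ) (a : Fin 3 → V) (x : V) : ℂ :=
  brPM br (a 1) (a 2) x * tauPM τ x (δ • a 0) +
  brPM br (a 2) (a 0) x * tauPM τ x (δ • a 1) +
  brPM br (a 0) (a 1) x * tauPM τ x (δ • a 2)

/-- The Hirota equations on `H_κ` for the frames with `(φ|a i) = s i`. -/
def HirotaType (br : ℂ → ℂ) (δ : ℂ) (τ : V → ℂ) (κ : ℂ) (s : Fin 3 → ℂ) : Prop :=
  ∀ a : Fin 3 → V, IsCFrame a → (∀ i, phi ⬝ᵥ a i = s i) →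
    Generically (hyperplane κ) fun x => hirota br δ τ a x = 0

theorem tauPM_neg (τ : V → ℂ) (x v : V) : tauPM τ x (-v) = tauPM τ x v := by
  simp only [tauPM, sub_neg_eq_add, ← sub_eq_add_neg, mul_comm]

theorem brPM_neg_right (br : ℂ → ℂ) (a b x : V) : brPM br a (-b) x = brPM br a b x := by
  simp only [brPM, sub_neg_eq_add, ← sub_eq_add_neg, mul_comm]

theorem brPM_swap {br : ℂ → ℂ} (hbr : IsThreeTerm br) (a b x : V) : brPM br b a x = -brPM br a b x := by
  simp only [brPM]
  rw [← neg_sub a b, neg_dotProduct, hbr.map_neg, add_comm b a]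
  ring

theorem brPM_neg_left {br : ℂ → ℂ} (hbr : IsThreeTerm br) (a b x : V) : brPM br (-a) b x = brPM br a b x := by
  rw [brPM_swap hbr, brPM_neg_right, brPM_swap hbr, neg_neg]

/-- This is the three-term relation at the values of the four linear forms. It makes the brackets
`[(a±b|x)]` behave like Plücker coordinates. -/
theorem brPM_plucker {br : ℂ → ℂ} (hbr : IsThreeTerm br) (a b c d x : V) :
    brPM br b c x * brPM br d a x + brPM br c a x * brPM br d b x +
      brPM br a b x * brPM br d c x = 0 := by
  simp only [brPM, add_dotProduct, sub_dotProduct]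
  exact hbr.three_term (d ⬝ᵥ x) (a ⬝ᵥ x) (b ⬝ᵥ x) (c ⬝ᵥ x)

theorem hirota_signs {br : ℂ → ℂ} (hbr : IsThreeTerm br) (δ : ℂ) (τ : V → ℂ)
    {a b : Fin 3 → V} (h : ∀ i, b i = a i ∨ b i = -a i)
    (x : V) : hirota br δ τ b x = hirota br δ τ a x := by
  have hb : ∀ i j, brPM br (b i) (b j) x = brPM br (a i) (a j) x := by
    intro i j
    rcases h i with hi | hi <;> rcases h j with hj | hj <;> rw [hi, hj] <;>
      simp only [brPM_neg_right, brPM_neg_left hbr]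
  have ht : ∀ i, tauPM τ x (δ • b i) = tauPM τ x (δ • a i) := by
    intro i
    rcases h i with hi | hi <;> rw [hi]
    rw [smul_neg, tauPM_neg]
  simp only [hirota, hb, ht]

theorem hirota_swap {br : ℂ → ℂ} (hbr : IsThreeTerm br) (δ : ℂ) (τ : V → ℂ) (a b c x : V) :
    hirota br δ τ ![a, c, b] x = -hirota br δ τ ![a, b, c] x := by
  simp only [hirota, Matrix.cons_val]
  rw [brPM_swap hbr b c, brPM_swap hbr a b, brPM_swap hbr c a]
  ring

theorem hirota_rotate (br : ℂ → ℂ) (δ : ℂ) (τ : V → ℂ) (a b c x : V) :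
    hirota br δ τ ![b, c, a] x = hirota br δ τ ![a, b, c] x := by
  simp only [hirota, Matrix.cons_val]
  ring

/-- A relation among the Hirota equations for the triples drawn from four vectors. -/
theorem hirota_elimination {br : ℂ → ℂ} (hbr : IsThreeTerm br) (δ : ℂ) (τ : V → ℂ) (a b c d x : V) :
    brPM br b d x * hirota br δ τ ![a, b, c] x =
      brPM br b c x * hirota br δ τ ![a, b, d] x - brPM br a b x * hirota br δ τ ![d, b, c] x := by
  simp only [hirota, Matrix.cons_val]
  have := brPM_plucker hbr a b c d x
  rw [brPM_swap hbr d b, brPM_swap hbr d c]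
  linear_combination (-tauPM τ x (δ • b)) * this

/-! ### Unions of parallel hyperplanes -/

/-- On distinct hyperplanes of the family the values of `(φ|x)` differ by at least `‖δ‖`, so each
one is isolated by an open strip and questions on `D_c` split into questions on single hyperplanes.
-/
theorem hyperplane_strip {c δ : ℂ} (hδ : δ ≠ 0) (n : ℤ) :
    IsOpen {x : V | ‖phi ⬝ᵥ x - (c + n * δ)‖ < ‖δ‖} ∧
      domainD c δ ∩ {x : V | ‖phi ⬝ᵥ x - (c + n * δ)‖ < ‖δ‖} = hyperplane (c + n * δ) := by
  constructor
  · have := (differentiable_dot phi).continuous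
    exact isOpen_lt (by fun_prop) continuous_const
  · ext x
    simp only [domainD, hyperplane, Set.mem_inter_iff, Set.mem_iUnion, Set.mem_ofPred_eq]
    constructor
    · rintro ⟨⟨m, hm⟩, h⟩
      rw [hm, show c + m * δ - (c + n * δ) = ((m - n : ℤ) : ℂ) * δ by push_cast; ring, norm_mul,
        Complex.norm_intCast] at h
      have h1 : |((m - n : ℤ) : ℝ)| < 1 := by
        by_contra! h1
        exact absurd h (not_lt.2 (le_mul_of_one_le_left (norm_nonneg _) h1))
      have h2 : m - n = 0 := by
        rw [← Int.cast_abs] at h1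
        exact Int.abs_lt_one_iff.1 (by exact_mod_cast h1)
      rw [hm, sub_eq_zero.1 h2]
    · intro h
      exact ⟨⟨n, h⟩, by simpa [h] using hδ⟩

theorem generically_domainD_iff {c δ : ℂ} (hδ : δ ≠ 0) {p : V → Prop} :
    Generically (domainD c δ) p ↔ ∀ n : ℤ, Generically (hyperplane (c + n * δ)) p := by
  constructor
  · intro h n
    rw [← (hyperplane_strip hδ n).2]
    exact h.inter_open (hyperplane_strip hδ n).1
  · intro h
    refine Generically.of_local fun x hx => ?_
    obtain ⟨n, hn⟩ := Set.mem_iUnion.1 hx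
    rw [← (hyperplane_strip hδ n).2] at hn
    exact ⟨_, (hyperplane_strip hδ n).1, hn.2, by rw [(hyperplane_strip hδ n).2]; exact h n⟩

theorem isMeromorphicOn_domainD {c δ : ℂ} (hδ : δ ≠ 0) {f : V → ℂ}
    (h : ∀ n : ℤ, IsMeromorphicOn (hyperplane (c + n * δ)) f) :
    IsMeromorphicOn (domainD c δ) f := by
  intro p hp
  obtain ⟨n, hn⟩ := Set.mem_iUnion.1 hp
  have hs := hyperplane_strip (c := c) hδ n
  have : 𝓝[domainD c δ] p = 𝓝[hyperplane (c + n * δ)] p := by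
    rw [← hs.2]
    refine (nhdsWithin_inter_of_mem' (mem_nhdsWithin_of_mem_nhds (hs.1.mem_nhds ?_))).symm
    rw [← hs.2] at hn
    exact hn.2
  rw [this]
  exact h n p hn


/-! ### The root lattice -/

/-- The vector with coordinates `v i / 2`. -/
noncomputable def half (v : Fin 8 → ℤ) : V := fun i => (v i : ℂ) / 2

theorem half_dot (v w : Fin 8 → ℤ) : half v ⬝ᵥ half w = ((∑ i, v i * w i : ℤ) : ℂ) / 4 := by
  simp only [half, dotProduct]
  push_cast
  rw [Finset.sum_div]
  exact Finset.sum_congr rfl fun i _ => by ring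

theorem phi_eq_half : phi = half fun _ => 1 := by
  ext i; simp [phi, half]

theorem phi_dot_half (v : Fin 8 → ℤ) : phi ⬝ᵥ half v = ((∑ i, v i : ℤ) : ℂ) / 4 := by
  rw [phi_eq_half, half_dot]; simp

/-- Doubled coordinates treat both cosets at once: the coset condition becomes common parity, and
`(φ|a)` becomes a quarter of the coordinate sum. -/
theorem mem_latticeP_iff {a : V} :
    a ∈ latticeP ↔ ∃ v : Fin 8 → ℤ, a = half v ∧ (∀ i, 2 ∣ v i - v 0) ∧ 4 ∣ ∑ i, v i := by
  have key : ∀ (v : Fin 8 → ℤ) (k : ℤ), phi ⬝ᵥ half v = k → 4 ∣ ∑ i, v i := by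
    intro v k hk
    rw [phi_dot_half] at hk
    refine ⟨k, ?_⟩
    have : ((∑ i, v i : ℤ) : ℂ) = ((4 * k : ℤ) : ℂ) := by
      push_cast at hk ⊢
      linear_combination 4 * hk
    exact_mod_cast this
  constructor
  · rintro ⟨⟨m, hm⟩ | ⟨m, hm⟩, k, hk⟩
    · have ha : a = half fun i => 2 * m i := by
        ext i; rw [hm]; simp [half]
      refine ⟨_, ha, fun i => ⟨m i - m 0, by ring⟩, key _ k (ha ▸ hk)⟩
    · have ha : a = half fun i => 2 * m i + 1 := by
        ext i; rw [hm]; simp [half, phi]; ring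
      refine ⟨_, ha, fun i => ⟨m i - m 0, by ring⟩, key _ k (ha ▸ hk)⟩
  · rintro ⟨v, rfl, hv, k, hk⟩
    refine ⟨?_, k, ?_⟩
    · choose m hm using hv
      rcases Int.even_or_odd' (v 0) with ⟨n, hn | hn⟩
      · refine Or.inl ⟨fun i => m i + n, fun i => ?_⟩
        have : v i = 2 * (m i + n) := by linarith [hm i]
        simp [half, this]
      · refine Or.inr ⟨fun i => m i + n, fun i => ?_⟩
        have : v i = 2 * (m i + n) + 1 := by linarith [hm i]
        simp [half, this, phi]; ring
    · rw [phi_dot_half, hk]; push_cast; ring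

theorem add_mem_latticeP {a b : V} (ha : a ∈ latticeP) (hb : b ∈ latticeP) :
    a + b ∈ latticeP := by
  obtain ⟨v, rfl, hv, hs⟩ := mem_latticeP_iff.1 ha
  obtain ⟨w, rfl, hw, ht⟩ := mem_latticeP_iff.1 hb
  refine mem_latticeP_iff.2 ⟨v + w, ?_, fun i => ?_, ?_⟩
  · ext i; simp [half]; ring
  · have := dvd_add (hv i) (hw i)
    simpa [add_sub_add_comm] using this
  · simpa [Finset.sum_add_distrib] using dvd_add hs ht

theorem neg_mem_latticeP {a : V} (ha : a ∈ latticeP) : -a ∈ latticeP := by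
  obtain ⟨v, rfl, hv, hs⟩ := mem_latticeP_iff.1 ha
  refine mem_latticeP_iff.2 ⟨-v, ?_, fun i => ?_, ?_⟩
  · ext i; simp [half]; ring
  · have := (dvd_neg.2 (hv i))
    simpa [neg_add_eq_sub] using this
  · simpa using hs

/-- The root lattice as an additive subgroup. -/
def latticeAddSubgroup : AddSubgroup V where
  carrier := latticeP
  zero_mem' := mem_latticeP_iff.2 ⟨0, by ext i; simp [half], by simp, by simp⟩
  add_mem' := add_mem_latticeP
  neg_mem' := neg_mem_latticeP

theorem zero_mem_latticeP : (0 : V) ∈ latticeP := latticeAddSubgroup.zero_mem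

theorem sub_mem_latticeP {a b : V} (ha : a ∈ latticeP) (hb : b ∈ latticeP) :
    a - b ∈ latticeP := latticeAddSubgroup.sub_mem ha hb

theorem zsmul_mem_latticeP {a : V} (ha : a ∈ latticeP) (k : ℤ) : (k : ℂ) • a ∈ latticeP := by
  rw [Int.cast_smul_eq_zsmul]
  exact latticeAddSubgroup.zsmul_mem ha k

theorem phi_mem_latticeP : phi ∈ latticeP :=
  mem_latticeP_iff.2 ⟨fun _ => 1, phi_eq_half, by simp, by simp⟩

/-- Write the doubled coordinates as `v i = v 0 + 2 m i`. The sum condition fixes `∑ m i` in terms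
of `v 0`, and then `∑ v i w i` is visibly a multiple of 4. -/
theorem latticeP_dot {a b : V} (ha : a ∈ latticeP) (hb : b ∈ latticeP) :
    ∃ k : ℤ, a ⬝ᵥ b = k := by
  obtain ⟨v, rfl, hv, s, hs⟩ := mem_latticeP_iff.1 ha
  obtain ⟨w, rfl, hw, t, ht⟩ := mem_latticeP_iff.1 hb
  choose m hm using hv
  choose n hn using hw
  have hv' : ∀ i, v i = v 0 + 2 * m i := fun i => by linarith [hm i]
  have hw' : ∀ i, w i = w 0 + 2 * n i := fun i => by linarith [hn i]
  have hs' : 8 * v 0 + 2 * ∑ i, m i = 4 * s := by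
    rw [← hs, Finset.sum_congr rfl fun i _ => hv' i, Finset.sum_add_distrib, Finset.mul_sum]; simp
  have ht' : 8 * w 0 + 2 * ∑ i, n i = 4 * t := by
    rw [← ht, Finset.sum_congr rfl fun i _ => hw' i, Finset.sum_add_distrib, Finset.mul_sum]; simp
  have key : ∑ i, v i * w i = 8 * (v 0 * w 0) + 2 * v 0 * ∑ i, n i + 2 * w 0 * ∑ i, m i
      + 4 * ∑ i, m i * n i := by
    rw [Finset.sum_congr rfl fun i _ => show v i * w i = v 0 * w 0 + 2 * v 0 * n i +
      2 * w 0 * m i + 4 * (m i * n i) by rw [hv' i, hw' i]; ring]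
    simp only [Finset.sum_add_distrib, ← Finset.mul_sum]
    simp
    ring
  refine ⟨-2 * v 0 * w 0 + v 0 * t + w 0 * s + ∑ i, m i * n i, ?_⟩
  have : ∑ i, v i * w i = 4 * (-2 * v 0 * w 0 + v 0 * t + w 0 * s + ∑ i, m i * n i) := by
    linear_combination key + v 0 * ht' + w 0 * hs'
  rw [half_dot, this]; push_cast; ring

/-- The lattice is even because `m (m - 1)` is even for every integer `m`. Positive definiteness
holds since the coordinates are real. -/
theorem latticeP_norm {a : V} (ha : a ∈ latticeP) :
    ∃ n : ℕ, a ⬝ᵥ a = 2 * n ∧ (n = 0 → a = 0) := by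
  obtain ⟨v, rfl, hv, s, hs⟩ := mem_latticeP_iff.1 ha
  choose m hm using hv
  have hv' : ∀ i, v i = v 0 + 2 * m i := fun i => by linarith [hm i]
  have hs' : 8 * v 0 + 2 * ∑ i, m i = 4 * s := by
    rw [← hs, Finset.sum_congr rfl fun i _ => hv' i, Finset.sum_add_distrib, Finset.mul_sum]; simp
  choose t ht using fun i => (Int.even_mul_pred_self (m i))
  have key : ∑ i, v i * v i = 8 * (v 0 * v 0) + (4 * v 0 + 4) * ∑ i, m i + 8 * ∑ i, t i := by
    rw [Finset.sum_congr rfl fun i _ => show v i * v i = v 0 * v 0 + (4 * v 0 + 4) * m i +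
      8 * t i by rw [hv' i]; linear_combination 4 * ht i]
    simp only [Finset.sum_add_distrib, ← Finset.mul_sum]
    simp
    ring
  have h8 : ∑ i, v i * v i = 8 * (-v 0 * v 0 + (v 0 + 1) * s - 2 * v 0 + ∑ i, t i) := by
    linear_combination key + (2 * v 0 + 2) * hs'
  have hnn : 0 ≤ ∑ i, v i * v i := Finset.sum_nonneg fun i _ => mul_self_nonneg (v i)
  obtain ⟨n, hn⟩ := Int.eq_ofNat_of_zero_le (a := -v 0 * v 0 + (v 0 + 1) * s - 2 * v 0 + ∑ i, t i)
    (by linarith)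
  refine ⟨n, ?_, fun h0 => ?_⟩
  · rw [half_dot, h8, hn]; push_cast; ring
  · rw [hn, h0] at h8
    have := (Finset.sum_eq_zero_iff_of_nonneg fun i _ => mul_self_nonneg (v i)).1
      (by simpa using h8)
    ext i
    have hi : v i = 0 := by simpa using this i (Finset.mem_univ i)
    simp [half, hi]

/-! ### Frames -/

/-- Congruence of all vectors to one `p` with `2p ∈ P` is symmetric in the frame, unlike the ordered
conditions of `IsCFrame`, and is easy to transport. -/
theorem isCFrame_of_sub {l : ℕ} {a : Fin l → V} {p : V}
    (ho : ∀ i j, a i ⬝ᵥ a j = if i = j then 1 else 0)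
    (hp : (2 : ℂ) • p ∈ latticeP) (ha : ∀ i, a i - p ∈ latticeP) : IsCFrame a where
  orthonormal := ho
  add_mem i j _ := by
    have := add_mem_latticeP (add_mem_latticeP (ha i) (ha j)) hp
    convert this using 1
    module
  sub_mem i j _ := by
    have := sub_mem_latticeP (ha i) (ha j)
    convert this using 1
    module
  two_mem i := by
    have := add_mem_latticeP (add_mem_latticeP (ha i) (ha i)) hp
    convert this using 1
    module

theorem IsCFrame.sub_mem' {l : ℕ} {a : Fin l → V} (h : IsCFrame a) (i j : Fin l) :
    a i - a j ∈ latticeP := by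
  rcases lt_trichotomy i j with hij | rfl | hij
  · exact h.sub_mem i j hij
  · simpa using zero_mem_latticeP
  · simpa using neg_mem_latticeP (h.sub_mem j i hij)

theorem IsCFrame.add_mem' {l : ℕ} {a : Fin l → V} (h : IsCFrame a) (i j : Fin l) :
    a i + a j ∈ latticeP := by
  have := add_mem_latticeP (h.sub_mem' i j) (h.two_mem j)
  convert this using 1
  module

theorem isCFrame_three {a b c : V} (haa : a ⬝ᵥ a = 1) (hbb : b ⬝ᵥ b = 1) (hcc : c ⬝ᵥ c = 1)
    (hab : a ⬝ᵥ b = 0) (hac : a ⬝ᵥ c = 0) (hbc : b ⬝ᵥ c = 0) (ha : (2 : ℂ) • a ∈ latticeP)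
    (hb : b - a ∈ latticeP) (hc : c - a ∈ latticeP) : IsCFrame ![a, b, c] := by
  refine isCFrame_of_sub (p := a) ?_ ha ?_
  · intro i j
    fin_cases i <;> fin_cases j <;>
      simp [haa, hbb, hcc, hab, hac, hbc, dotProduct_comm b a, dotProduct_comm c a,
        dotProduct_comm c b]
  · intro i
    fin_cases i
    · simpa using zero_mem_latticeP
    · simpa using hb
    · simpa using hc

theorem IsCFrame.signs {l : ℕ} {a b : Fin l → V} (h : IsCFrame a)
    (hb : ∀ i, b i = a i ∨ b i = -a i) : IsCFrame b := by
  rcases l with _ | l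
  · exact ⟨fun i => i.elim0, fun i => i.elim0, fun i => i.elim0, fun i => i.elim0⟩
  refine isCFrame_of_sub (p := a 0) ?_ (h.two_mem 0) ?_
  · intro i j
    have := h.orthonormal i j
    by_cases hij : i = j
    · subst hij
      rcases hb i with hi | hi <;> simpa [hi] using this
    · rw [if_neg hij] at this ⊢
      rcases hb i with hi | hi <;> rcases hb j with hj | hj <;> simp [hi, hj, this]
  · intro i
    rcases hb i with hi | hi
    · rw [hi]; exact h.sub_mem' i 0
    · rw [hi]
      have := neg_mem_latticeP (h.add_mem' i 0)
      convert this using 1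
      module

theorem IsCFrame.perm {l : ℕ} {a : Fin l → V} (h : IsCFrame a) (σ : Equiv.Perm (Fin l)) :
    IsCFrame (a ∘ σ) := by
  rcases l with _ | l
  · exact ⟨fun i => i.elim0, fun i => i.elim0, fun i => i.elim0, fun i => i.elim0⟩
  refine isCFrame_of_sub (p := a 0) (fun i j => ?_) (h.two_mem 0) fun i => h.sub_mem' _ _
  simp [h.orthonormal]

/-! ### Reflections in roots and their action on frames -/

/-- The orthogonal reflection in a root. -/
noncomputable def reflect (r x : V) : V := x - (r ⬝ᵥ x) • r

theorem reflect_dot {r : V} (hr : r ⬝ᵥ r = 2) (x y : V) :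
    reflect r x ⬝ᵥ reflect r y = x ⬝ᵥ y := by
  simp only [reflect, sub_dotProduct, dotProduct_sub, smul_dotProduct, dotProduct_smul,
    smul_eq_mul, hr, dotProduct_comm x r]
  ring

theorem reflect_reflect {r : V} (hr : r ⬝ᵥ r = 2) (x : V) : reflect r (reflect r x) = x := by
  simp only [reflect, dotProduct_sub, dotProduct_smul, smul_eq_mul, hr]
  module

theorem reflect_sub (r x y : V) : reflect r (x - y) = reflect r x - reflect r y := by
  simp only [reflect, dotProduct_sub]; module

theorem reflect_smul (r : V) (c : ℂ) (x : V) : reflect r (c • x) = c • reflect r x := by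
  simp only [reflect, dotProduct_smul, smul_eq_mul]; module

theorem reflect_neg (r x : V) : reflect r (-x) = -reflect r x := by
  simp only [reflect, dotProduct_neg]; module

theorem reflect_mem {r : V} (hr : r ∈ latticeP) {x : V} (hx : x ∈ latticeP) :
    reflect r x ∈ latticeP := by
  obtain ⟨k, hk⟩ := latticeP_dot hr hx
  rw [reflect, hk]
  exact sub_mem_latticeP hx (zsmul_mem_latticeP hr k)

theorem IsCFrame.reflect {l : ℕ} {a : Fin l → V} (h : IsCFrame a) {r : V} (hr : r ∈ latticeP)
    (hrr : r ⬝ᵥ r = 2) : IsCFrame fun i => reflect r (a i) := by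
  rcases l with _ | l
  · exact ⟨fun i => i.elim0, fun i => i.elim0, fun i => i.elim0, fun i => i.elim0⟩
  refine isCFrame_of_sub (p := ORG.reflect r (a 0)) (fun i j => ?_) ?_ fun i => ?_
  · rw [reflect_dot hrr, h.orthonormal]
  · rw [← reflect_smul]; exact reflect_mem hr (h.two_mem 0)
  · rw [← reflect_sub]; exact reflect_mem hr (h.sub_mem' i 0)

/-- Two unit vectors congruent modulo the lattice are orthogonal or equal up to sign. -/
theorem dot_eq_or {a b : V} (ha : a ⬝ᵥ a = 1) (hb : b ⬝ᵥ b = 1) (h2 : (2 : ℂ) • b ∈ latticeP)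
    (h : a - b ∈ latticeP) : a ⬝ᵥ b = 0 ∨ a = b ∨ a = -b := by
  have h' : a + b ∈ latticeP := by
    convert add_mem_latticeP h h2 using 1
    module
  obtain ⟨n, hn, hn0⟩ := latticeP_norm h
  obtain ⟨m, hm, hm0⟩ := latticeP_norm h'
  simp only [sub_dotProduct, dotProduct_sub, add_dotProduct, dotProduct_add, ha, hb,
    dotProduct_comm b a] at hn hm
  -- The norms of `a - b` and `a + b` are `2n` and `2m` with sum 4. The extreme cases give `a = ±b`,
  -- and `n = m = 1` gives orthogonality.
  have h1 : ((n + m : ℕ) : ℂ) = (2 : ℕ) := by push_cast; linear_combination -(hn + hm) / 2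
  have h1 : n + m = 2 := by exact_mod_cast h1
  rcases Nat.eq_zero_or_pos n with h0 | hpos
  · exact Or.inr (Or.inl (sub_eq_zero.1 (hn0 h0)))
  · rcases Nat.eq_zero_or_pos m with h0 | hpos'
    · exact Or.inr (Or.inr (eq_neg_of_add_eq_zero_left (hm0 h0)))
    · have : n = 1 := by omega
      subst this
      left
      push_cast at hn
      linear_combination -hn / 2


/-! ### Enumeration of integer vectors of given norm -/

/-- The lists of length `n` with entries in `S` and sum of squares `N`. -/
def vecsOfNormSq (S : List ℤ) : ℕ → ℕ → List (List ℤ)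
  | 0, 0 => [[]]
  | 0, _ + 1 => []
  | n + 1, N => S.flatMap fun c =>
      if c.natAbs * c.natAbs ≤ N then
        (vecsOfNormSq S n (N - c.natAbs * c.natAbs)).map (c :: ·) else []

theorem mem_vecsOfNormSq {S : List ℤ} {n N : ℕ} {l : List ℤ} :
    l ∈ vecsOfNormSq S n N ↔ l.length = n ∧ (∀ c ∈ l, c ∈ S) ∧
      (l.map fun c => c.natAbs * c.natAbs).sum = N := by
  induction n generalizing N l with
  | zero =>
    rcases N with _ | N
    · simp only [vecsOfNormSq, List.mem_singleton, List.length_eq_zero_iff]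
      exact ⟨fun h => by subst h; simp, fun h => h.1⟩
    · simp only [vecsOfNormSq, List.not_mem_nil, List.length_eq_zero_iff, false_iff]
      rintro ⟨rfl, -, h⟩
      simp at h
  | succ n ih =>
    simp only [vecsOfNormSq, List.mem_flatMap]
    constructor
    · rintro ⟨c, hc, hl⟩
      split_ifs at hl with h
      · obtain ⟨l', hl', rfl⟩ := List.mem_map.1 hl
        obtain ⟨h1, h2, h3⟩ := ih.1 hl'
        refine ⟨by simp [h1], by simpa [hc] using h2, ?_⟩
        simp only [List.map_cons, List.sum_cons, h3]
        omega
      · simp at hl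
    · rintro ⟨h1, h2, h3⟩
      rcases l with _ | ⟨c, l⟩
      · simp at h1
      · simp only [List.map_cons, List.sum_cons] at h3
        refine ⟨c, h2 c (by simp), ?_⟩
        rw [if_pos (by omega)]
        refine List.mem_map.2 ⟨l, ih.2 ⟨by simpa using h1, fun c hc => h2 c (by simp [hc]), ?_⟩, rfl⟩
        omega

theorem ofFn_mem_vecsOfNormSq {S : List ℤ} {n N : ℕ} {v : Fin n → ℤ} :
    List.ofFn v ∈ vecsOfNormSq S n N ↔ (∀ i, v i ∈ S) ∧ ∑ i, v i * v i = N := by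
  rw [mem_vecsOfNormSq]
  have : ((List.ofFn v).map fun c => c.natAbs * c.natAbs).sum = N ↔ ∑ i, v i * v i = N := by
    rw [List.map_ofFn, List.sum_ofFn, ← Nat.cast_inj (R := ℤ)]
    simp
  rw [this]
  simp

/-- The standard inner product of integer lists. -/
def listDot : List ℤ → List ℤ → ℤ
  | a :: l, b :: m => a * b + listDot l m
  | _, _ => 0

theorem listDot_ofFn {n : ℕ} (v w : Fin n → ℤ) :
    listDot (List.ofFn v) (List.ofFn w) = ∑ i, v i * w i := by
  induction n with
  | zero => simp [listDot]
  | succ n ih => simp [listDot, List.ofFn_succ, ih, Fin.sum_univ_succ]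

theorem exists_ofFn_of_mem {S : List ℤ} {n N : ℕ} {l : List ℤ} (h : l ∈ vecsOfNormSq S n N) :
    ∃ v : Fin n → ℤ, l = List.ofFn v := by
  obtain ⟨rfl, -⟩ := mem_vecsOfNormSq.1 h
  exact ⟨l.get, by simp⟩

theorem spinor_check : (vecsOfNormSq [-2, -1, 0, 1, 2] 8 4).all (fun u =>
    (vecsOfNormSq [1, -1] 8 8).any fun g => listDot u g == 2 && g.sum % 4 == 0) = true := by
  decide +kernel

/-- Provides a root `half g` whose reflection takes the doubled vector `2u` to `2u - g`, all of
whose entries are odd. It reduces `exists_frame` to the odd case. -/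
theorem exists_spinor {u : Fin 8 → ℤ} (hu : ∑ i, u i * u i = 4) :
    ∃ g : Fin 8 → ℤ, (∀ i, g i = 1 ∨ g i = -1) ∧ 4 ∣ ∑ i, g i ∧ ∑ i, u i * g i = 2 := by
  have hmem : List.ofFn u ∈ vecsOfNormSq [-2, -1, 0, 1, 2] 8 4 := by
    refine ofFn_mem_vecsOfNormSq.2 ⟨fun i => ?_, by simpa using hu⟩
    have h1 : u i * u i ≤ 4 := by
      rw [← hu]
      exact Finset.single_le_sum (f := fun i => u i * u i) (fun i _ => mul_self_nonneg (u i))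
        (Finset.mem_univ i)
    have h2 : u i ≤ 2 := by nlinarith
    have h3 : -2 ≤ u i := by nlinarith
    simp only [List.mem_cons, List.not_mem_nil, or_false]
    omega
  obtain ⟨l, hl, h⟩ := List.any_eq_true.1 (List.all_eq_true.1 spinor_check _ hmem)
  obtain ⟨g, rfl⟩ := exists_ofFn_of_mem hl
  have hg := (ofFn_mem_vecsOfNormSq.1 hl).1
  simp only [listDot_ofFn, Bool.and_eq_true, beq_iff_eq, List.sum_ofFn] at h
  exact ⟨g, fun i => by simpa using hg i, Int.dvd_of_emod_eq_zero h.2, h.1⟩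

/-! ### Completion of frames -/

/-- Let `t i = ±1` be congruent to `v i` modulo 4. The eight vectors `(t - 4 t_j e_j)/4` are
orthonormal, because `7 + 9 = 16`. -/
theorem exists_frame_of_odd {a : V} {v : Fin 8 → ℤ} (ha : (2 : ℂ) • a = half v)
    (hodd : ∀ i, v i % 2 = 1) (hv : ∑ i, v i * v i = 16) :
    ∃ b : Fin 8 → V, (∀ i j, b i ⬝ᵥ b j = if i = j then 1 else 0) ∧
      ∀ i, b i - a ∈ latticeP := by
  have ht : ∀ i, ∃ t m : ℤ, (t = 1 ∨ t = -1) ∧ v i = t + 4 * m := by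
    intro i
    have := hodd i
    rcases (by omega : v i % 4 = 1 ∨ v i % 4 = 3) with h | h
    · exact ⟨1, (v i - 1) / 4, Or.inl rfl, by omega⟩
    · exact ⟨-1, (v i + 1) / 4, Or.inr rfl, by omega⟩
  choose t m ht hm using ht
  have htt : ∀ i, t i * t i = 1 := fun i => by rcases ht i with h | h <;> simp [h]
  have hb : ∀ j, (fun i => ((t i - 4 * t j * (if i = j then 1 else 0) : ℤ) : ℂ) / 4 : V) =
      (1 / 2 : ℂ) • half fun i => t i - 4 * t j * (if i = j then 1 else 0) := by
    intro j; ext i; simp only [half, Pi.smul_apply, smul_eq_mul]; ring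
  refine ⟨fun j => (1 / 2 : ℂ) • half fun i => t i - 4 * t j * (if i = j then 1 else 0), ?_, ?_⟩
  · intro j k
    rw [smul_dotProduct, dotProduct_smul, half_dot]
    have : ∑ i, (t i - 4 * t j * (if i = j then 1 else 0)) *
        (t i - 4 * t k * (if i = k then 1 else 0)) = if j = k then 16 else 0 := by
      have : ∀ i, (t i - 4 * t j * (if i = j then 1 else 0)) *
        (t i - 4 * t k * (if i = k then 1 else 0)) = 1 - (if i = j then 4 * (t j * t i) else 0)
          - (if i = k then 4 * (t k * t i) else 0) +
          (if i = j then (if i = k then 16 * (t j * t k) else 0) else 0) := by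
        intro i
        split_ifs <;> linear_combination htt i
      rw [Finset.sum_congr rfl fun i _ => this i]
      simp only [Finset.sum_add_distrib, Finset.sum_sub_distrib, Finset.sum_ite_eq',
        Finset.mem_univ, if_true, htt]
      split_ifs with hjk
      · subst hjk; simp [htt]
      · simp
    rw [this]
    split_ifs <;> norm_num
  · intro j
    refine mem_latticeP_iff.2 ⟨fun i => -2 * m i - 2 * t j * (if i = j then 1 else 0), ?_, ?_, ?_⟩
    · have ha' : a = (1 / 2 : ℂ) • half v := by rw [← ha]; module
      rw [ha']
      ext i
      simp only [half, Pi.smul_apply, Pi.sub_apply, smul_eq_mul, hm i]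
      push_cast
      ring
    · intro i
      exact dvd_sub (dvd_sub (dvd_mul_of_dvd_left (by norm_num) _) ⟨t j * (if i = j then 1 else 0),
        by ring⟩) (dvd_sub (dvd_mul_of_dvd_left (by norm_num) _)
        ⟨t j * (if 0 = j then 1 else 0), by ring⟩)
    -- Here `b j - a = -m - t_j e_j`, which lies in `P` exactly when `∑ m i` is odd. The norm
    -- condition forces this.
    · have h1 : ∑ i, v i * v i = 8 + 8 * ∑ i, t i * m i + 16 * ∑ i, m i * m i := by
        rw [Finset.sum_congr rfl fun i _ => show v i * v i = 1 + 8 * (t i * m i) +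
          16 * (m i * m i) by rw [hm i]; linear_combination htt i]
        simp only [Finset.sum_add_distrib, ← Finset.mul_sum]
        simp
      have h2 : ∑ i, t i * m i = 1 - 2 * ∑ i, m i * m i := by linarith
      have h3 : ∀ i, ∃ s, t i * m i = m i + 2 * s := by
        intro i
        rcases ht i with h | h
        · exact ⟨0, by rw [h]; ring⟩
        · exact ⟨-m i, by rw [h]; ring⟩
      choose s hs using h3
      have h4 : ∑ i, t i * m i = ∑ i, m i + 2 * ∑ i, s i := by
        rw [Finset.sum_congr rfl fun i _ => hs i, Finset.sum_add_distrib, Finset.mul_sum]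
      have h5 : ∑ i, (-2 * m i - 2 * t j * (if i = j then 1 else 0)) =
          -2 * ∑ i, m i - 2 * t j := by
        simp [Finset.sum_sub_distrib, ← Finset.mul_sum]
      rw [h5]
      rcases ht j with h | h <;> rw [h] <;> omega

/-- The doubled coordinates `v` of `2a` are all odd or all even. An even vector is reflected into an
odd one, and the frame found there is reflected back. -/
theorem exists_frame {a : V} (haa : a ⬝ᵥ a = 1) (ha : (2 : ℂ) • a ∈ latticeP) :
    ∃ b : Fin 8 → V, (∀ i j, b i ⬝ᵥ b j = if i = j then 1 else 0) ∧
      ∀ i, b i - a ∈ latticeP := by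
  obtain ⟨v, hv, hpar, hs⟩ := mem_latticeP_iff.1 ha
  have ha' : a = (1 / 2 : ℂ) • half v := by rw [← hv]; module
  have hn : ∑ i, v i * v i = 16 := by
    rw [ha', smul_dotProduct, dotProduct_smul, half_dot] at haa
    have : ((∑ i, v i * v i : ℤ) : ℂ) = (16 : ℤ) := by
      simp only [smul_eq_mul] at haa
      push_cast at haa ⊢
      linear_combination 16 * haa
    exact_mod_cast this
  rcases Int.emod_two_eq_zero_or_one (v 0) with h0 | h1
  · have : ∀ i, ∃ u, v i = 2 * u := fun i => ⟨v i / 2, by have := hpar i; omega⟩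
    choose u hu using this
    have hun : ∑ i, u i * u i = 4 := by
      have : ∑ i, v i * v i = 4 * ∑ i, u i * u i := by
        rw [Finset.mul_sum]
        exact Finset.sum_congr rfl fun i _ => by rw [hu i]; ring
      omega
    obtain ⟨g, hg, hgs, hug⟩ := exists_spinor hun
    have hgg : ∀ i, g i * g i = 1 := fun i => by rcases hg i with h | h <;> simp [h]
    have hgmem : half g ∈ latticeP := by
      refine mem_latticeP_iff.2 ⟨g, rfl, fun i => ?_, hgs⟩
      rcases hg i with h | h <;> rcases hg 0 with h' | h' <;> rw [h, h'] <;> norm_num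
    have hgnorm : half g ⬝ᵥ half g = 2 := by
      rw [half_dot, Finset.sum_congr rfl fun i _ => hgg i]; norm_num
    have hgv : ∑ i, g i * v i = 4 := by
      have : ∑ i, g i * v i = 2 * ∑ i, u i * g i := by
        rw [Finset.mul_sum]
        exact Finset.sum_congr rfl fun i _ => by rw [hu i]; ring
      omega
    have hra : (2 : ℂ) • reflect (half g) a = half fun i => v i - g i := by
      rw [← reflect_smul, hv, reflect, half_dot, hgv]
      ext i
      simp [half]; ring
    obtain ⟨b, hb, hbm⟩ := exists_frame_of_odd hra
      (fun i => by rcases hg i with h | h <;> have := hu i <;> omega) (by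
        rw [Finset.sum_congr rfl fun i _ => show (v i - g i) * (v i - g i) =
          v i * v i - 2 * (g i * v i) + g i * g i by ring]
        simp only [Finset.sum_add_distrib, Finset.sum_sub_distrib, ← Finset.mul_sum, hn, hgv, hgg]
        norm_num)
    refine ⟨fun i => reflect (half g) (b i), fun i j => ?_, fun i => ?_⟩
    · rw [reflect_dot hgnorm, hb]
    · have := reflect_mem hgmem (hbm i)
      rwa [reflect_sub, reflect_reflect hgnorm] at this
  · exact exists_frame_of_odd hv (fun i => by have := hpar i; omega) hn

theorem parseval {b : Fin 8 → V} (hb : ∀ i j, b i ⬝ᵥ b j = if i = j then 1 else 0) (x y : V) :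
    ∑ j, (b j ⬝ᵥ x) * (b j ⬝ᵥ y) = x ⬝ᵥ y := by
  have h1 : Matrix.of b * (Matrix.of b).transpose = 1 := by
    ext i j
    rw [Matrix.mul_apply', Matrix.one_apply, ← hb i j]
    rfl
  have h2 := mul_eq_one_comm.1 h1
  calc ∑ j, (b j ⬝ᵥ x) * (b j ⬝ᵥ y)
      = (Matrix.of b).mulVec x ⬝ᵥ (Matrix.of b).mulVec y := rfl
    _ = x ⬝ᵥ y := by
      rw [Matrix.dotProduct_mulVec, Matrix.vecMul_mulVec, h2, Matrix.vecMul_one]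


theorem IsCFrame.exists_complete {l : ℕ} [NeZero l] {a : Fin l → V} (h : IsCFrame a) :
    ∃ b : Fin 8 → V, (∀ i j, b i ⬝ᵥ b j = if i = j then 1 else 0) ∧
      ∀ j i, b j - a i ∈ latticeP := by
  obtain ⟨b, hb, hba⟩ := exists_frame (a := a 0) (by simpa using h.orthonormal 0 0) (h.two_mem 0)
  refine ⟨b, hb, fun j i => ?_⟩
  have := sub_mem_latticeP (hba j) (h.sub_mem' i 0)
  convert this using 1
  module

/-- A `C_l`-frame with `l < 8` can be extended. -/
theorem IsCFrame.exists_orthogonal {l : ℕ} [NeZero l] {a : Fin l → V} (h : IsCFrame a)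
    (hl : l < 8) : ∃ b : V, b ⬝ᵥ b = 1 ∧ (∀ i, b ⬝ᵥ a i = 0) ∧ ∀ i, b - a i ∈ latticeP := by
  obtain ⟨b, hb, hba⟩ := h.exists_complete
  -- Count the pairs with `b j = ± a i`. By Parseval each `a i` matches exactly one `b j`, so if
  -- every `b j` met some `a i` there would be at least eight vectors `a i`.
  by_contra! hcon
  have hex : ∀ j, ∃ i, b j ⬝ᵥ a i ≠ 0 := by
    intro j
    by_contra! h0
    obtain ⟨i, hi⟩ := hcon (b j) (by simpa using hb j j) h0
    exact hi (hba j i)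
  have hval : ∀ j i, (b j ⬝ᵥ a i) * (b j ⬝ᵥ a i) = ((if b j ⬝ᵥ a i = 0 then 0 else 1 : ℕ) : ℂ) := by
    intro j i
    have hii : a i ⬝ᵥ a i = 1 := by simpa using h.orthonormal i i
    rcases dot_eq_or (by simpa using hb j j) hii (h.two_mem i) (hba j i) with h0 | h0 | h0
    · simp [h0]
    · simp [h0, hii]
    · simp [h0, hii]
  have hsum : ∀ i, ∑ j, (if b j ⬝ᵥ a i = 0 then 0 else 1 : ℕ) = 1 := by
    intro i
    have := parseval hb (a i) (a i)
    rw [Finset.sum_congr rfl fun j _ => hval j i, h.orthonormal i i, if_pos rfl] at this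
    exact_mod_cast this
  have h8 : 8 ≤ ∑ j : Fin 8, ∑ i, (if b j ⬝ᵥ a i = 0 then 0 else 1 : ℕ) := by
    calc 8 = ∑ j : Fin 8, 1 := by simp
      _ ≤ _ := by
        refine Finset.sum_le_sum fun j _ => ?_
        obtain ⟨i, hi⟩ := hex j
        have := Finset.single_le_sum (f := fun i => if b j ⬝ᵥ a i = 0 then 0 else 1)
          (fun i _ => Nat.zero_le _) (Finset.mem_univ i)
        simpa [hi] using this
  rw [Finset.sum_comm, Finset.sum_congr rfl fun i _ => hsum i] at h8
  simp at h8
  omega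

/-- A `C_3`-frame orthogonal to `φ` extends by a vector with `(φ|b) = 1`. -/
theorem IsCFrame.exists_phi_one {a : Fin 3 → V} (h : IsCFrame a) (h0 : ∀ i, phi ⬝ᵥ a i = 0) :
    ∃ b : V, b ⬝ᵥ b = 1 ∧ (∀ i, b ⬝ᵥ a i = 0) ∧ (∀ i, b - a i ∈ latticeP) ∧ phi ⬝ᵥ b = 1 := by
  obtain ⟨b, hb, hba⟩ := h.exists_complete
  have hk : ∀ j, ∃ k : ℤ, phi ⬝ᵥ b j = k := by
    intro j
    obtain ⟨k, hk⟩ := latticeP_dot phi_mem_latticeP (hba j 0)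
    exact ⟨k, by rw [← hk, dotProduct_sub, h0, sub_zero]⟩
  choose k hk using hk
  -- Parseval for `φ` itself. Hence some `k j` is `±1`, and such a `b j` cannot be `± a i`, because
  -- every `a i` is orthogonal to `φ`.
  have hsum : ∑ j, k j * k j = 2 := by
    have := parseval hb phi phi
    rw [phi_dot_phi] at this
    simp only [dotProduct_comm _ phi, hk] at this
    exact_mod_cast this
  obtain ⟨j, hj⟩ : ∃ j, k j ≠ 0 := by
    by_contra! h
    simp [h] at hsum
  have hle : k j * k j ≤ 2 := by
    rw [← hsum]
    exact Finset.single_le_sum (f := fun i => k i * k i) (fun i _ => mul_self_nonneg (k i))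
      (Finset.mem_univ j)
  have hj1 : k j = 1 ∨ k j = -1 := by
    have h1 : k j ≤ 1 := by nlinarith
    have h2 : -1 ≤ k j := by nlinarith
    omega
  have horth : ∀ i, b j ⬝ᵥ a i = 0 := by
    intro i
    rcases dot_eq_or (by simpa using hb j j) (by simpa using h.orthonormal i i) (h.two_mem i)
      (hba j i) with h' | h' | h'
    · exact h'
    · exact absurd (by exact_mod_cast (show (k j : ℂ) = 0 by rw [← hk, h', h0])) hj
    · exact absurd (by exact_mod_cast (show (k j : ℂ) = 0 by rw [← hk, h']; simp [h0])) hj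
  rcases hj1 with h1 | h1
  · exact ⟨b j, by simpa using hb j j, horth, hba j, by rw [hk, h1]; simp⟩
  · refine ⟨-b j, by simpa using hb j j, fun i => by simp [horth], fun i => ?_,
      by simp [hk, h1]⟩
    have := neg_mem_latticeP (add_mem_latticeP (hba j i) (h.two_mem i))
    convert this using 1
    module

/-- The possible values of `(φ|a)`. -/
theorem phi_dot_unit {a : V} (haa : a ⬝ᵥ a = 1) (ha : (2 : ℂ) • a ∈ latticeP) :
    ∃ k : ℤ, phi ⬝ᵥ a = (k : ℂ) / 2 ∧ -2 ≤ k ∧ k ≤ 2 := by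
  have key : ∀ a : V, a ⬝ᵥ a = 1 → (2 : ℂ) • a ∈ latticeP → ∀ k : ℤ, phi ⬝ᵥ a = (k : ℂ) / 2 →
      k ≤ 2 := by
    intro a haa ha k hk
    -- The norm of `2a - φ` is `6 - 2k`, so `k ≤ 3`. Equality would give `2a = φ`, whose norms 4 and
    -- 2 disagree.
    obtain ⟨n, hn, hn0⟩ := latticeP_norm (sub_mem_latticeP ha phi_mem_latticeP)
    simp only [sub_dotProduct, dotProduct_sub, smul_dotProduct, dotProduct_smul, smul_eq_mul,
      dotProduct_comm a phi, phi_dot_phi, haa, hk] at hn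
    have h1 : ((3 - k : ℤ) : ℂ) = (n : ℤ) := by push_cast; linear_combination hn / 2
    have h1 : 3 - k = n := by exact_mod_cast h1
    by_contra! h
    have h3 : n = 0 := by omega
    have := sub_eq_zero.1 (hn0 h3)
    have h4 := phi_dot_phi
    rw [← this] at h4
    simp [haa] at h4
  obtain ⟨k, hk⟩ := latticeP_dot phi_mem_latticeP ha
  rw [dotProduct_smul, smul_eq_mul] at hk
  have hk' : phi ⬝ᵥ a = (k : ℂ) / 2 := by linear_combination hk / 2
  refine ⟨k, hk', ?_, key a haa ha k hk'⟩
  have := key (-a) (by simpa using haa) (by simpa using neg_mem_latticeP ha) (-k)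
    (by rw [dotProduct_neg, hk']; push_cast; ring)
  omega

/-- The lattice vector `a + b - φ` has norm `2 - 4 + 2 = 0`. -/
theorem add_eq_phi {a b : V} (haa : a ⬝ᵥ a = 1) (hbb : b ⬝ᵥ b = 1) (hab : a ⬝ᵥ b = 0)
    (hmem : a + b ∈ latticeP) (ha : phi ⬝ᵥ a = 1) (hb : phi ⬝ᵥ b = 1) : a + b = phi := by
  obtain ⟨n, hn, hn0⟩ := latticeP_norm (sub_mem_latticeP hmem phi_mem_latticeP)
  refine sub_eq_zero.1 (hn0 ?_)
  have h1 : (n : ℂ) = (0 : ℕ) := by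
    simp only [sub_dotProduct, dotProduct_sub, add_dotProduct, dotProduct_add,
      dotProduct_comm a phi, dotProduct_comm b phi, dotProduct_comm b a, phi_dot_phi, haa, hbb,
      hab, ha, hb] at hn
    push_cast
    linear_combination -hn / 2
  exact_mod_cast h1

theorem parity_cases {x y z : ℕ} {m n : ℤ} (hx : x ≤ 2) (hy : y ≤ 2) (hz : z ≤ 2)
    (hm : (x : ℤ) - y = 2 * m) (hn : (x : ℤ) - z = 2 * n) (h : ¬ (x = 2 ∧ y = 2 ∧ z = 2)) :
    (x = 1 ∧ y = 1 ∧ z = 1) ∨ (x = 0 ∧ y = 0 ∧ z = 0) ∨ (x = 2 ∧ y = 0 ∧ z = 0) ∨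
      (x = 0 ∧ y = 2 ∧ z = 0) ∨ (x = 0 ∧ y = 0 ∧ z = 2) ∨ (x = 2 ∧ y = 2 ∧ z = 0) ∨
      (x = 2 ∧ y = 0 ∧ z = 2) ∨ (x = 0 ∧ y = 2 ∧ z = 2) := by
  interval_cases x <;> interval_cases y <;> interval_cases z <;> simp at h ⊢ <;> omega

/-- Up to signs and order, every `C_3`-frame is of one of four types. -/
theorem IsCFrame.classification {a : Fin 3 → V} (h : IsCFrame a) :
    ∃ (b : Fin 3 → V) (σ : Equiv.Perm (Fin 3)), IsCFrame b ∧ (∀ i, b i = a i ∨ b i = -a i) ∧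
      ((∀ i, phi ⬝ᵥ b i = 1 / 2) ∨
        (∀ i, phi ⬝ᵥ (b ∘ σ) i = ![0, 0, 0] i) ∨ (∀ i, phi ⬝ᵥ (b ∘ σ) i = ![1, 0, 0] i) ∨
        (∀ i, phi ⬝ᵥ (b ∘ σ) i = ![1, 1, 0] i)) := by
  have hk : ∀ i, ∃ (k : ℕ) (c : V), (c = a i ∨ c = -a i) ∧ phi ⬝ᵥ c = (k : ℂ) / 2 ∧ k ≤ 2 := by
    intro i
    obtain ⟨k, hk, hl, hu⟩ := phi_dot_unit (by simpa using h.orthonormal i i) (h.two_mem i)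
    rcases le_total 0 k with h0 | h0
    · refine ⟨k.toNat, a i, Or.inl rfl, ?_, by omega⟩
      rw [hk]; congr 1
      exact_mod_cast (Int.toNat_of_nonneg h0).symm
    · refine ⟨(-k).toNat, -a i, Or.inr rfl, ?_, by omega⟩
      rw [dotProduct_neg, hk, ← neg_div]; congr 1
      exact_mod_cast (Int.toNat_of_nonneg (neg_nonneg.2 h0)).symm
  choose k b hb hk hle using hk
  have hF := h.signs hb
  have hpar : ∀ i j, ∃ m : ℤ, (k i : ℤ) - k j = 2 * m := by
    intro i j
    obtain ⟨m, hm⟩ := latticeP_dot phi_mem_latticeP (hF.sub_mem' i j)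
    rw [dotProduct_sub, hk, hk] at hm
    refine ⟨m, ?_⟩
    have : (((k i : ℤ) - k j : ℤ) : ℂ) = ((2 * m : ℤ) : ℂ) := by
      push_cast; linear_combination 2 * hm
    exact_mod_cast this
  obtain ⟨m1, hm1⟩ := hpar 0 1
  obtain ⟨m2, hm2⟩ := hpar 0 2
  have horth : ∀ i j, i ≠ j → k i = 2 → k j = 2 → b i + b j = phi := by
    intro i j hij hi hj
    refine add_eq_phi (by simpa using hF.orthonormal i i) (by simpa using hF.orthonormal j j)
      (by simpa [hij] using hF.orthonormal i j) (hF.add_mem' i j) ?_ ?_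
    · rw [hk, hi]; norm_num
    · rw [hk, hj]; norm_num
  -- If all three pairings were 1, two of the vectors would add up to `φ`, and the third would be
  -- orthogonal to `φ`.
  have h3 : ¬ (k 0 = 2 ∧ k 1 = 2 ∧ k 2 = 2) := by
    rintro ⟨h0, h1, h2⟩
    have e := horth 0 1 (by decide) h0 h1
    have e2 : phi ⬝ᵥ b 2 = 1 := by rw [hk, h2]; norm_num
    rw [← e, add_dotProduct, hF.orthonormal, hF.orthonormal] at e2
    simp at e2
  have hle0 := hle 0
  have hle1 := hle 1
  have hle2 := hle 2
  have hcases := parity_cases hle0 hle1 hle2 hm1 hm2 h3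
  have h01 : (Equiv.swap (0 : Fin 3) 1) 2 = 2 := by decide
  have h02 : (Equiv.swap (0 : Fin 3) 2) 1 = 1 := by decide
  have h12 : (Equiv.swap (1 : Fin 3) 2) 0 = 0 := by decide
  rcases hcases with h | h | h | h | h | h | h | h <;> obtain ⟨h0, h1, h2⟩ := h
  · exact ⟨b, 1, hF, hb, Or.inl fun i => by fin_cases i <;> simp [*]⟩
  · exact ⟨b, 1, hF, hb, Or.inr (Or.inl fun i => by fin_cases i <;> simp [*])⟩
  · exact ⟨b, 1, hF, hb, Or.inr (Or.inr (Or.inl fun i => by fin_cases i <;> simp [*]))⟩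
  · exact ⟨b, Equiv.swap 0 1, hF, hb,
      Or.inr (Or.inr (Or.inl fun i => by fin_cases i <;> simp [*]))⟩
  · exact ⟨b, Equiv.swap 0 2, hF, hb,
      Or.inr (Or.inr (Or.inl fun i => by fin_cases i <;> simp [*]))⟩
  · exact ⟨b, 1, hF, hb, Or.inr (Or.inr (Or.inr fun i => by fin_cases i <;> simp [*]))⟩
  · exact ⟨b, Equiv.swap 1 2, hF, hb,
      Or.inr (Or.inr (Or.inr fun i => by fin_cases i <;> simp [*]))⟩
  · exact ⟨b, Equiv.swap 0 2, hF, hb,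
      Or.inr (Or.inr (Or.inr fun i => by fin_cases i <;> simp [*]))⟩


/-! ### Connectedness of the frames with `(φ|a 0) = 1` -/

/-- Twice the roots orthogonal to `φ`, as integer lists. -/
def rootsPerpPhi : List (List ℤ) :=
  (vecsOfNormSq [-2, 0, 2] 8 8 ++ vecsOfNormSq [-1, 1] 8 8).filter fun v => v.sum == 0

theorem mem_rootsPerpPhi {r : V} (hr : r ∈ latticeP) (hrr : r ⬝ᵥ r = 2) (h0 : phi ⬝ᵥ r = 0) :
    ∃ v : Fin 8 → ℤ, r = half v ∧ List.ofFn v ∈ rootsPerpPhi := by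
  obtain ⟨v, rfl, hpar, -⟩ := mem_latticeP_iff.1 hr
  refine ⟨v, rfl, ?_⟩
  have h8 : ∑ i, v i * v i = 8 := by
    rw [half_dot] at hrr
    have : ((∑ i, v i * v i : ℤ) : ℂ) = (8 : ℤ) := by push_cast at hrr ⊢; linear_combination 4 * hrr
    exact_mod_cast this
  have hs : ∑ i, v i = 0 := by
    rw [phi_dot_half] at h0
    have : ((∑ i, v i : ℤ) : ℂ) = (0 : ℤ) := by push_cast at h0 ⊢; linear_combination 4 * h0
    exact_mod_cast this
  have hb : ∀ i, -2 ≤ v i ∧ v i ≤ 2 := by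
    intro i
    have : v i * v i ≤ 8 := by
      rw [← h8]
      exact Finset.single_le_sum (f := fun i => v i * v i) (fun i _ => mul_self_nonneg (v i))
        (Finset.mem_univ i)
    constructor <;> nlinarith
  rw [rootsPerpPhi, List.mem_filter, List.mem_append, ofFn_mem_vecsOfNormSq,
    ofFn_mem_vecsOfNormSq]
  refine ⟨?_, by rw [List.sum_ofFn, hs]; rfl⟩
  rcases Int.emod_two_eq_zero_or_one (v 0) with h | h
  · refine Or.inl ⟨fun i => ?_, by simpa using h8⟩
    have := hpar i
    have := hb i
    simp only [List.mem_cons, List.not_mem_nil, or_false]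
    omega
  · refine Or.inr ⟨fun i => ?_, by simpa using h8⟩
    have := hpar i
    have := hb i
    simp only [List.mem_cons, List.not_mem_nil, or_false]
    omega

theorem of_mem_rootsPerpPhi {l : List ℤ} (hl : l ∈ rootsPerpPhi) :
    ∃ v : Fin 8 → ℤ, l = List.ofFn v ∧ half v ∈ latticeP ∧ half v ⬝ᵥ half v = 2 ∧
      phi ⬝ᵥ half v = 0 := by
  rw [rootsPerpPhi, List.mem_filter, List.mem_append] at hl
  obtain ⟨hl, hs⟩ := hl
  obtain ⟨v, rfl⟩ : ∃ v : Fin 8 → ℤ, l = List.ofFn v := hl.elim exists_ofFn_of_mem exists_ofFn_of_mem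
  rw [ofFn_mem_vecsOfNormSq, ofFn_mem_vecsOfNormSq] at hl
  have hs : ∑ i, v i = 0 := by rwa [beq_iff_eq, List.sum_ofFn] at hs
  refine ⟨v, rfl, mem_latticeP_iff.2 ⟨v, rfl, fun i => ?_, by simp [hs]⟩, ?_, ?_⟩
  · rcases hl with ⟨h, -⟩ | ⟨h, -⟩
    · have h1 := h i
      have h2 := h 0
      simp only [List.mem_cons, List.not_mem_nil, or_false] at h1 h2
      omega
    · have h1 := h i
      have h2 := h 0
      simp only [List.mem_cons, List.not_mem_nil, or_false] at h1 h2
      omega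
  · have : ∑ i, v i * v i = 8 := by rcases hl with h | h <;> simpa using h.2
    rw [half_dot, this]; norm_num
  · rw [phi_dot_half, hs]; simp

/-- On doubled vectors `listDot` is four times the form: 4 means inner product 1, and 8 is the norm
of a root. The check shows that the graph of moves is connected: from any other root some neighbour
is strictly closer to the base root. The bound 8 makes the climb terminate. -/
theorem climb_check : rootsPerpPhi.all (fun a => a == [2, -2, 0, 0, 0, 0, 0, 0] ||
    rootsPerpPhi.any fun b => listDot a b == 4 &&
      (decide (listDot b [2, -2, 0, 0, 0, 0, 0, 0] ≤ 8) &&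
      decide (listDot a [2, -2, 0, 0, 0, 0, 0, 0] < listDot b [2, -2, 0, 0, 0, 0, 0, 0]))) = true := by
  decide +kernel

/-- For `r` orthogonal to the base root `α` this finds `β` with `(β|r) = (β|α) = 1`, the corner of
the triangle used in `IsTypeOneClosed.loop`. -/
theorem loop_check : rootsPerpPhi.all (fun r => !(listDot r [2, -2, 0, 0, 0, 0, 0, 0] == 0) ||
    rootsPerpPhi.any fun b => listDot b r == 4 &&
      listDot b [2, -2, 0, 0, 0, 0, 0, 0] == 4) = true := by
  decide +kernel

/-- The base root. -/
def baseRoot : Fin 8 → ℤ := ![2, -2, 0, 0, 0, 0, 0, 0]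

theorem exists_climb {v : Fin 8 → ℤ} (hv : List.ofFn v ∈ rootsPerpPhi) (hne : v ≠ baseRoot) :
    ∃ w : Fin 8 → ℤ, List.ofFn w ∈ rootsPerpPhi ∧ ∑ i, v i * w i = 4 ∧
      ∑ i, w i * baseRoot i ≤ 8 ∧ ∑ i, v i * baseRoot i < ∑ i, w i * baseRoot i := by
  have hb : [2, -2, 0, 0, 0, 0, 0, 0] = List.ofFn baseRoot := by simp [baseRoot]
  have := List.all_eq_true.1 climb_check _ hv
  rw [hb, Bool.or_eq_true, beq_iff_eq, List.any_eq_true] at this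
  rcases this with h | ⟨l, hl, h⟩
  · exact absurd (List.ofFn_injective h) hne
  · obtain ⟨w, rfl, -⟩ := of_mem_rootsPerpPhi hl
    simp only [listDot_ofFn, Bool.and_eq_true, beq_iff_eq, decide_eq_true_eq] at h
    exact ⟨w, hl, h.1, h.2.1, h.2.2⟩

theorem exists_loop {v : Fin 8 → ℤ} (hv : List.ofFn v ∈ rootsPerpPhi)
    (h0 : ∑ i, v i * baseRoot i = 0) :
    ∃ w : Fin 8 → ℤ, List.ofFn w ∈ rootsPerpPhi ∧ ∑ i, w i * v i = 4 ∧
      ∑ i, w i * baseRoot i = 4 := by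
  have hb : [2, -2, 0, 0, 0, 0, 0, 0] = List.ofFn baseRoot := by simp [baseRoot]
  have := List.all_eq_true.1 loop_check _ hv
  rw [hb, listDot_ofFn, h0, Bool.or_eq_true, List.any_eq_true] at this
  rcases this with h | ⟨l, hl, h⟩
  · simp at h
  · obtain ⟨w, rfl, -⟩ := of_mem_rootsPerpPhi hl
    simp only [listDot_ofFn, Bool.and_eq_true, beq_iff_eq] at h
    exact ⟨w, hl, h.1, h.2⟩

/-- The `C_3`-frames `{±a, ±b, ±c}` with `(φ|a) = 1` and `(φ|b) = (φ|c) = 0`. -/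
structure IsTypeOne (a b c : V) : Prop where
  frame : IsCFrame ![a, b, c]
  phi_a : phi ⬝ᵥ a = 1
  phi_b : phi ⬝ᵥ b = 0
  phi_c : phi ⬝ᵥ c = 0

namespace IsTypeOne

variable {a b c : V}

theorem aa (h : IsTypeOne a b c) : a ⬝ᵥ a = 1 := by simpa using h.frame.orthonormal 0 0
theorem bb (h : IsTypeOne a b c) : b ⬝ᵥ b = 1 := by simpa using h.frame.orthonormal 1 1
theorem cc (h : IsTypeOne a b c) : c ⬝ᵥ c = 1 := by simpa using h.frame.orthonormal 2 2
theorem ab (h : IsTypeOne a b c) : a ⬝ᵥ b = 0 := by simpa using h.frame.orthonormal 0 1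
theorem ac (h : IsTypeOne a b c) : a ⬝ᵥ c = 0 := by simpa using h.frame.orthonormal 0 2
theorem bc (h : IsTypeOne a b c) : b ⬝ᵥ c = 0 := by simpa using h.frame.orthonormal 1 2

theorem two_a (h : IsTypeOne a b c) : (2 : ℂ) • a ∈ latticeP := by simpa using h.frame.two_mem 0
theorem two_b (h : IsTypeOne a b c) : (2 : ℂ) • b ∈ latticeP := by simpa using h.frame.two_mem 1
theorem two_c (h : IsTypeOne a b c) : (2 : ℂ) • c ∈ latticeP := by simpa using h.frame.two_mem 2
theorem ba_mem (h : IsTypeOne a b c) : b - a ∈ latticeP := by simpa using h.frame.sub_mem' 1 0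
theorem ca_mem (h : IsTypeOne a b c) : c - a ∈ latticeP := by simpa using h.frame.sub_mem' 2 0
theorem bc_mem (h : IsTypeOne a b c) : b - c ∈ latticeP := by simpa using h.frame.sub_mem' 1 2

theorem swap (h : IsTypeOne a b c) : IsTypeOne a c b where
  frame := isCFrame_three h.aa h.cc h.bb h.ac h.ab (by rw [dotProduct_comm]; exact h.bc) h.two_a
    h.ca_mem h.ba_mem
  phi_a := h.phi_a
  phi_b := h.phi_c
  phi_c := h.phi_b

theorem neg_b (h : IsTypeOne a b c) : IsTypeOne a (-b) c where
  frame := h.frame.signs fun i => by fin_cases i <;> simp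
  phi_a := h.phi_a
  phi_b := by simp [h.phi_b]
  phi_c := h.phi_c

theorem phi_dot_reflect {r : V} (h0 : phi ⬝ᵥ r = 0) (x : V) :
    phi ⬝ᵥ ORG.reflect r x = phi ⬝ᵥ x := by
  simp [ORG.reflect, h0]

theorem reflected (h : IsTypeOne a b c) {r : V} (hr : r ∈ latticeP) (hrr : r ⬝ᵥ r = 2)
    (h0 : phi ⬝ᵥ r = 0) :
    IsTypeOne (ORG.reflect r a) (ORG.reflect r b) (ORG.reflect r c) where
  frame := by
    have := h.frame.reflect hr hrr
    convert this using 1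
    ext i
    fin_cases i <;> rfl
  phi_a := by rw [phi_dot_reflect h0, h.phi_a]
  phi_b := by rw [phi_dot_reflect h0, h.phi_b]
  phi_c := by rw [phi_dot_reflect h0, h.phi_c]

/-- The root `2 a - φ`. -/
theorem root (h : IsTypeOne a b c) : (2 : ℂ) • a - phi ∈ latticeP ∧
    ((2 : ℂ) • a - phi) ⬝ᵥ ((2 : ℂ) • a - phi) = 2 ∧ phi ⬝ᵥ ((2 : ℂ) • a - phi) = 0 := by
  refine ⟨sub_mem_latticeP h.two_a phi_mem_latticeP, ?_, ?_⟩ <;>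
  simp only [sub_dotProduct, dotProduct_sub, smul_dotProduct, dotProduct_smul, smul_eq_mul,
      dotProduct_comm a phi, phi_dot_phi, h.aa, h.phi_a] <;> norm_num

end IsTypeOne

/-- A family of type one frames, closed under signs, exchange, and the reflections in roots `r`
orthogonal to `φ` with `(r|a) = 1/2`. -/
structure IsTypeOneClosed (G : V → V → V → Prop) : Prop where
  swap : ∀ a b c, G a b c → G a c b
  neg : ∀ a b c, G a b c → G a (-b) c
  move : ∀ a b c r, IsTypeOne a b c → r ∈ latticeP → r ⬝ᵥ r = 2 → phi ⬝ᵥ r = 0 →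
    r ⬝ᵥ a = 1 / 2 → G a b c → G (reflect r a) (reflect r b) (reflect r c)

/-- The unit vector `(φ + α)/2` for the base root `α`. -/
noncomputable def baseA : V := (1 / 2 : ℂ) • (phi + half baseRoot)

/-- Completing `baseA` to a frame, the first vector. -/
noncomputable def baseB : V := (1 / 2 : ℂ) • half ![1, 1, 3, -1, -1, -1, -1, -1]

/-- Completing `baseA` to a frame, the second vector. -/
noncomputable def baseC : V := (1 / 2 : ℂ) • half ![1, 1, -1, 3, -1, -1, -1, -1]

theorem baseA_eq : baseA = (1 / 2 : ℂ) • half ![3, -1, 1, 1, 1, 1, 1, 1] := by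
  rw [baseA, phi_eq_half]
  congr 1
  ext i
  fin_cases i <;> simp [half, baseRoot] <;> norm_num

theorem half_dot_eq {v w : Fin 8 → ℤ} (k : ℤ) (h : ∑ i, v i * w i = 4 * k) :
    half v ⬝ᵥ half w = k := by
  rw [half_dot, h]; push_cast; ring

theorem isTypeOne_base : IsTypeOne baseA baseB baseC := by
  have hm : ∀ v : Fin 8 → ℤ, (∀ i, 2 ∣ v i - v 0) → 4 ∣ ∑ i, v i → half v ∈ latticeP :=
    fun v h1 h2 => mem_latticeP_iff.2 ⟨v, rfl, h1, h2⟩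
  rw [baseA_eq, baseB, baseC]
  refine ⟨isCFrame_three ?_ ?_ ?_ ?_ ?_ ?_ ?_ ?_ ?_, ?_, ?_, ?_⟩
  · rw [smul_dotProduct, dotProduct_smul, half_dot_eq 4 (by decide)]; norm_num
  · rw [smul_dotProduct, dotProduct_smul, half_dot_eq 4 (by decide)]; norm_num
  · rw [smul_dotProduct, dotProduct_smul, half_dot_eq 4 (by decide)]; norm_num
  · rw [smul_dotProduct, dotProduct_smul, half_dot_eq 0 (by decide)]; norm_num
  · rw [smul_dotProduct, dotProduct_smul, half_dot_eq 0 (by decide)]; norm_num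
  · rw [smul_dotProduct, dotProduct_smul, half_dot_eq 0 (by decide)]; norm_num
  · rw [smul_smul, show (2 : ℂ) * (1 / 2) = 1 by norm_num, one_smul]
    exact hm _ (by decide) (by decide)
  · have := hm ![-1, 1, 1, -1, -1, -1, -1, -1] (by decide) (by decide)
    convert this using 1
    ext i
    fin_cases i <;> simp [half] <;> norm_num
  · have := hm ![-1, 1, -1, 1, -1, -1, -1, -1] (by decide) (by decide)
    convert this using 1
    ext i
    fin_cases i <;> simp [half] <;> norm_num
  · rw [phi_eq_half, dotProduct_smul, half_dot_eq 2 (by decide)]; norm_num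
  · rw [phi_eq_half, dotProduct_smul, half_dot_eq 0 (by decide)]; norm_num
  · rw [phi_eq_half, dotProduct_smul, half_dot_eq 0 (by decide)]; norm_num

/-- In the `A₂` system spanned by `r` and `s`, the reflection in `r + s` equals `s_s s_r s_s`. -/
theorem reflect_three {r s : V} (hr : r ⬝ᵥ r = 2) (hs : s ⬝ᵥ s = 2) (hrs : r ⬝ᵥ s = -1) (x : V) :
    reflect (-r - s) (reflect s (reflect r x)) = reflect s x := by
  simp only [reflect, dotProduct_sub, sub_dotProduct, neg_dotProduct, dotProduct_smul, smul_eq_mul,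
    hr, hs, hrs, dotProduct_comm s r]
  module

namespace IsTypeOneClosed

variable {G : V → V → V → Prop}

/-- The reflection in `r` fixes `baseA`, so it is not itself a move. It is the composite of three
moves around the triangle of roots `α → β → β - r → α`, by `reflect_three`. -/
theorem loop (hG : IsTypeOneClosed G) {b c r : V} (h : IsTypeOne baseA b c) (hr : r ∈ latticeP)
    (hrr : r ⬝ᵥ r = 2) (h0 : phi ⬝ᵥ r = 0) (hra : r ⬝ᵥ baseA = 0) (hg : G baseA b c) :
    G baseA (reflect r b) (reflect r c) := by
  obtain ⟨v, rfl, hv⟩ := mem_rootsPerpPhi hr hrr h0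
  set α := half baseRoot with hα
  have hrα : half v ⬝ᵥ α = 0 := by
    rw [baseA, dotProduct_smul, dotProduct_add, dotProduct_comm, h0] at hra
    simpa using hra
  have hvb : ∑ i, v i * baseRoot i = 0 := by
    rw [hα, half_dot] at hrα
    have : ((∑ i, v i * baseRoot i : ℤ) : ℂ) = (0 : ℤ) := by
      push_cast at hrα ⊢; linear_combination 4 * hrα
    exact_mod_cast this
  obtain ⟨w, hw, hwv, hwb⟩ := exists_loop hv hvb
  obtain ⟨w', hw', hmem, hww, hw0⟩ := of_mem_rootsPerpPhi hw
  obtain rfl := List.ofFn_injective hw'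
  have hβr : half w ⬝ᵥ half v = 1 := by simpa using half_dot_eq 1 (by simpa using hwv)
  have hβα : half w ⬝ᵥ α = 1 := by simpa using half_dot_eq 1 (by simpa using hwb)
  generalize half v = r at *
  generalize half w = β at *
  have hα1 : α ∈ latticeP ∧ α ⬝ᵥ α = 2 ∧ phi ⬝ᵥ α = 0 := by
    have := h.root
    rwa [show (2 : ℂ) • baseA - phi = α by rw [baseA]; module] at this
  obtain ⟨hαm, hαα, hα0⟩ := hα1
  have hA : baseA = (1 / 2 : ℂ) • (phi + α) := rfl
  clear_value α
  have e1 : (α - β) ⬝ᵥ (α - β) = 2 := by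
    simp only [sub_dotProduct, dotProduct_sub, hαα, hww, hβα, dotProduct_comm α β]; norm_num
  have e2 : phi ⬝ᵥ (α - β) = 0 := by rw [dotProduct_sub, hα0, hw0, sub_zero]
  have m1 := sub_mem_latticeP hαm hmem
  have s1 := hG.move _ _ _ (α - β) h m1 e1 e2 (by
    rw [hA]
    simp only [dotProduct_smul, dotProduct_add, sub_dotProduct, dotProduct_comm α phi,
      dotProduct_comm β phi, hα0, hw0, hαα, hβα, smul_eq_mul]
    norm_num) hg
  have t1 := h.reflected m1 e1 e2
  have a1 : reflect (α - β) baseA = (1 / 2 : ℂ) • (phi + β) := by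
    rw [hA, reflect_smul, reflect]
    simp only [dotProduct_add, sub_dotProduct, dotProduct_comm α phi,
      dotProduct_comm β phi, hα0, hw0, hαα, hβα]
    module
  have s2 := hG.move _ _ _ r t1 hr hrr h0 (by
    rw [a1]
    simp only [dotProduct_smul, dotProduct_add, dotProduct_comm r phi,
      dotProduct_comm r β, h0, hβr, smul_eq_mul]
    norm_num) s1
  have t2 := t1.reflected hr hrr h0
  have e3 : (α - β) ⬝ᵥ r = -1 := by
    rw [sub_dotProduct, dotProduct_comm α r, hrα, hβr]; norm_num
  have e4 : (-(α - β) - r) ⬝ᵥ (-(α - β) - r) = 2 := by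
    simp only [sub_dotProduct (-(α - β)), dotProduct_sub _ (-(α - β)), neg_dotProduct,
      dotProduct_neg, e1, e3, hrr, dotProduct_comm r (α - β)]
    norm_num
  have s3 := hG.move _ _ _ (-(α - β) - r) t2
    (sub_mem_latticeP (neg_mem_latticeP m1) hr) e4
    (by rw [dotProduct_sub, dotProduct_neg, e2, h0]; simp) (by
    rw [a1, reflect_smul, reflect]
    simp only [dotProduct_smul, dotProduct_add, dotProduct_sub, sub_dotProduct, neg_dotProduct,
      dotProduct_comm r phi, dotProduct_comm r β, dotProduct_comm α phi, dotProduct_comm α β,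
      dotProduct_comm α r, hrα, hrr,
      dotProduct_comm β phi, h0, hβr, smul_eq_mul, hα0, hw0, hβα, hww]
    norm_num) s2
  simp only [reflect_three e1 hrr e3] at s3
  have a2 : reflect r baseA = baseA := by rw [reflect, hra]; simp
  rwa [a2] at s3

/-- Frame vectors are exchanged one at a time. If `p ⊥ b`, the reflection in the root `p - b` fixes
`baseA` and sends `p` to `b`. The second exchange leaves the vector already placed alone, since it
is orthogonal to both. -/
theorem base (hG : IsTypeOneClosed G) (hbase : G baseA baseB baseC) {b c : V}
    (h : IsTypeOne baseA b c) : G baseA b c := by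
  have replace_b : ∀ p q b c, IsTypeOne baseA p q → G baseA p q → IsTypeOne baseA b c →
      ∃ q', IsTypeOne baseA b q' ∧ G baseA b q' ∧ (p ⬝ᵥ c = 0 → c = q → c = q') ∧
        (q ⬝ᵥ b = 0 → q' = q) := by
    intro p q b c hpq hg hbc
    have hmem : b - p ∈ latticeP := by
      convert sub_mem_latticeP hbc.ba_mem hpq.ba_mem using 1
      module
    rcases dot_eq_or hbc.bb hpq.bb hpq.two_b hmem with h0 | h0 | h0
    · have e : (p - b) ⬝ᵥ (p - b) = 2 := by
        simp only [sub_dotProduct, dotProduct_sub, hpq.bb, hbc.bb, h0, dotProduct_comm p b]; norm_num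
      have m : p - b ∈ latticeP := by simpa using neg_mem_latticeP hmem
      have e0 : phi ⬝ᵥ (p - b) = 0 := by rw [dotProduct_sub, hpq.phi_b, hbc.phi_b, sub_zero]
      have ea : (p - b) ⬝ᵥ baseA = 0 := by
        rw [sub_dotProduct, dotProduct_comm, hpq.ab, dotProduct_comm, hbc.ab, sub_zero]
      have ep : reflect (p - b) p = b := by
        rw [reflect, sub_dotProduct, hpq.bb, h0]; module
      have eA : reflect (p - b) baseA = baseA := by rw [reflect, ea]; simp
      have hl := hG.loop hpq m e e0 ea hg
      have ht := hpq.reflected m e e0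
      rw [ep] at hl ht
      rw [eA] at ht
      have eq : q ⬝ᵥ b = 0 → reflect (p - b) q = q := by
        intro hqb
        rw [reflect, sub_dotProduct, hpq.bc, dotProduct_comm b q, hqb]; simp
      refine ⟨_, ht, hl, ?_, eq⟩
      rintro - rfl
      exact (eq (by rw [dotProduct_comm]; exact hbc.bc)).symm
    · subst h0
      exact ⟨q, hpq, hg, fun _ h => h, fun _ => rfl⟩
    · subst h0
      exact ⟨q, hpq.neg_b, hG.neg _ _ _ hg, fun _ h => h, fun _ => rfl⟩
  obtain ⟨q, hq, hgq, -⟩ := replace_b _ _ b c isTypeOne_base hbase h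
  obtain ⟨q', -, hg', -, hq'⟩ := replace_b q b c b hq.swap (hG.swap _ _ _ hgq) h.swap
  rw [hq' h.bc] at hg'
  exact hG.swap _ _ _ hg'

/-- Induction on the defect `8 - ∑ v i * baseRoot i` of the doubled root `v` of `2a - φ`. It
decreases along the climb and ends at `baseA`. -/
theorem all (hG : IsTypeOneClosed G) (hbase : G baseA baseB baseC) {a b c : V}
    (h : IsTypeOne a b c) : G a b c := by
  have main : ∀ (N : ℕ) (a b c : V) (v : Fin 8 → ℤ), IsTypeOne a b c →
      (2 : ℂ) • a - phi = half v → List.ofFn v ∈ rootsPerpPhi →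
      (8 - ∑ i, v i * baseRoot i).toNat ≤ N → G a b c := by
    intro N
    induction N with
    | zero =>
      intro a b c v h ha hv hN
      by_cases hvb : v = baseRoot
      · have : a = baseA := by rw [baseA, ← hvb, ← ha]; module
        subst this
        exact hG.base hbase h
      · obtain ⟨w, -, -, h1, h2⟩ := exists_climb hv hvb
        omega
    | succ N ih =>
      intro a b c v h ha hv hN
      by_cases hvb : v = baseRoot
      · have : a = baseA := by rw [baseA, ← hvb, ← ha]; module
        subst this
        exact hG.base hbase h
      · obtain ⟨w, hw, hvw, h1, h2⟩ := exists_climb hv hvb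
        obtain ⟨w', hw', hmem, hww, hw0⟩ := of_mem_rootsPerpPhi hw
        obtain rfl := List.ofFn_injective hw'
        obtain ⟨hvm, hvv, hv0⟩ := h.root
        rw [ha] at hvm hvv hv0
        have hvw1 : half v ⬝ᵥ half w = 1 := by simpa using half_dot_eq 1 (by simpa using hvw)
        have ha' : a = (1 / 2 : ℂ) • (phi + half v) := by rw [← ha]; module
        have e : (half w - half v) ⬝ᵥ (half w - half v) = 2 := by
          simp only [sub_dotProduct, dotProduct_sub, hvv, hww, hvw1,
            dotProduct_comm (half w) (half v)]
          norm_num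
        have m := sub_mem_latticeP hmem hvm
        have e0 : phi ⬝ᵥ (half w - half v) = 0 := by rw [dotProduct_sub, hv0, hw0, sub_zero]
        have ht := h.reflected m e e0
        have hra : reflect (half w - half v) a = (1 / 2 : ℂ) • (phi + half w) := by
          rw [ha', reflect_smul, reflect]
          simp only [dotProduct_add, sub_dotProduct, dotProduct_comm (half v) phi,
            dotProduct_comm (half w) phi, hv0, hw0, hvv, hvw1, dotProduct_comm (half w) (half v)]
          module
        have hg := ih _ _ _ w ht (by rw [hra]; module) hw (by omega)
        -- The induction hypothesis holds at the reflected frame, and the same involution brings it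
        -- back.
        have := hG.move _ _ _ _ ht m e e0 (by
          rw [hra]
          simp only [dotProduct_smul, dotProduct_add, sub_dotProduct, dotProduct_comm (half v) phi,
            dotProduct_comm (half w) phi, hv0, hw0, hww, hvw1, smul_eq_mul]
          norm_num) hg
        simpa only [reflect_reflect e] using this
  obtain ⟨h1, h2, h3⟩ := h.root
  obtain ⟨v, hv, hvm⟩ := mem_rootsPerpPhi h1 h2 h3
  exact main _ a b c v h hv hvm le_rfl

end IsTypeOneClosed


/-! ### Propagation of the Hirota equations from frame to frame -/

theorem hirota_eq (br : ℂ → ℂ) (δ : ℂ) (τ : V → ℂ) (a b c x : V) :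
    hirota br δ τ ![a, b, c] x =
      br (b ⬝ᵥ x + c ⬝ᵥ x) * br (b ⬝ᵥ x - c ⬝ᵥ x) * (τ (x + δ • a) * τ (x - δ • a)) +
      br (c ⬝ᵥ x + a ⬝ᵥ x) * br (c ⬝ᵥ x - a ⬝ᵥ x) * (τ (x + δ • b) * τ (x - δ • b)) +
      br (a ⬝ᵥ x + b ⬝ᵥ x) * br (a ⬝ᵥ x - b ⬝ᵥ x) * (τ (x + δ • c) * τ (x - δ • c)) := by
  simp only [hirota, Matrix.cons_val, brPM, tauPM, add_dotProduct, sub_dotProduct]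

namespace IsTypeOne

variable {a b c r : V}

theorem bc_add_mem (h : IsTypeOne a b c) : b + c ∈ latticeP := by
  convert add_mem_latticeP h.bc_mem h.two_c using 1
  module

theorem ab_add_mem (h : IsTypeOne a b c) : a + b ∈ latticeP := by
  convert add_mem_latticeP h.ba_mem h.two_a using 1
  module

/-- The frame of half-integral type relating the frame `a, b, c` to its reflection. -/
theorem isCFrame_half (h : IsTypeOne a b c) (hr : r ∈ latticeP) (hrr : r ⬝ᵥ r = 2)
    (hra : r ⬝ᵥ a = 1 / 2) (hrb : r ⬝ᵥ b = -1 / 2) (hrc : r ⬝ᵥ c = -1 / 2) :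
    IsCFrame ![(1 / 2 : ℂ) • (a + b - r), (1 / 2 : ℂ) • (a + b + r),
      (1 / 2 : ℂ) • (a - b - r) - c] := by
  have hdot : ∀ x : V, x ⬝ᵥ r = r ⬝ᵥ x := fun x => dotProduct_comm x r
  refine isCFrame_three ?_ ?_ ?_ ?_ ?_ ?_ ?_ ?_ ?_
  iterate 6
    simp only [smul_dotProduct, dotProduct_smul, add_dotProduct, dotProduct_add, sub_dotProduct,
      dotProduct_sub, smul_eq_mul, hdot, hrr, hra, hrb, hrc, h.aa, h.bb, h.cc, h.ab, h.ac, h.bc,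
      dotProduct_comm b a, dotProduct_comm c a, dotProduct_comm c b]
    norm_num
  · convert sub_mem_latticeP h.ab_add_mem hr using 1
    module
  · convert hr using 1
    module
  · convert neg_mem_latticeP h.bc_add_mem using 1
    module

/-- For `x` in `H_κ` and `a`, `b`, `c`, `r` as in `IsTypeOne.move`, this centre brings only values
on `H_{κ-δ}` and `H_κ` into play. The value `τ(x + δ(b+c-a+r))` is symmetric in `b` and `c`, so it
can be eliminated against the equation with `b` and `c` exchanged. -/
theorem hirota_half {br : ℂ → ℂ} (hbr : IsThreeTerm br) (δ : ℂ) (τ : V → ℂ)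
    (h : IsTypeOne a b c) (hrr : r ⬝ᵥ r = 2)
    (hra : r ⬝ᵥ a = 1 / 2) (hrb : r ⬝ᵥ b = -1 / 2) (hrc : r ⬝ᵥ c = -1 / 2) (x : V) :
    hirota br δ τ ![(1 / 2 : ℂ) • (a + b - r), (1 / 2 : ℂ) • (a + b + r),
      (1 / 2 : ℂ) • (a - b - r) - c] (x + (δ / 2) • (b - a + r)) =
    br (a ⬝ᵥ x - c ⬝ᵥ x) * br (b ⬝ᵥ x + c ⬝ᵥ x + (r ⬝ᵥ x + δ / 2)) *
      (τ (x + δ • b) * τ (x - δ • a + δ • r)) -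
    br (a ⬝ᵥ x - c ⬝ᵥ x - (r ⬝ᵥ x + δ / 2)) * br (b ⬝ᵥ x + c ⬝ᵥ x) *
      (τ (x + δ • b + δ • r) * τ (x - δ • a)) -
    br (a ⬝ᵥ x + b ⬝ᵥ x) * br (r ⬝ᵥ x + δ / 2) *
      (τ (x - δ • c) * τ (x + δ • (b + c - a + r))) := by
  have hdot : ∀ x : V, x ⬝ᵥ r = r ⬝ᵥ x := fun x => dotProduct_comm x r
  set z := x + (δ / 2) • (b - a + r) with hz
  have d1 : (1 / 2 : ℂ) • (a + b - r) ⬝ᵥ z =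
      (a ⬝ᵥ x + b ⬝ᵥ x) / 2 - (r ⬝ᵥ x + δ / 2) / 2 := by
    simp only [hz, smul_dotProduct, dotProduct_smul, add_dotProduct, dotProduct_add,
      sub_dotProduct, dotProduct_sub, smul_eq_mul, hdot a, hdot b, hrr, hra, hrb, h.aa, h.bb, h.ab,
      dotProduct_comm b a]
    ring
  have d2 : (1 / 2 : ℂ) • (a + b + r) ⬝ᵥ z =
      (a ⬝ᵥ x + b ⬝ᵥ x) / 2 + (r ⬝ᵥ x + δ / 2) / 2 := by
    simp only [hz, smul_dotProduct, dotProduct_smul, add_dotProduct, dotProduct_add,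
      dotProduct_sub, smul_eq_mul, hdot a, hdot b, hrr, hra, hrb, h.aa, h.bb, h.ab,
      dotProduct_comm b a]
    ring
  have d3 : ((1 / 2 : ℂ) • (a - b - r) - c) ⬝ᵥ z =
      (a ⬝ᵥ x - b ⬝ᵥ x) / 2 - c ⬝ᵥ x - (r ⬝ᵥ x + δ / 2) / 2 := by
    simp only [hz, smul_dotProduct, dotProduct_smul, dotProduct_add,
      sub_dotProduct, dotProduct_sub, smul_eq_mul, hdot a, hdot b, hdot c, hrr, hra, hrb, hrc,
      h.aa, h.bb, h.ab, h.ac, h.bc, dotProduct_comm b a, dotProduct_comm c a, dotProduct_comm c b]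
    ring
  have t1 : z + δ • (1 / 2 : ℂ) • (a + b - r) = x + δ • b := by rw [hz]; module
  have t2 : z - δ • (1 / 2 : ℂ) • (a + b - r) = x - δ • a + δ • r := by rw [hz]; module
  have t3 : z + δ • (1 / 2 : ℂ) • (a + b + r) = x + δ • b + δ • r := by rw [hz]; module
  have t4 : z - δ • (1 / 2 : ℂ) • (a + b + r) = x - δ • a := by rw [hz]; module
  have t5 : z + δ • ((1 / 2 : ℂ) • (a - b - r) - c) = x - δ • c := by rw [hz]; module
  have t6 : z - δ • ((1 / 2 : ℂ) • (a - b - r) - c) = x + δ • (b + c - a + r) := by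
    rw [hz]; module
  clear_value z
  rw [hirota_eq, d1, d2, d3, t1, t2, t3, t4, t5, t6]
  rw [show (a ⬝ᵥ x + b ⬝ᵥ x) / 2 + (r ⬝ᵥ x + δ / 2) / 2 +
      ((a ⬝ᵥ x - b ⬝ᵥ x) / 2 - c ⬝ᵥ x - (r ⬝ᵥ x + δ / 2) / 2) = a ⬝ᵥ x - c ⬝ᵥ x by ring,
    show (a ⬝ᵥ x + b ⬝ᵥ x) / 2 + (r ⬝ᵥ x + δ / 2) / 2 -
      ((a ⬝ᵥ x - b ⬝ᵥ x) / 2 - c ⬝ᵥ x - (r ⬝ᵥ x + δ / 2) / 2) =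
      b ⬝ᵥ x + c ⬝ᵥ x + (r ⬝ᵥ x + δ / 2) by ring,
    show (a ⬝ᵥ x - b ⬝ᵥ x) / 2 - c ⬝ᵥ x - (r ⬝ᵥ x + δ / 2) / 2 +
      ((a ⬝ᵥ x + b ⬝ᵥ x) / 2 - (r ⬝ᵥ x + δ / 2) / 2) =
      a ⬝ᵥ x - c ⬝ᵥ x - (r ⬝ᵥ x + δ / 2) by ring,
    show (a ⬝ᵥ x - b ⬝ᵥ x) / 2 - c ⬝ᵥ x - (r ⬝ᵥ x + δ / 2) / 2 -
      ((a ⬝ᵥ x + b ⬝ᵥ x) / 2 - (r ⬝ᵥ x + δ / 2) / 2) = -(b ⬝ᵥ x + c ⬝ᵥ x) by ring,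
    show (a ⬝ᵥ x + b ⬝ᵥ x) / 2 - (r ⬝ᵥ x + δ / 2) / 2 +
      ((a ⬝ᵥ x + b ⬝ᵥ x) / 2 + (r ⬝ᵥ x + δ / 2) / 2) = a ⬝ᵥ x + b ⬝ᵥ x by ring,
    show (a ⬝ᵥ x + b ⬝ᵥ x) / 2 - (r ⬝ᵥ x + δ / 2) / 2 -
      ((a ⬝ᵥ x + b ⬝ᵥ x) / 2 + (r ⬝ᵥ x + δ / 2) / 2) = -(r ⬝ᵥ x + δ / 2) by ring,
    hbr.map_neg, hbr.map_neg]
  ring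

/-- Since `reflect r a = a - r/2`, centring at `x + (δ/2) r` makes the reflected equation contain
the same outer value `τ(x + δa)` as the original equation at `x`. -/
theorem hirota_reflect (br : ℂ → ℂ) (δ : ℂ) (τ : V → ℂ)
    (hrr : r ⬝ᵥ r = 2)
    (hra : r ⬝ᵥ a = 1 / 2) (hrb : r ⬝ᵥ b = -1 / 2) (hrc : r ⬝ᵥ c = -1 / 2) (x : V) :
    hirota br δ τ ![reflect r a, reflect r b, reflect r c] (x + (δ / 2) • r) =
      br (b ⬝ᵥ x + c ⬝ᵥ x + (r ⬝ᵥ x + δ / 2)) * br (b ⬝ᵥ x - c ⬝ᵥ x) *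
        (τ (x + δ • a) * τ (x - δ • a + δ • r)) +
      br (c ⬝ᵥ x + a ⬝ᵥ x) * br (c ⬝ᵥ x - a ⬝ᵥ x + (r ⬝ᵥ x + δ / 2)) *
        (τ (x + δ • b + δ • r) * τ (x - δ • b)) +
      br (a ⬝ᵥ x + b ⬝ᵥ x) * br (a ⬝ᵥ x - b ⬝ᵥ x - (r ⬝ᵥ x + δ / 2)) *
        (τ (x + δ • c + δ • r) * τ (x - δ • c)) := by
  have hdot : ∀ x : V, x ⬝ᵥ r = r ⬝ᵥ x := fun x => dotProduct_comm x r
  have ea : reflect r a = a - (1 / 2 : ℂ) • r := by rw [reflect, hra]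
  have eb : reflect r b = b + (1 / 2 : ℂ) • r := by rw [reflect, hrb]; module
  have ec : reflect r c = c + (1 / 2 : ℂ) • r := by rw [reflect, hrc]; module
  rw [hirota_eq, ea, eb, ec]
  have da : (a - (1 / 2 : ℂ) • r) ⬝ᵥ (x + (δ / 2) • r) = a ⬝ᵥ x - (r ⬝ᵥ x + δ / 2) / 2 := by
    simp only [smul_dotProduct, dotProduct_smul, dotProduct_add,
      sub_dotProduct, smul_eq_mul, hdot a, hrr, hra]
    ring
  have db : ∀ b : V, r ⬝ᵥ b = -1 / 2 → (b + (1 / 2 : ℂ) • r) ⬝ᵥ (x + (δ / 2) • r) =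
      b ⬝ᵥ x + (r ⬝ᵥ x + δ / 2) / 2 := by
    intro b hrb
    simp only [smul_dotProduct, dotProduct_smul, dotProduct_add,
      add_dotProduct, smul_eq_mul, hdot b, hrr, hrb]
    ring
  have t1 : x + (δ / 2) • r + δ • (a - (1 / 2 : ℂ) • r) = x + δ • a := by module
  have t2 : x + (δ / 2) • r - δ • (a - (1 / 2 : ℂ) • r) = x - δ • a + δ • r := by module
  have t3 : ∀ b : V, x + (δ / 2) • r + δ • (b + (1 / 2 : ℂ) • r) = x + δ • b + δ • r := by
    intro b; module
  have t4 : ∀ b : V, x + (δ / 2) • r - δ • (b + (1 / 2 : ℂ) • r) = x - δ • b := by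
    intro b; module
  rw [da, db b hrb, db c hrc, t1, t2, t3, t3, t4, t4]
  congr 1
  · congr 1
    · congr 2 <;> congr 1 <;> ring
    · congr 2 <;> congr 1 <;> ring
  · congr 2 <;> congr 1 <;> ring

theorem sub_norm (h : IsTypeOne a b c) : (b - c) ⬝ᵥ (b - c) = 2 := by
  simp only [sub_dotProduct, dotProduct_sub, h.bb, h.cc, h.bc, dotProduct_comm c b]; norm_num

theorem add_norm (h : IsTypeOne a b c) : (b + c) ⬝ᵥ (b + c) = 2 := by
  simp only [add_dotProduct, dotProduct_add, h.bb, h.cc, h.bc, dotProduct_comm c b]; norm_num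

theorem br_ne_zero {br : ℂ → ℂ} (hbr : IsThreeTerm br) (κ : ℂ) (h : IsTypeOne a b c) :
    Generically (hyperplane κ) fun x =>
      br (b ⬝ᵥ x + c ⬝ᵥ x) ≠ 0 ∧ br (b ⬝ᵥ x - c ⬝ᵥ x) ≠ 0 := by
  have h1 := hbr.generically_ne_zero κ (v := b + c) (by
    rw [h.add_norm, dotProduct_add, h.phi_b, h.phi_c]; norm_num)
  have h2 := hbr.generically_ne_zero κ (v := b - c) (by
    rw [h.sub_norm, dotProduct_sub, h.phi_b, h.phi_c]; norm_num)
  simp only [add_dotProduct, sub_dotProduct] at h1 h2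
  rw [generically_iff] at *
  exact h1.and h2

theorem move {br : ℂ → ℂ} (hbr : IsThreeTerm br) {δ κ : ℂ} {τ : V → ℂ}
    (hI : HirotaType br δ τ (κ - δ / 2) fun _ => 1 / 2)
    (hτ : Generically (hyperplane (κ - δ)) fun x => τ x ≠ 0)
    (h : IsTypeOne a b c) (hr : r ∈ latticeP) (hrr : r ⬝ᵥ r = 2) (h0 : phi ⬝ᵥ r = 0)
    (hra : r ⬝ᵥ a = 1 / 2) (hrb : r ⬝ᵥ b = -1 / 2) (hrc : r ⬝ᵥ c = -1 / 2)
    (hg : Generically (hyperplane κ) fun x => hirota br δ τ ![a, b, c] x = 0) :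
    Generically (hyperplane κ) fun x =>
      hirota br δ τ ![reflect r a, reflect r b, reflect r c] x = 0 := by
  have typeI : ∀ b c : V, IsTypeOne a b c → r ⬝ᵥ b = -1 / 2 → r ⬝ᵥ c = -1 / 2 →
      Generically (hyperplane κ) fun x => hirota br δ τ ![(1 / 2 : ℂ) • (a + b - r),
        (1 / 2 : ℂ) • (a + b + r), (1 / 2 : ℂ) • (a - b - r) - c]
        (x + (δ / 2) • (b - a + r)) = 0 := by
    intro b c h hrb hrc
    refine (hI _ (h.isCFrame_half hr hrr hra hrb hrc) ?_).shift _ ?_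
    · intro i
      fin_cases i <;> simp [h0, h.phi_a, h.phi_b, h.phi_c]
    · simp [h0, h.phi_a, h.phi_b]; ring
  have hT := hτ.shift (κ := κ) (-(δ • a)) (by simp [h.phi_a]; ring)
  have hmain : Generically (hyperplane κ) fun x =>
      hirota br δ τ ![reflect r a, reflect r b, reflect r c] (x + (δ / 2) • r) = 0 := by
    have h1 := typeI b c h hrb hrc
    have h2 := typeI c b h.swap hrc hrb
    have h3 := h.br_ne_zero hbr κ
    rw [generically_iff] at *
    filter_upwards [hg, h1, h2, h3, hT] with x e0 e1 e2 hne hT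
    rw [h.hirota_half hbr δ τ hrr hra hrb hrc] at e1
    rw [h.swap.hirota_half hbr δ τ hrr hra hrc hrb, show c + b - a + r = b + c - a + r by abel,
      add_comm (c ⬝ᵥ x) (b ⬝ᵥ x)] at e2
    rw [hirota_eq] at e0
    rw [hirota_reflect br δ τ hrr hra hrb hrc]
    rw [← sub_eq_add_neg] at hT
    rw [← neg_sub (a ⬝ᵥ x) (c ⬝ᵥ x), hbr.map_neg, add_comm (c ⬝ᵥ x) (a ⬝ᵥ x)] at e0
    rw [show c ⬝ᵥ x - a ⬝ᵥ x + (r ⬝ᵥ x + δ / 2) = -(a ⬝ᵥ x - c ⬝ᵥ x - (r ⬝ᵥ x + δ / 2)) by ring,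
      hbr.map_neg, add_comm (c ⬝ᵥ x) (a ⬝ᵥ x)]
    -- After multiplication by `[(b+c|x)] τ(x-δa)`, the reflected equation is a combination of the
    -- original one, which cancels `τ(x+δa)`, and of the two half-type ones, whose common value
    -- cancels.
    refine (mul_eq_zero.1 ?_).resolve_left (mul_ne_zero hne.1 hT)
    generalize br (b ⬝ᵥ x + c ⬝ᵥ x) = u1 at *
    generalize br (b ⬝ᵥ x + c ⬝ᵥ x + (r ⬝ᵥ x + δ / 2)) = u2 at *
    linear_combination (u2 * τ (x - δ • a + δ • r)) * e0 +
      (br (a ⬝ᵥ x + c ⬝ᵥ x) * τ (x - δ • b)) * e1 - (br (a ⬝ᵥ x + b ⬝ᵥ x) * τ (x - δ • c)) * e2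
  have := hmain.shift (κ := κ) (-((δ / 2) • r)) (by simp [h0])
  simpa using this

/-- Since `b - a ∈ P`, `(r|b) = k + 1/2` with `k` an integer. The norm `4 - 4k` of `2b - r` bounds
`k`, because `2b = r` is impossible by norms. The same argument applies to `-b`. -/
theorem reflect_dot_values (h : IsTypeOne a b c) (hr : r ∈ latticeP) (hrr : r ⬝ᵥ r = 2)
    (hra : r ⬝ᵥ a = 1 / 2) : r ⬝ᵥ b = 1 / 2 ∨ r ⬝ᵥ b = -1 / 2 := by
  obtain ⟨k, hk⟩ := latticeP_dot hr h.ba_mem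
  rw [dotProduct_sub, hra] at hk
  have key : ∀ b : V, b ⬝ᵥ b = 1 → (2 : ℂ) • b ∈ latticeP → ∀ k : ℤ, r ⬝ᵥ b = k + 1 / 2 →
      k ≤ 0 := by
    intro b hbb hb2 k hk
    obtain ⟨n, hn, hn0⟩ := latticeP_norm (sub_mem_latticeP hb2 hr)
    simp only [sub_dotProduct, dotProduct_sub, smul_dotProduct, dotProduct_smul, smul_eq_mul, hbb,
      dotProduct_comm b r, hk, hrr] at hn
    have : ((n : ℤ) : ℂ) = ((2 - 2 * k : ℤ) : ℂ) := by push_cast; linear_combination -hn / 2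
    have h1 : (n : ℤ) = 2 - 2 * k := by exact_mod_cast this
    by_contra! hpos
    have hz : n = 0 := by omega
    have e := sub_eq_zero.1 (hn0 hz)
    rw [← e] at hrr
    simp [hbb] at hrr
  have h1 := key b h.bb h.two_b k (by linear_combination hk)
  have h2 := key (-b) (by simpa using h.bb) (by simpa using neg_mem_latticeP h.two_b) (-k - 1)
    (by rw [dotProduct_neg]; push_cast; linear_combination -hk)
  rcases (by omega : k = 0 ∨ k = -1) with rfl | rfl
  · left; push_cast at hk; linear_combination hk
  · right; push_cast at hk; linear_combination hk

end IsTypeOne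

theorem isTypeOneClosed_hirota {br : ℂ → ℂ} (hbr : IsThreeTerm br) {δ κ : ℂ} {τ : V → ℂ}
    (hI : HirotaType br δ τ (κ - δ / 2) fun _ => 1 / 2)
    (hτ : Generically (hyperplane (κ - δ)) fun x => τ x ≠ 0) :
    IsTypeOneClosed fun a b c =>
      Generically (hyperplane κ) fun x => hirota br δ τ ![a, b, c] x = 0 where
  swap a b c h := by
    have : ∀ x, hirota br δ τ ![a, c, b] x = -hirota br δ τ ![a, b, c] x :=
      hirota_swap hbr δ τ a b c
    simpa only [this, neg_eq_zero] using h
  neg a b c h := by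
    have : ∀ x, hirota br δ τ ![a, -b, c] x = hirota br δ τ ![a, b, c] x := fun x =>
      hirota_signs hbr δ τ (fun i => by fin_cases i <;> simp) x
    simpa only [this] using h
  move a b c r h hr hrr h0 hra hg := by
    have hs : ∀ (e f : V), (e = b ∨ e = -b) → (f = c ∨ f = -c) → ∀ x,
        hirota br δ τ ![a, e, f] x = hirota br δ τ ![a, b, c] x := fun e f he hf x =>
      hirota_signs hbr δ τ (fun i => by fin_cases i <;> simp [*]) x
    have hs' : ∀ (e f : V), (e = b ∨ e = -b) → (f = c ∨ f = -c) → ∀ x,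
        hirota br δ τ ![reflect r a, reflect r e, reflect r f] x =
          hirota br δ τ ![reflect r a, reflect r b, reflect r c] x := fun e f he hf x =>
      hirota_signs hbr δ τ (fun i => by
        rcases he with rfl | rfl <;> rcases hf with rfl | rfl <;> fin_cases i <;>
          simp [reflect_neg]) x
    -- The move is computed for `(r|b) = (r|c) = -1/2`; signs of `b` and `c` are free.
    have hchoose : ∀ e : V, (r ⬝ᵥ e = 1 / 2 ∨ r ⬝ᵥ e = -1 / 2) →
        ∃ f, (f = e ∨ f = -e) ∧ r ⬝ᵥ f = -1 / 2 := by
      rintro e (he | he)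
      · exact ⟨-e, Or.inr rfl, by rw [dotProduct_neg, he]; ring⟩
      · exact ⟨e, Or.inl rfl, he⟩
    obtain ⟨e, he, hre⟩ := hchoose b (h.reflect_dot_values hr hrr hra)
    obtain ⟨f, hf, hrf⟩ := hchoose c (h.swap.reflect_dot_values hr hrr hra)
    have ht : IsTypeOne a e f := by
      have h1 : IsTypeOne a e c := by
        rcases he with rfl | rfl
        · exact h
        · exact h.neg_b
      rcases hf with rfl | rfl
      · exact h1
      · exact h1.swap.neg_b.swap
    have := ht.move hbr hI hτ hr hrr h0 hra hre hrf (by simpa only [hs e f he hf] using hg)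
    simpa only [hs' e f he hf] using this


/-! ### From type (1,0,0) to the types (0,0,0) and (1,1,0) -/

theorem eq_vec_three (a : Fin 3 → V) : a = ![a 0, a 1, a 2] := by
  ext i; fin_cases i <;> rfl

theorem IsCFrame.isTypeOne {a : Fin 3 → V} (h : IsCFrame a)
    (hp : ∀ i, phi ⬝ᵥ a i = ![1, 0, 0] i) : IsTypeOne (a 0) (a 1) (a 2) where
  frame := by rw [← eq_vec_three]; exact h
  phi_a := by simpa using hp 0
  phi_b := by simpa using hp 1
  phi_c := by simpa using hp 2

theorem IsTypeOne.generically {br : ℂ → ℂ} {δ κ : ℂ} {τ : V → ℂ} {a b c : V}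
    (h : IsTypeOne a b c) (hH : HirotaType br δ τ κ ![1, 0, 0]) :
    Generically (hyperplane κ) fun x => hirota br δ τ ![a, b, c] x = 0 :=
  hH _ h.frame fun i => by fin_cases i <;> simp [h.phi_a, h.phi_b, h.phi_c]

theorem hirotaType_one_of_base {br : ℂ → ℂ} (hbr : IsThreeTerm br) {δ κ : ℂ} {τ : V → ℂ}
    (hI : HirotaType br δ τ (κ - δ / 2) fun _ => 1 / 2)
    (hτ : Generically (hyperplane (κ - δ)) fun x => τ x ≠ 0)
    (hbase : Generically (hyperplane κ) fun x => hirota br δ τ ![baseA, baseB, baseC] x = 0) :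
    HirotaType br δ τ κ ![1, 0, 0] := by
  intro a ha hp
  rw [eq_vec_three a]
  exact (isTypeOneClosed_hirota hbr hI hτ).all hbase (ha.isTypeOne hp)

/-- Both `a ± b` have norm 2. The excluded pairings include the case `a ± b = ±φ`, in which the
bracket is constant on the hyperplane. -/
theorem brPM_generically_ne_zero {br : ℂ → ℂ} (hbr : IsThreeTerm br) (κ : ℂ) {a b : V}
    (haa : a ⬝ᵥ a = 1) (hbb : b ⬝ᵥ b = 1) (hab : a ⬝ᵥ b = 0)
    (h1 : (phi ⬝ᵥ a + phi ⬝ᵥ b) ^ 2 ≠ 4) (h2 : (phi ⬝ᵥ a - phi ⬝ᵥ b) ^ 2 ≠ 4) :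
    Generically (hyperplane κ) fun x => brPM br a b x ≠ 0 := by
  have e1 := hbr.generically_ne_zero κ (v := a + b) (by
    rw [dotProduct_add phi]
    simp only [add_dotProduct, dotProduct_add, haa, hbb, hab, dotProduct_comm b a]
    convert h1 using 1; norm_num)
  have e2 := hbr.generically_ne_zero κ (v := a - b) (by
    rw [dotProduct_sub phi]
    simp only [sub_dotProduct, dotProduct_sub, haa, hbb, hab, dotProduct_comm b a]
    convert h2 using 1; norm_num)
  rw [generically_iff] at *
  filter_upwards [e1, e2] with x h1 h2 using mul_ne_zero h1 h2

/-- Adjoin `d` with `(φ|d) = 1`. Every triple containing `d` has type (1,0,0), and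
`hirota_elimination` removes `d`. -/
theorem hirotaType_zero {br : ℂ → ℂ} (hbr : IsThreeTerm br) {δ κ : ℂ} {τ : V → ℂ}
    (hH : HirotaType br δ τ κ ![1, 0, 0]) : HirotaType br δ τ κ ![0, 0, 0] := by
  intro a ha hp
  have hp0 : ∀ i, phi ⬝ᵥ a i = 0 := fun i => by rw [hp]; fin_cases i <;> rfl
  obtain ⟨d, hdd, hda, hdm, hd1⟩ := ha.exists_phi_one hp0
  have h2d : (2 : ℂ) • d ∈ latticeP := by
    convert add_mem_latticeP (add_mem_latticeP (hdm 0) (hdm 0)) (ha.two_mem 0) using 1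
    module
  have hneg : ∀ i, a i - d ∈ latticeP := fun i => by simpa using neg_mem_latticeP (hdm i)
  have hT : ∀ i j, i ≠ j → IsTypeOne d (a i) (a j) := fun i j hij =>
    { frame := isCFrame_three hdd (by simpa using ha.orthonormal i i)
        (by simpa using ha.orthonormal j j) (hda i) (hda j) (by simpa [hij] using ha.orthonormal i j)
        h2d (hneg i) (hneg j)
      phi_a := hd1
      phi_b := hp0 i
      phi_c := hp0 j }
  have h1 := (hT 0 1 (by decide)).generically hH
  have h2 := (hT 1 2 (by decide)).generically hH
  have h3 := brPM_generically_ne_zero hbr κ (a := a 1) (b := d) (by simpa using ha.orthonormal 1 1)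
    hdd (by rw [dotProduct_comm]; exact hda 1) (by rw [hp0, hd1]; norm_num)
    (by rw [hp0, hd1]; norm_num)
  rw [generically_iff] at *
  filter_upwards [h1, h2, h3] with x e1 e2 hne
  have := hirota_elimination hbr δ τ (a 0) (a 1) (a 2) d x
  rw [hirota_rotate br δ τ d (a 0) (a 1), e1, e2, ← eq_vec_three] at this
  simpa [hne] using this

/-- A fourth vector `d` is orthogonal to `φ = a 0 + a 1`. The elimination pivots on `a 2`, so both
auxiliary triples have type (1,0,0). -/
theorem hirotaType_two {br : ℂ → ℂ} (hbr : IsThreeTerm br) {δ κ : ℂ} {τ : V → ℂ}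
    (hH : HirotaType br δ τ κ ![1, 0, 0]) : HirotaType br δ τ κ ![1, 1, 0] := by
  intro a ha hp
  have hp0 : phi ⬝ᵥ a 0 = 1 := by simpa using hp 0
  have hp1 : phi ⬝ᵥ a 1 = 1 := by simpa using hp 1
  have hp2 : phi ⬝ᵥ a 2 = 0 := by simpa using hp 2
  have hn : ∀ i, a i ⬝ᵥ a i = 1 := fun i => by simpa using ha.orthonormal i i
  have ho : ∀ i j, i ≠ j → a i ⬝ᵥ a j = 0 := fun i j hij => by simpa [hij] using ha.orthonormal i j
  obtain ⟨d, hdd, hda, hdm⟩ := ha.exists_orthogonal (by norm_num)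
  have hd0 : phi ⬝ᵥ d = 0 := by
    rw [← add_eq_phi (hn 0) (hn 1) (ho 0 1 (by decide)) (ha.add_mem' 0 1) hp0 hp1,
      dotProduct_comm, dotProduct_add, hda, hda, add_zero]
  have hT : ∀ i, i ≠ 2 → phi ⬝ᵥ a i = 1 → IsTypeOne (a i) (a 2) d := fun i hi h1 =>
    { frame := isCFrame_three (hn i) (hn 2) hdd (ho i 2 hi) (by rw [dotProduct_comm]; exact hda i)
        (by rw [dotProduct_comm]; exact hda 2) (ha.two_mem i) (ha.sub_mem' 2 i) (hdm i)
      phi_a := h1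
      phi_b := hp2
      phi_c := hd0 }
  have h1 := (hT 0 (by decide) hp0).generically hH
  have h2 := (hT 1 (by decide) hp1).swap.generically hH
  have h3 := brPM_generically_ne_zero hbr κ (a := a 2) (b := d) (hn 2)
    hdd (by rw [dotProduct_comm]; exact hda 2) (by rw [hp2, hd0]; norm_num)
    (by rw [hp2, hd0]; norm_num)
  rw [generically_iff] at *
  filter_upwards [h1, h2, h3] with x e1 e2 hne
  have := hirota_elimination hbr δ τ (a 0) (a 2) (a 1) d x
  rw [hirota_rotate br δ τ (a 1) d (a 2), e1, e2, hirota_swap hbr, ← eq_vec_three] at this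
  simpa [hne] using this

/-! ### From type (1,0,0) to the next equations of type (1/2,1/2,1/2) -/

/-- Four orthonormal vectors of a frame with `(φ|·) = 1/2`. -/
structure IsHalfFour (a b c d : V) : Prop where
  aa : a ⬝ᵥ a = 1
  bb : b ⬝ᵥ b = 1
  cc : c ⬝ᵥ c = 1
  dd : d ⬝ᵥ d = 1
  ab : a ⬝ᵥ b = 0
  ac : a ⬝ᵥ c = 0
  ad : a ⬝ᵥ d = 0
  bc : b ⬝ᵥ c = 0
  bd : b ⬝ᵥ d = 0
  cd : c ⬝ᵥ d = 0
  phi_a : phi ⬝ᵥ a = 1 / 2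
  phi_b : phi ⬝ᵥ b = 1 / 2
  phi_c : phi ⬝ᵥ c = 1 / 2
  phi_d : phi ⬝ᵥ d = 1 / 2
  two_d : (2 : ℂ) • d ∈ latticeP
  a_mem : a - d ∈ latticeP
  b_mem : b - d ∈ latticeP
  c_mem : c - d ∈ latticeP

namespace IsHalfFour

variable {a b c d : V}

theorem rotate (h : IsHalfFour a b c d) : IsHalfFour b c a d where
  aa := h.bb
  bb := h.cc
  cc := h.aa
  dd := h.dd
  ab := h.bc
  ac := by rw [dotProduct_comm]; exact h.ab
  ad := h.bd
  bc := by rw [dotProduct_comm]; exact h.ac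
  bd := h.cd
  cd := h.ad
  phi_a := h.phi_b
  phi_b := h.phi_c
  phi_c := h.phi_a
  phi_d := h.phi_d
  two_d := h.two_d
  a_mem := h.b_mem
  b_mem := h.c_mem
  c_mem := h.a_mem

/-- These three vectors are the images of `a`, `b`, `c` under the reflection in the root `φ - a -
d`. -/
theorem isTypeOne (h : IsHalfFour a b c d) :
    IsTypeOne ((1 / 2 : ℂ) • (phi + a - d)) (b + (1 / 2 : ℂ) • (a + d - phi))
      (c + (1 / 2 : ℂ) • (a + d - phi)) := by
  refine ⟨isCFrame_three ?_ ?_ ?_ ?_ ?_ ?_ ?_ ?_ ?_, ?_, ?_, ?_⟩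
  iterate 6
    simp only [smul_dotProduct, dotProduct_smul, add_dotProduct, dotProduct_add, sub_dotProduct,
      dotProduct_sub, smul_eq_mul, phi_dot_phi, h.aa, h.bb, h.cc, h.dd, h.ab, h.ac, h.ad, h.bc,
      h.bd, h.cd, dotProduct_comm b a, dotProduct_comm c a, dotProduct_comm d a,
      dotProduct_comm d b, dotProduct_comm d c, dotProduct_comm a phi,
      dotProduct_comm b phi, dotProduct_comm c phi, dotProduct_comm d phi, h.phi_a, h.phi_b,
      h.phi_c, h.phi_d]
    norm_num
  · convert add_mem_latticeP phi_mem_latticeP h.a_mem using 1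
    module
  · convert sub_mem_latticeP (add_mem_latticeP h.b_mem h.two_d) phi_mem_latticeP using 1
    module
  · convert sub_mem_latticeP (add_mem_latticeP h.c_mem h.two_d) phi_mem_latticeP using 1
    module
  iterate 3
    simp only [dotProduct_smul, dotProduct_add, dotProduct_sub, phi_dot_phi, h.phi_a, h.phi_b,
      h.phi_c, h.phi_d, smul_eq_mul]
    norm_num

theorem dot_a (h : IsHalfFour a b c d) (δ : ℂ) (z : V) :
    (1 / 2 : ℂ) • (phi + a - d) ⬝ᵥ (z + (δ / 2) • (a + d - phi)) =
      (phi ⬝ᵥ z + a ⬝ᵥ z - d ⬝ᵥ z) / 2 - δ / 4 := by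
  simp only [smul_dotProduct, dotProduct_smul, add_dotProduct, dotProduct_add, sub_dotProduct,
      dotProduct_sub, smul_eq_mul, phi_dot_phi, h.aa, h.dd, h.ad, dotProduct_comm d a,
      dotProduct_comm a phi, dotProduct_comm d phi, h.phi_a, h.phi_d]
  ring

theorem dot_b (h : IsHalfFour a b c d) (δ : ℂ) (z : V) :
    (b + (1 / 2 : ℂ) • (a + d - phi)) ⬝ᵥ (z + (δ / 2) • (a + d - phi)) =
      b ⬝ᵥ z + (a ⬝ᵥ z + d ⬝ᵥ z - phi ⬝ᵥ z) / 2 + δ / 4 := by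
  simp only [smul_dotProduct, dotProduct_smul, add_dotProduct, dotProduct_add, sub_dotProduct,
      dotProduct_sub, smul_eq_mul, phi_dot_phi, h.aa, h.dd, h.ab, h.ad, h.bd, dotProduct_comm d a,
      dotProduct_comm b a, dotProduct_comm b phi,
      dotProduct_comm a phi, dotProduct_comm d phi, h.phi_a, h.phi_b, h.phi_d]
  ring

theorem dot_c (h : IsHalfFour a b c d) (δ : ℂ) (z : V) :
    (c + (1 / 2 : ℂ) • (a + d - phi)) ⬝ᵥ (z + (δ / 2) • (a + d - phi)) =
      c ⬝ᵥ z + (a ⬝ᵥ z + d ⬝ᵥ z - phi ⬝ᵥ z) / 2 + δ / 4 := by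
  simp only [smul_dotProduct, dotProduct_smul, add_dotProduct, dotProduct_add, sub_dotProduct,
      dotProduct_sub, smul_eq_mul, phi_dot_phi, h.aa, h.dd, h.ac, h.ad, h.cd, dotProduct_comm d a,
      dotProduct_comm c a, dotProduct_comm c phi,
      dotProduct_comm a phi, dotProduct_comm d phi, h.phi_a, h.phi_c, h.phi_d]
  ring

theorem hirota_typeOne {br : ℂ → ℂ} (hbr : IsThreeTerm br) (δ : ℂ) (τ : V → ℂ)
    (h : IsHalfFour a b c d) (z : V) :
    hirota br δ τ ![(1 / 2 : ℂ) • (phi + a - d), b + (1 / 2 : ℂ) • (a + d - phi),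
      c + (1 / 2 : ℂ) • (a + d - phi)] (z + (δ / 2) • (a + d - phi)) =
    br (a ⬝ᵥ z + b ⬝ᵥ z + c ⬝ᵥ z + (d ⬝ᵥ z - phi ⬝ᵥ z + δ / 2)) * br (b ⬝ᵥ z - c ⬝ᵥ z) *
      (τ (z + δ • a) * τ (z + δ • (d - phi))) +
    br (c ⬝ᵥ z + a ⬝ᵥ z) * br (c ⬝ᵥ z + (d ⬝ᵥ z - phi ⬝ᵥ z + δ / 2)) *
      (τ (z + δ • (a + b) + δ • (d - phi)) * τ (z - δ • b)) -
    br (a ⬝ᵥ z + b ⬝ᵥ z) * br (b ⬝ᵥ z + (d ⬝ᵥ z - phi ⬝ᵥ z + δ / 2)) *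
      (τ (z + δ • (a + c) + δ • (d - phi)) * τ (z - δ • c)) := by
  have t1 : z + (δ / 2) • (a + d - phi) + δ • (1 / 2 : ℂ) • (phi + a - d) = z + δ • a := by module
  have t2 : z + (δ / 2) • (a + d - phi) - δ • (1 / 2 : ℂ) • (phi + a - d) =
    z + δ • (d - phi) := by module
  have t3 : ∀ b : V, z + (δ / 2) • (a + d - phi) + δ • (b + (1 / 2 : ℂ) • (a + d - phi)) =
      z + δ • (a + b) + δ • (d - phi) := fun b => by module
  have t4 : ∀ b : V, z + (δ / 2) • (a + d - phi) - δ • (b + (1 / 2 : ℂ) • (a + d - phi)) =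
      z - δ • b := fun b => by module
  rw [hirota_eq, h.dot_a, h.dot_b, h.dot_c, t1, t2, t3, t3, t4, t4]
  set p := a ⬝ᵥ z
  set q := b ⬝ᵥ z
  set s := c ⬝ᵥ z
  set u := d ⬝ᵥ z
  set w := phi ⬝ᵥ z
  rw [show q + (p + u - w) / 2 + δ / 4 + (s + (p + u - w) / 2 + δ / 4) =
      p + q + s + (u - w + δ / 2) by ring,
    show q + (p + u - w) / 2 + δ / 4 - (s + (p + u - w) / 2 + δ / 4) = q - s by ring,
    show s + (p + u - w) / 2 + δ / 4 + ((w + p - u) / 2 - δ / 4) = s + p by ring,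
    show s + (p + u - w) / 2 + δ / 4 - ((w + p - u) / 2 - δ / 4) = s + (u - w + δ / 2) by ring,
    show (w + p - u) / 2 - δ / 4 + (q + (p + u - w) / 2 + δ / 4) = p + q by ring,
    show (w + p - u) / 2 - δ / 4 - (q + (p + u - w) / 2 + δ / 4) = -(q + (u - w + δ / 2)) by ring,
    hbr.map_neg]
  ring

/-- The three cyclic versions of `hirota_typeOne` share the factor `τ(z + δ(d-φ))`, which lives on
`H_{κ-δ}`, and one bracket. Weighted by `[(b+c|z)] τ(z-δa)` and its rotations, their cross terms
cancel in pairs and leave the required equation times these common factors. -/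
theorem hirota_half {br : ℂ → ℂ} (hbr : IsThreeTerm br) {δ κ : ℂ} {τ : V → ℂ}
    (hH : HirotaType br δ τ κ ![1, 0, 0])
    (hτ : Generically (hyperplane (κ - δ)) fun x => τ x ≠ 0) (h : IsHalfFour a b c d) :
    Generically (hyperplane (κ + δ / 2)) fun x => hirota br δ τ ![a, b, c] x = 0 := by
  have key : ∀ {a b c : V}, IsHalfFour a b c d → κ + δ / 2 + phi ⬝ᵥ ((δ / 2) • (a + d - phi)) = κ := by
    intro a b c h
    simp only [dotProduct_smul, dotProduct_add, dotProduct_sub, phi_dot_phi, h.phi_a, h.phi_d,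
      smul_eq_mul]
    ring
  have h1 := (h.isTypeOne.generically hH).shift _ (key h)
  have h2 := (h.rotate.isTypeOne.generically hH).shift _ (key h.rotate)
  have h3 := (h.rotate.rotate.isTypeOne.generically hH).shift _ (key h.rotate.rotate)
  have h4 := (h.isTypeOne.br_ne_zero hbr κ).shift _ (key h)
  have h5 := hτ.shift (κ := κ + δ / 2) (δ • (d - phi)) (by
    simp only [dotProduct_smul, dotProduct_sub, phi_dot_phi, h.phi_d, smul_eq_mul]
    ring)
  rw [generically_iff] at *
  filter_upwards [h1, h2, h3, h4, h5] with z e1 e2 e3 hS hT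
  rw [h.hirota_typeOne hbr] at e1
  rw [h.rotate.hirota_typeOne hbr, show b ⬝ᵥ z + c ⬝ᵥ z + a ⬝ᵥ z = a ⬝ᵥ z + b ⬝ᵥ z + c ⬝ᵥ z by ring,
    add_comm b a] at e2
  rw [h.rotate.rotate.hirota_typeOne hbr,
    show c ⬝ᵥ z + a ⬝ᵥ z + b ⬝ᵥ z = a ⬝ᵥ z + b ⬝ᵥ z + c ⬝ᵥ z by ring,
    add_comm c a, add_comm c b] at e3
  rw [h.dot_b, h.dot_c, show b ⬝ᵥ z + (a ⬝ᵥ z + d ⬝ᵥ z - phi ⬝ᵥ z) / 2 + δ / 4 +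
    (c ⬝ᵥ z + (a ⬝ᵥ z + d ⬝ᵥ z - phi ⬝ᵥ z) / 2 + δ / 4) =
    a ⬝ᵥ z + b ⬝ᵥ z + c ⬝ᵥ z + (d ⬝ᵥ z - phi ⬝ᵥ z + δ / 2) by ring] at hS
  rw [hirota_eq]
  refine (mul_eq_zero.1 ?_).resolve_left (mul_ne_zero hS.1 hT)
  linear_combination (br (b ⬝ᵥ z + c ⬝ᵥ z) * τ (z - δ • a)) * e1 +
    (br (c ⬝ᵥ z + a ⬝ᵥ z) * τ (z - δ • b)) * e2 + (br (a ⬝ᵥ z + b ⬝ᵥ z) * τ (z - δ • c)) * e3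

end IsHalfFour

theorem hirotaType_half {br : ℂ → ℂ} (hbr : IsThreeTerm br) {δ κ : ℂ} {τ : V → ℂ}
    (hH : HirotaType br δ τ κ ![1, 0, 0])
    (hτ : Generically (hyperplane (κ - δ)) fun x => τ x ≠ 0) :
    HirotaType br δ τ (κ + δ / 2) fun _ => 1 / 2 := by
  intro a ha hp
  have hn : ∀ i, a i ⬝ᵥ a i = 1 := fun i => by simpa using ha.orthonormal i i
  have ho : ∀ i j, i ≠ j → a i ⬝ᵥ a j = 0 := fun i j hij => by simpa [hij] using ha.orthonormal i j
  obtain ⟨d, hdd, hda, hdm⟩ := ha.exists_orthogonal (by norm_num)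
  have h2d : (2 : ℂ) • d ∈ latticeP := by
    convert add_mem_latticeP (add_mem_latticeP (hdm 0) (hdm 0)) (ha.two_mem 0) using 1
    module
  have hneg : ∀ i, a i - d ∈ latticeP := fun i => by simpa using neg_mem_latticeP (hdm i)
  have hfour : ∀ d : V, d ⬝ᵥ d = 1 → (∀ i, d ⬝ᵥ a i = 0) → (∀ i, a i - d ∈ latticeP) →
      (2 : ℂ) • d ∈ latticeP → phi ⬝ᵥ d = 1 / 2 → IsHalfFour (a 0) (a 1) (a 2) d :=
    fun d hdd hda hneg h2d hd => ⟨hn 0, hn 1, hn 2, hdd, ho _ _ (by decide), ho _ _ (by decide),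
      by rw [dotProduct_comm]; exact hda 0, ho _ _ (by decide),
      by rw [dotProduct_comm]; exact hda 1, by rw [dotProduct_comm]; exact hda 2,
      hp 0, hp 1, hp 2, hd, h2d, hneg 0, hneg 1, hneg 2⟩
  rw [eq_vec_three a]
  obtain ⟨k, hk, hl, hu⟩ := phi_dot_unit hdd h2d
  obtain ⟨m, hm⟩ := latticeP_dot phi_mem_latticeP (hneg 0)
  rw [dotProduct_sub, hp, hk] at hm
  have : ((1 - k : ℤ) : ℂ) = ((2 * m : ℤ) : ℂ) := by push_cast; linear_combination 2 * hm
  have : 1 - k = 2 * m := by exact_mod_cast this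
  -- Congruence to `a 0` makes `(φ|d)` a half-integer; replacing `d` by `-d` makes it `1/2`.
  rcases (by omega : k = 1 ∨ k = -1) with rfl | rfl
  · exact (hfour d hdd hda hneg h2d (by rw [hk]; norm_num)).hirota_half hbr hH hτ
  · refine (hfour (-d) (by simpa using hdd) (fun i => by simp [hda]) (fun i => ?_)
      (by simpa using neg_mem_latticeP h2d) (by rw [dotProduct_neg, hk]; norm_num)).hirota_half
      hbr hH hτ
    convert add_mem_latticeP (hneg i) h2d using 1
    module


/-! ### The recursion step -/

theorem typeTwo_frame : ∃ a b c : V, IsCFrame ![a, b, c] ∧ a + b = phi ∧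
    phi ⬝ᵥ a = 1 ∧ phi ⬝ᵥ b = 1 ∧ phi ⬝ᵥ c = 0 := by
  have hm : ∀ v : Fin 8 → ℤ, (∀ i, 2 ∣ v i - v 0) → 4 ∣ ∑ i, v i → half v ∈ latticeP :=
    fun v h1 h2 => mem_latticeP_iff.2 ⟨v, rfl, h1, h2⟩
  refine ⟨half ![1, 1, 1, 1, 0, 0, 0, 0], half ![0, 0, 0, 0, 1, 1, 1, 1],
    half ![1, 1, -1, -1, 0, 0, 0, 0], isCFrame_three ?_ ?_ ?_ ?_ ?_ ?_ ?_ ?_ ?_, ?_, ?_, ?_, ?_⟩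
  · simpa using half_dot_eq (v := ![1, 1, 1, 1, 0, 0, 0, 0]) (w := ![1, 1, 1, 1, 0, 0, 0, 0]) 1
      (by decide)
  · simpa using half_dot_eq (v := ![0, 0, 0, 0, 1, 1, 1, 1]) (w := ![0, 0, 0, 0, 1, 1, 1, 1]) 1
      (by decide)
  · simpa using half_dot_eq (v := ![1, 1, -1, -1, 0, 0, 0, 0])
      (w := ![1, 1, -1, -1, 0, 0, 0, 0]) 1 (by decide)
  · simpa using half_dot_eq (v := ![1, 1, 1, 1, 0, 0, 0, 0]) (w := ![0, 0, 0, 0, 1, 1, 1, 1]) 0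
      (by decide)
  · simpa using half_dot_eq (v := ![1, 1, 1, 1, 0, 0, 0, 0]) (w := ![1, 1, -1, -1, 0, 0, 0, 0]) 0
      (by decide)
  · simpa using half_dot_eq (v := ![0, 0, 0, 0, 1, 1, 1, 1]) (w := ![1, 1, -1, -1, 0, 0, 0, 0]) 0
      (by decide)
  · convert hm ![2, 2, 2, 2, 0, 0, 0, 0] (by decide) (by decide) using 1
    ext i
    fin_cases i <;> simp [half]
  · convert hm ![-1, -1, -1, -1, 1, 1, 1, 1] (by decide) (by decide) using 1
    ext i
    fin_cases i <;> simp [half] <;> norm_num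
  · convert hm ![0, 0, -2, -2, 0, 0, 0, 0] (by decide) (by decide) using 1
    ext i
    fin_cases i <;> simp [half] <;> norm_num
  · ext i
    fin_cases i <;> simp [half, phi]
  · rw [phi_eq_half]
    simpa using half_dot_eq (v := fun _ => 1) (w := ![1, 1, 1, 1, 0, 0, 0, 0]) 1 (by decide)
  · rw [phi_eq_half]
    simpa using half_dot_eq (v := fun _ => 1) (w := ![0, 0, 0, 0, 1, 1, 1, 1]) 1 (by decide)
  · rw [phi_eq_half]
    simpa using half_dot_eq (v := fun _ => 1) (w := ![1, 1, -1, -1, 0, 0, 0, 0]) 0 (by decide)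

/-- For a frame with `a + b = φ`, if `τ` vanished on `H_{κ+δ}` the equation would reduce to `[κ]
[(a-b|x)] τ(x±δc) = 0`, a product of generically nonzero factors. -/
theorem generically_ne_zero_of_hirotaType_two {br : ℂ → ℂ} (hbr : IsThreeTerm br) {δ κ : ℂ}
    {τ : V → ℂ} (hκ : br κ ≠ 0) (hH : HirotaType br δ τ κ ![1, 1, 0])
    (hτ : Generically (hyperplane κ) fun x => τ x ≠ 0)
    (hm : IsMeromorphicOn (hyperplane (κ + δ)) τ) :
    Generically (hyperplane (κ + δ)) fun x => τ x ≠ 0 := by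
  refine hm.zero_or_ne_zero.resolve_left fun hz => ?_
  obtain ⟨a, b, c, hF, hab, ha, hb, hc⟩ := typeTwo_frame
  have haa : a ⬝ᵥ a = 1 := by simpa using hF.orthonormal 0 0
  have hbb : b ⬝ᵥ b = 1 := by simpa using hF.orthonormal 1 1
  have hab0 : a ⬝ᵥ b = 0 := by simpa using hF.orthonormal 0 1
  have h1 := hH _ hF fun i => by fin_cases i <;> simp [ha, hb, hc]
  have h2 := hz.shift (κ := κ) (δ • a) (by simp [ha])
  have h3 := hz.shift (κ := κ) (δ • b) (by simp [hb])
  have h4 := hτ.shift (κ := κ) (δ • c) (by simp [hc])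
  have h5 := hτ.shift (κ := κ) (-(δ • c)) (by simp [hc])
  have h6 := hbr.generically_ne_zero κ (v := a - b) (by
    rw [dotProduct_sub phi, ha, hb]
    simp only [sub_dotProduct, dotProduct_sub, haa, hbb, hab0, dotProduct_comm b a]
    norm_num)
  obtain ⟨x, hx⟩ := hyperplane_nonempty κ
  refine Generically.false_elim (S := hyperplane κ) ?_ hx
  rw [generically_iff] at *
  filter_upwards [h1, h2, h3, h4, h5, h6, eventually_mem_genericFilter _]
    with x e1 e2 e3 e4 e5 e6 hx
  rw [← sub_eq_add_neg] at e5
  simp only [hirota, Matrix.cons_val, tauPM, e2, e3, brPM, hab, zero_mul, mul_zero, zero_add] at e1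
  rw [show phi ⬝ᵥ x = κ from hx] at e1
  exact mul_ne_zero (mul_ne_zero hκ e6) (mul_ne_zero e4 e5) e1

theorem hyperplane_shift_mem {κ κ' : ℂ} {x v : V} (hx : x ∈ hyperplane κ)
    (hv : κ + phi ⬝ᵥ v = κ') : x + v ∈ hyperplane κ' := by
  simp only [hyperplane, Set.mem_ofPred_eq, dotProduct_add] at *
  rw [hx, hv]

/-- The solution for `τ(x + δ a)` of the Hirota equation for the base frame, in terms of the
values `τp` and `τc` of `τ` on the two preceding hyperplanes. -/
noncomputable def nextTau (br : ℂ → ℂ) (δ : ℂ) (τp τc : V → ℂ) (x : V) : ℂ :=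
  (brPM br baseA baseC x * tauPM τc x (δ • baseB) +
    brPM br baseB baseA x * tauPM τc x (δ • baseC)) /
    (brPM br baseB baseC x * τp (x - δ • baseA))

theorem isMeromorphicOn_brPM {br : ℂ → ℂ} (hbr : IsThreeTerm br) (S : Set V) (a b : V) :
    IsMeromorphicOn S fun x => brPM br a b x :=
  isMeromorphicOn_of_analytic fun p _ =>
    (hbr.analyticAt_comp_dot _ p).mul (hbr.analyticAt_comp_dot _ p)

theorem IsMeromorphicOn.tauPM {κ : ℂ} {τ : V → ℂ} (h : IsMeromorphicOn (hyperplane κ) τ) {v : V}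
    (hv : phi ⬝ᵥ v = 0) : IsMeromorphicOn (hyperplane κ) fun x => tauPM τ x v := by
  have h1 := h.shift (κ := κ) v (by simp [hv])
  have h2 := h.shift (κ := κ) (-v) (by simp [hv])
  simpa only [ORG.tauPM, sub_eq_add_neg] using h1.mul h2

theorem nextTau_denominator_ne_zero {br : ℂ → ℂ} (hbr : IsThreeTerm br) {δ κ : ℂ} {τp : V → ℂ}
    (hp : Generically (hyperplane (κ - δ)) fun x => τp x ≠ 0) :
    Generically (hyperplane κ) fun x => brPM br baseB baseC x * τp (x - δ • baseA) ≠ 0 := by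
  have hb := isTypeOne_base
  have h1 := brPM_generically_ne_zero hbr κ hb.bb hb.cc hb.bc (by rw [hb.phi_b, hb.phi_c]; norm_num)
    (by rw [hb.phi_b, hb.phi_c]; norm_num)
  have h2 := hp.shift (κ := κ) (-(δ • baseA)) (by simp [hb.phi_a]; ring)
  rw [generically_iff] at *
  filter_upwards [h1, h2] with x e1 e2
  rw [← sub_eq_add_neg] at e2
  exact mul_ne_zero e1 e2

theorem isMeromorphicOn_nextTau {br : ℂ → ℂ} (hbr : IsThreeTerm br) {δ κ : ℂ} {τp τc : V → ℂ}
    (hp : IsMeromorphicOn (hyperplane (κ - δ)) τp)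
    (hp0 : Generically (hyperplane (κ - δ)) fun x => τp x ≠ 0)
    (hc : IsMeromorphicOn (hyperplane κ) τc) :
    IsMeromorphicOn (hyperplane κ) (nextTau br δ τp τc) := by
  have hb := isTypeOne_base
  have h2 := hp.shift (κ := κ) (-(δ • baseA)) (by simp [hb.phi_a]; ring)
  simp only [← sub_eq_add_neg] at h2
  refine IsMeromorphicOn.div (IsMeromorphicOn.add ?_ ?_) ?_ (nextTau_denominator_ne_zero hbr hp0)
  · exact (isMeromorphicOn_brPM hbr _ _ _).mul (hc.tauPM (by simp [hb.phi_b]))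
  · exact (isMeromorphicOn_brPM hbr _ _ _).mul (hc.tauPM (by simp [hb.phi_c]))
  · exact (isMeromorphicOn_brPM hbr _ _ _).mul h2

theorem hirota_base_of_nextTau {br : ℂ → ℂ} (hbr : IsThreeTerm br) {δ : ℂ} {τ : V → ℂ} {x : V}
    (hx : τ (x + δ • baseA) = nextTau br δ τ τ x)
    (hne : brPM br baseB baseC x * τ (x - δ • baseA) ≠ 0) :
    hirota br δ τ ![baseA, baseB, baseC] x = 0 := by
  have h1 := left_ne_zero_of_mul hne
  have h2 := right_ne_zero_of_mul hne
  simp only [hirota, Matrix.cons_val]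
  rw [tauPM, hx, nextTau, brPM_swap hbr baseA baseC, brPM_swap hbr baseA baseB]
  field_simp
  ring

/-! ### Gluing -/

open Classical in
/-- The function equal to `T n` on `H_{c + nδ}` for natural `n`, and to zero elsewhere. -/
noncomputable def glue (c δ : ℂ) (T : ℕ → V → ℂ) (x : V) : ℂ :=
  if h : ∃ n : ℕ, phi ⬝ᵥ x = c + n * δ then T h.choose x else 0

theorem glue_of_mem {c δ : ℂ} (hδ : δ ≠ 0) (T : ℕ → V → ℂ) {x : V} (n : ℕ)
    (hx : x ∈ hyperplane (c + n * δ)) : glue c δ T x = T n x := by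
  have h : ∃ n : ℕ, phi ⬝ᵥ x = c + n * δ := ⟨n, hx⟩
  have e : h.choose = n := by
    have h1 : c + n * δ = c + h.choose * δ := Eq.trans (Eq.symm hx) h.choose_spec
    have h2 := mul_right_cancel₀ hδ (add_left_cancel h1)
    exact_mod_cast h2.symm
  rw [glue, dif_pos h, e]

theorem glue_of_neg {c δ : ℂ} (hδ : δ ≠ 0) (T : ℕ → V → ℂ) {x : V} (n : ℤ) (hn : n < 0)
    (hx : x ∈ hyperplane (c + n * δ)) : glue c δ T x = 0 := by
  rw [glue, dif_neg]
  rintro ⟨m, hm⟩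
  rw [show phi ⬝ᵥ x = c + n * δ from hx] at hm
  have h2 := mul_right_cancel₀ hδ (add_left_cancel hm)
  have h3 : n = m := by exact_mod_cast h2
  omega

/-- The components of the hypergeometric `τ`-function with initial components `τ₀`, `τ₁`. -/
noncomputable def tauSeq (br : ℂ → ℂ) (δ : ℂ) (τ₀ τ₁ : V → ℂ) : ℕ → V → ℂ
  | 0 => τ₀
  | 1 => τ₁
  | n + 2 => fun y =>
      nextTau br δ (tauSeq br δ τ₀ τ₁ n) (tauSeq br δ τ₀ τ₁ (n + 1)) (y - δ • baseA)

/-! ### Arbitrary frames -/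

theorem hirota_perm {br : ℂ → ℂ} (hbr : IsThreeTerm br) {δ : ℂ} {τ : V → ℂ} {a : Fin 3 → V}
    (σ : Equiv.Perm (Fin 3)) {x : V} (h : hirota br δ τ (a ∘ σ) x = 0) :
    hirota br δ τ a x = 0 := by
  have hσ : ∀ σ : Equiv.Perm (Fin 3), (σ 0 = 0 ∧ σ 1 = 1 ∧ σ 2 = 2) ∨
      (σ 0 = 0 ∧ σ 1 = 2 ∧ σ 2 = 1) ∨ (σ 0 = 1 ∧ σ 1 = 0 ∧ σ 2 = 2) ∨
      (σ 0 = 1 ∧ σ 1 = 2 ∧ σ 2 = 0) ∨ (σ 0 = 2 ∧ σ 1 = 0 ∧ σ 2 = 1) ∨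
      (σ 0 = 2 ∧ σ 1 = 1 ∧ σ 2 = 0) := by decide
  simp only [hirota, Function.comp_apply] at h ⊢
  rcases hσ σ with h' | h' | h' | h' | h' | h' <;> obtain ⟨e0, e1, e2⟩ := h' <;>
    rw [e0, e1, e2] at h
  · exact h
  · rw [brPM_swap hbr (a 1) (a 2), brPM_swap hbr (a 0) (a 1), brPM_swap hbr (a 2) (a 0)] at h
    linear_combination -h
  · rw [brPM_swap hbr (a 2) (a 0), brPM_swap hbr (a 1) (a 2), brPM_swap hbr (a 0) (a 1)] at h
    linear_combination -h
  · linear_combination h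
  · linear_combination h
  · rw [brPM_swap hbr (a 0) (a 1), brPM_swap hbr (a 2) (a 0), brPM_swap hbr (a 1) (a 2)] at h
    linear_combination -h

/-- The two signs `±δ a i` shift the hyperplane index by `±ε` modulo integers; integrality of `2ε`
makes both land in the same family. -/
theorem setOf_six_points {ω δ ε : ℂ} {a : Fin 3 → V} (hε : ∃ p : ℤ, 2 * ε = p)
    (ha : ∀ i, ∃ m : ℤ, phi ⬝ᵥ a i = ε + m) :
    {x | ∀ i, x + δ • a i ∈ domainD ω δ ∧ x - δ • a i ∈ domainD ω δ} =
      domainD (ω + ε * δ) δ := by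
  obtain ⟨p, hp⟩ := hε
  ext x
  simp only [domainD, hyperplane, Set.mem_iUnion, Set.mem_ofPred_eq, dotProduct_add,
    dotProduct_sub, dotProduct_smul, smul_eq_mul]
  constructor
  · intro h
    obtain ⟨n, hn⟩ := (h 0).1
    obtain ⟨m, hm⟩ := ha 0
    refine ⟨n - m - p, ?_⟩
    rw [hm] at hn
    push_cast
    linear_combination hn - δ * hp
  · rintro ⟨n, hn⟩ i
    obtain ⟨m, hm⟩ := ha i
    refine ⟨⟨n + m + p, ?_⟩, n - m, ?_⟩
    · rw [hm, hn]; push_cast; linear_combination δ * hp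
    · rw [hm, hn]; push_cast; ring

theorem hirota_of_types {br : ℂ → ℂ} (hbr : IsThreeTerm br) {ω δ : ℂ} (hδ : δ ≠ 0) {τ : V → ℂ}
    (hhalf : ∀ n : ℤ, HirotaType br δ τ (ω + n * δ + δ / 2) fun _ => 1 / 2)
    (h0 : ∀ n : ℤ, HirotaType br δ τ (ω + n * δ) ![0, 0, 0])
    (h1 : ∀ n : ℤ, HirotaType br δ τ (ω + n * δ) ![1, 0, 0])
    (h2 : ∀ n : ℤ, HirotaType br δ τ (ω + n * δ) ![1, 1, 0])
    (a : Fin 3 → V) (ha : IsCFrame a) :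
    Generically {x | ∀ i, x + δ • a i ∈ domainD ω δ ∧ x - δ • a i ∈ domainD ω δ} fun x =>
      hirota br δ τ a x = 0 := by
  obtain ⟨b, σ, hF, hb, hcases⟩ := ha.classification
  -- The three integral types share the centres `D_ω`, so they are treated together.
  have hint : ∀ s : Fin 3 → ℤ, (∀ n : ℤ, HirotaType br δ τ (ω + n * δ) fun i => (s i : ℂ)) →
      (∀ i, phi ⬝ᵥ (b ∘ σ) i = s i) →
      Generically {x | ∀ i, x + δ • a i ∈ domainD ω δ ∧ x - δ • a i ∈ domainD ω δ} fun x =>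
        hirota br δ τ a x = 0 := by
    intro s hH hs
    rw [setOf_six_points (ε := 0) ⟨0, by simp⟩ fun i => ?_, zero_mul, add_zero,
      generically_domainD_iff hδ]
    · intro n
      have := hH n _ (hF.perm σ) hs
      rw [generically_iff] at *
      filter_upwards [this] with x hx
      rw [← hirota_signs hbr δ τ hb]
      exact hirota_perm hbr σ hx
    · have h := hs (σ⁻¹ i)
      rw [Function.comp_apply, show σ (σ⁻¹ i) = i from σ.apply_symm_apply i] at h
      rcases hb i with h' | h'
      · exact ⟨s (σ⁻¹ i), by rw [← h', h, zero_add]⟩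
      · refine ⟨-s (σ⁻¹ i), ?_⟩
        rw [h', dotProduct_neg] at h
        push_cast
        linear_combination -h
  rcases hcases with h | h | h | h
  · rw [setOf_six_points (ε := 1 / 2) ⟨1, by norm_num⟩ fun i => ?_, generically_domainD_iff hδ]
    · intro n
      have := hhalf n b hF h
      rw [show ω + n * δ + δ / 2 = ω + 1 / 2 * δ + n * δ by ring] at this
      rw [generically_iff] at *
      filter_upwards [this] with x hx
      rwa [← hirota_signs hbr δ τ hb]
    · have h := h i
      rcases hb i with h' | h'
      · exact ⟨0, by rw [← h', h]; simp⟩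
      · refine ⟨-1, ?_⟩
        rw [h', dotProduct_neg] at h
        push_cast
        linear_combination -h
  · refine hint 0 (fun n => ?_) fun i => ?_
    · convert h0 n using 1; ext i; fin_cases i <;> simp
    · rw [h i]; fin_cases i <;> simp
  · refine hint ![1, 0, 0] (fun n => ?_) fun i => ?_
    · convert h1 n using 1; ext i; fin_cases i <;> simp
    · rw [h i]; fin_cases i <;> simp
  · refine hint ![1, 1, 0] (fun n => ?_) fun i => ?_
    · convert h2 n using 1; ext i; fin_cases i <;> simp
    · rw [h i]; fin_cases i <;> simp


/-! ### Existence and uniqueness -/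

theorem nextTau_congr (br : ℂ → ℂ) {δ κ : ℂ} {f f' g g' : V → ℂ}
    (hf : ∀ x ∈ hyperplane (κ - δ), f x = f' x) (hg : ∀ x ∈ hyperplane κ, g x = g' x) {x : V}
    (hx : x ∈ hyperplane κ) : nextTau br δ f g x = nextTau br δ f' g' x := by
  have hb := isTypeOne_base
  have h0 : ∀ v, phi ⬝ᵥ v = 0 → tauPM g x (δ • v) = tauPM g' x (δ • v) := fun v hv => by
    rw [tauPM, tauPM, hg _ (hyperplane_shift_mem hx (by simp [hv])), sub_eq_add_neg,
      hg _ (hyperplane_shift_mem hx (by simp [hv]))]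
  rw [nextTau, nextTau, h0 _ hb.phi_b, h0 _ hb.phi_c, sub_eq_add_neg,
    hf _ (hyperplane_shift_mem hx (by simp [hb.phi_a]; ring))]

theorem recursion_step {br : ℂ → ℂ} (hbr : IsThreeTerm br) {δ κ : ℂ} {τ : V → ℂ}
    (hκ : br κ ≠ 0) (hI : HirotaType br δ τ (κ - δ / 2) fun _ => 1 / 2)
    (hpm : IsMeromorphicOn (hyperplane (κ - δ)) τ) (hcm : IsMeromorphicOn (hyperplane κ) τ)
    (hp : Generically (hyperplane (κ - δ)) fun x => τ x ≠ 0)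
    (hc : Generically (hyperplane κ) fun x => τ x ≠ 0)
    (hnext : ∀ x ∈ hyperplane κ, τ (x + δ • baseA) = nextTau br δ τ τ x) :
    HirotaType br δ τ κ ![1, 0, 0] ∧ (HirotaType br δ τ (κ + δ / 2) fun _ => 1 / 2) ∧
      IsMeromorphicOn (hyperplane (κ + δ)) τ ∧
      Generically (hyperplane (κ + δ)) fun x => τ x ≠ 0 := by
  have hb := isTypeOne_base
  have hbase : Generically (hyperplane κ) fun x =>
      hirota br δ τ ![baseA, baseB, baseC] x = 0 := by
    have := nextTau_denominator_ne_zero hbr hp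
    rw [generically_iff] at *
    filter_upwards [this, eventually_mem_genericFilter _] with x hne hx
    exact hirota_base_of_nextTau hbr (hnext x hx) hne
  have h1 := hirotaType_one_of_base hbr hI hp hbase
  have hshift : κ + δ + phi ⬝ᵥ (-(δ • baseA)) = κ := by simp [hb.phi_a]
  have hm : IsMeromorphicOn (hyperplane (κ + δ)) τ := by
    refine ((isMeromorphicOn_nextTau hbr hpm hp hcm).shift (-(δ • baseA)) hshift).congr
      fun x hx => ?_
    rw [← hnext _ (hyperplane_shift_mem hx hshift)]
    simp
  exact ⟨h1, hirotaType_half hbr h1 hp, hm,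
    generically_ne_zero_of_hirotaType_two hbr hκ (hirotaType_two hbr h1) hc hm⟩

/-- Every product `τ(x ± δ a i)` contains a zero factor. This settles all equations centred below
`H_ω`. -/
theorem hirotaType_of_forall_eq_zero {br : ℂ → ℂ} {δ κ : ℂ} {τ : V → ℂ} {s : Fin 3 → ℂ}
    (h : ∀ i, (∀ x ∈ hyperplane (κ + δ * s i), τ x = 0) ∨
      ∀ x ∈ hyperplane (κ - δ * s i), τ x = 0) : HirotaType br δ τ κ s := by
  intro a _ hs
  refine Generically.of_forall fun x hx => ?_
  have : ∀ i, tauPM τ x (δ • a i) = 0 := by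
    intro i
    rw [tauPM]
    rcases h i with h | h
    · rw [h _ (hyperplane_shift_mem hx (by simp [hs])), zero_mul]
    · rw [sub_eq_add_neg, h (x + -(δ • a i)) (hyperplane_shift_mem hx (by simp [hs]; ring)),
        mul_zero]
  simp [hirota, this]

/-- The term with `a 0` contains `τ` on `H_{ω-δ}` and disappears. The remaining two-term equation is
the ratio hypothesis with denominators cleared. -/
theorem hirotaType_one_initial {br : ℂ → ℂ} (hbr : IsThreeTerm br) {δ ω : ℂ} {τ τ₀ : V → ℂ}
    (hτ₀ : Generically (hyperplane ω) fun x => τ₀ x ≠ 0)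
    (h0 : ∀ x ∈ hyperplane ω, τ x = τ₀ x) (hneg : ∀ x ∈ hyperplane (ω - δ), τ x = 0)
    (hII : ∀ a : Fin 3 → V, IsCFrame a →
      phi ⬝ᵥ a 0 = 1 → phi ⬝ᵥ a 1 = 0 → phi ⬝ᵥ a 2 = 0 →
      MeroEq (hyperplane ω)
        (fun x => tauPM τ₀ x (δ • a 1) / tauPM τ₀ x (δ • a 2))
        (fun x => brPM br (a 0) (a 1) x / brPM br (a 0) (a 2) x)) :
    HirotaType br δ τ ω ![1, 0, 0] := by
  intro a ha hs
  have hT := ha.isTypeOne hs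
  have h := hII a ha hT.phi_a hT.phi_b hT.phi_c
  have h1 := hτ₀.shift (κ := ω) (δ • a 2) (by simp [hT.phi_c])
  have h2 := hτ₀.shift (κ := ω) (-(δ • a 2)) (by simp [hT.phi_c])
  have h3 := brPM_generically_ne_zero hbr ω hT.aa hT.cc hT.ac
    (by rw [hT.phi_a, hT.phi_c]; norm_num) (by rw [hT.phi_a, hT.phi_c]; norm_num)
  rw [MeroEq, generically_iff] at *
  filter_upwards [h, h1, h2, h3, eventually_mem_genericFilter _] with x e e1 e2 e3 hx
  rw [← sub_eq_add_neg] at e2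
  have hP : ∀ v, phi ⬝ᵥ v = 0 → tauPM τ x (δ • v) = tauPM τ₀ x (δ • v) := fun v hv => by
    rw [tauPM, tauPM, h0 _ (hyperplane_shift_mem hx (by simp [hv])), sub_eq_add_neg,
      h0 _ (hyperplane_shift_mem hx (by simp [hv]))]
  have hz : tauPM τ x (δ • a 0) = 0 := by
    rw [tauPM, sub_eq_add_neg,
      hneg (x + -(δ • a 0)) (hyperplane_shift_mem hx (by simp [hT.phi_a]; ring)), mul_zero]
  have hne : tauPM τ₀ x (δ • a 2) ≠ 0 := mul_ne_zero e1 e2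
  rw [div_eq_div_iff hne e3] at e
  rw [hirota, hz, hP _ hT.phi_b, hP _ hT.phi_c, brPM_swap hbr (a 0) (a 2)]
  linear_combination -e

/-- Two terms contain `τ` on `H_{ω-δ}`, and the third contains `[(φ|x)] = [ω] = 0`: this is where
`ω` must be a period. -/
theorem hirotaType_two_initial {br : ℂ → ℂ} {δ ω : ℂ} {τ : V → ℂ} (hω : br ω = 0)
    (hneg : ∀ x ∈ hyperplane (ω - δ), τ x = 0) : HirotaType br δ τ ω ![1, 1, 0] := by
  intro a ha hs
  have h0 : phi ⬝ᵥ a 0 = 1 := by simpa using hs 0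
  have h1 : phi ⬝ᵥ a 1 = 1 := by simpa using hs 1
  refine Generically.of_forall fun x hx => ?_
  have hz : ∀ v, phi ⬝ᵥ v = 1 → tauPM τ x (δ • v) = 0 := fun v hv => by
    rw [tauPM, sub_eq_add_neg,
      hneg (x + -(δ • v)) (hyperplane_shift_mem hx (by simp [hv]; ring)), mul_zero]
  have hphi : a 0 + a 1 = phi := add_eq_phi (by simpa using ha.orthonormal 0 0)
    (by simpa using ha.orthonormal 1 1) (by simpa using ha.orthonormal 0 1) (ha.add_mem' 0 1) h0 h1
  rw [hirota, hz _ h0, hz _ h1, brPM, brPM, brPM, hphi, show phi ⬝ᵥ x = ω from hx, hω]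
  ring

end ORG

/-! ### Assembly of the theorem -/

open ORG in
theorem mainTheorem5 (br : ℂ → ℂ) (hbr : ORG.IsThreeTerm br)
    (δ : ℂ) (hδ : δ ≠ 0)
    (hδΩ : ∀ n : ℤ, (n : ℂ) * δ ∈ ORG.periods br → (n : ℂ) * δ = 0)
    (ω : ℂ) (hω : ω ∈ ORG.periods br)
    (τ₀ τ₁ : ORG.V → ℂ)
    (hτ₀ : ORG.IsMeromorphicOn (ORG.hyperplane ω) τ₀)
    (hτ₁ : ORG.IsMeromorphicOn (ORG.hyperplane (ω + δ)) τ₁)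
    (hτ₀_ne : ¬ ORG.MeroEq (ORG.hyperplane ω) τ₀ 0)
    (hτ₁_ne : ¬ ORG.MeroEq (ORG.hyperplane (ω + δ)) τ₁ 0)
    (hII : ∀ a : Fin 3 → ORG.V, ORG.IsCFrame a →
      ORG.phi ⬝ᵥ a 0 = 1 → ORG.phi ⬝ᵥ a 1 = 0 → ORG.phi ⬝ᵥ a 2 = 0 →
      ORG.MeroEq (ORG.hyperplane ω)
        (fun x => ORG.tauPM τ₀ x (δ • a 1) / ORG.tauPM τ₀ x (δ • a 2))
        (fun x => ORG.brPM br (a 0) (a 1) x / ORG.brPM br (a 0) (a 2) x))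
    (hI : ∀ a : Fin 3 → ORG.V, ORG.IsCFrame a → (∀ i, ORG.phi ⬝ᵥ a i = 1 / 2) →
      ORG.MeroEq (ORG.hyperplane (ω + δ / 2))
        (fun x =>
          ORG.brPM br (a 1) (a 2) x * (τ₀ (x - δ • a 0) * τ₁ (x + δ • a 0)) +
          ORG.brPM br (a 2) (a 0) x * (τ₀ (x - δ • a 1) * τ₁ (x + δ • a 1)) +
          ORG.brPM br (a 0) (a 1) x * (τ₀ (x - δ • a 2) * τ₁ (x + δ • a 2)))
        0) :
    ∃ τ : ORG.V → ℂ,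
      (ORG.IsHypergeometricTau br δ ω τ ∧
        ORG.MeroEq (ORG.hyperplane ω) τ τ₀ ∧
        ORG.MeroEq (ORG.hyperplane (ω + δ)) τ τ₁) ∧
      ∀ τ' : ORG.V → ℂ,
        ORG.IsHypergeometricTau br δ ω τ' ∧
          ORG.MeroEq (ORG.hyperplane ω) τ' τ₀ ∧
          ORG.MeroEq (ORG.hyperplane (ω + δ)) τ' τ₁ →
        ORG.MeroEq (ORG.domainD ω δ) τ' τ := by
  set T := tauSeq br δ τ₀ τ₁ with hTdef
  set τ := glue ω δ T with hτdef
  have hb := isTypeOne_base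
  have hτn : ∀ (n : ℕ), ∀ x ∈ hyperplane (ω + n * δ), τ x = T n x :=
    fun n x hx => glue_of_mem hδ T n hx
  have hneg : ∀ n : ℤ, n < 0 → ∀ x ∈ hyperplane (ω + n * δ), τ x = 0 :=
    fun n hn x hx => glue_of_neg hδ T n hn hx
  have h0eq : ∀ x ∈ hyperplane ω, τ x = τ₀ x := fun x hx => hτn 0 x (by simpa using hx)
  have h1eq : ∀ x ∈ hyperplane (ω + δ), τ x = τ₁ x := fun x hx => hτn 1 x (by simpa using hx)
  have hnegone : ∀ x ∈ hyperplane (ω - δ), τ x = 0 := fun x hx =>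
    hneg (-1) (by norm_num) x (by simpa [sub_eq_add_neg] using hx)
  have hτ₀' := hτ₀.generically_ne_zero hτ₀_ne
  have hτ₁' := hτ₁.generically_ne_zero hτ₁_ne
  -- Otherwise the difference `(n+1)δ` of two periods would be a nonzero period.
  have hbrn : ∀ n : ℕ, br (ω + (n + 1 : ℕ) * δ) ≠ 0 := by
    intro n h
    have h1 := hbr.map_sub_eq_zero h hω
    rw [add_sub_cancel_left] at h1
    have h2 := hδΩ (n + 1 : ℕ) (by simpa [periods] using h1)
    rcases mul_eq_zero.1 h2 with h3 | h3
    · rw [Int.cast_natCast] at h3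
      exact Nat.succ_ne_zero n (by exact_mod_cast h3)
    · exact hδ h3
  have hnext : ∀ n : ℕ, ∀ x ∈ hyperplane (ω + (n + 1 : ℕ) * δ),
      τ (x + δ • baseA) = nextTau br δ τ τ x := by
    intro n x hx
    rw [hτn (n + 2) _ (hyperplane_shift_mem hx (by simp [hb.phi_a]; ring))]
    have : T (n + 2) (x + δ • baseA) = nextTau br δ (T n) (T (n + 1)) x := by
      simp only [hTdef, tauSeq, add_sub_cancel_right]
    rw [this]
    refine nextTau_congr br (fun y hy => (hτn n y ?_).symm) (fun y hy => (hτn (n + 1) y hy).symm) hx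
    rwa [show ω + (n : ℂ) * δ = ω + ((n + 1 : ℕ) : ℂ) * δ - δ by push_cast; ring]
  -- The invariant covers two adjacent hyperplanes and the half-type equations between them, which
  -- is what `recursion_step` consumes. Its type (1,0,0) and (1,1,0) parts are carried for the final
  -- assembly only.
  have hstate : ∀ n : ℕ, (HirotaType br δ τ (ω + n * δ + δ / 2) fun _ => 1 / 2) ∧
      IsMeromorphicOn (hyperplane (ω + n * δ)) τ ∧
      IsMeromorphicOn (hyperplane (ω + (n + 1 : ℕ) * δ)) τ ∧
      (Generically (hyperplane (ω + n * δ)) fun x => τ x ≠ 0) ∧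
      (Generically (hyperplane (ω + (n + 1 : ℕ) * δ)) fun x => τ x ≠ 0) ∧
      HirotaType br δ τ (ω + n * δ) ![1, 0, 0] ∧ HirotaType br δ τ (ω + n * δ) ![1, 1, 0] := by
    intro n
    induction n with
    | zero =>
      simp only [CharP.cast_eq_zero, zero_mul, add_zero, zero_add, Nat.cast_one, one_mul]
      refine ⟨fun a ha hs => ?_, hτ₀.congr h0eq, hτ₁.congr h1eq, ?_, ?_,
        hirotaType_one_initial hbr hτ₀' h0eq hnegone hII, hirotaType_two_initial hω hnegone⟩
      · have h := hI a ha hs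
        rw [MeroEq, generically_iff] at *
        filter_upwards [h, eventually_mem_genericFilter _] with x e hx
        have hP : ∀ i, tauPM τ x (δ • a i) = τ₀ (x - δ • a i) * τ₁ (x + δ • a i) := by
          intro i
          rw [tauPM, h1eq _ (hyperplane_shift_mem hx (by simp [hs]; ring)), sub_eq_add_neg,
            h0eq _ (hyperplane_shift_mem hx (by simp [hs]; ring)), mul_comm]
        rw [hirota, hP, hP, hP]
        exact e
      · rw [generically_iff] at *
        filter_upwards [hτ₀', eventually_mem_genericFilter _] with x e hx
        rwa [h0eq x hx]
      · rw [generically_iff] at *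
        filter_upwards [hτ₁', eventually_mem_genericFilter _] with x e hx
        rwa [h1eq x hx]
    | succ n ih =>
      obtain ⟨i1, i2, i3, i4, i5, -, -⟩ := ih
      have e1 : ω + (n : ℂ) * δ = ω + ((n + 1 : ℕ) : ℂ) * δ - δ := by push_cast; ring
      have e2 : ω + (n : ℂ) * δ + δ / 2 = ω + ((n + 1 : ℕ) : ℂ) * δ - δ / 2 := by push_cast; ring
      have e3 : ω + ((n + 1 + 1 : ℕ) : ℂ) * δ = ω + ((n + 1 : ℕ) : ℂ) * δ + δ := by
        push_cast; ring
      rw [e2] at i1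
      rw [e1] at i2 i4
      obtain ⟨s1, s2, s3, s4⟩ := recursion_step hbr (hbrn n) i1 i2 i3 i4 i5 (hnext n)
      rw [e3]
      exact ⟨s2, i3, s3, i5, s4, s1, hirotaType_two hbr s1⟩
  have hmero : ∀ n : ℤ, IsMeromorphicOn (hyperplane (ω + n * δ)) τ := by
    intro n
    rcases lt_or_ge n 0 with hn | hn
    · exact (isMeromorphicOn_of_analytic (f := fun _ => 0) fun _ _ => analyticAt_const).congr
        (hneg n hn)
    · obtain ⟨m, rfl⟩ := Int.eq_ofNat_of_zero_le hn
      simpa using (hstate m).2.1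
  have hvanish : ∀ n : ℤ, n < 0 → ∀ κ : ℂ, κ = ω + n * δ → ∀ x ∈ hyperplane κ, τ x = 0 := by
    rintro n hn κ rfl
    exact hneg n hn
  have hhalf : ∀ n : ℤ, HirotaType br δ τ (ω + n * δ + δ / 2) fun _ => 1 / 2 := by
    intro n
    rcases lt_or_ge n 0 with hn | hn
    · exact hirotaType_of_forall_eq_zero fun i => Or.inr (hvanish n hn _ (by ring))
    · obtain ⟨m, rfl⟩ := Int.eq_ofNat_of_zero_le hn
      simpa using (hstate m).1
  have hone : ∀ n : ℤ, HirotaType br δ τ (ω + n * δ) ![1, 0, 0] := by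
    intro n
    rcases lt_or_ge n 0 with hn | hn
    · refine hirotaType_of_forall_eq_zero fun i => Or.inr ?_
      fin_cases i
      · exact hvanish (n - 1) (by omega) _ (by simp; ring)
      · exact hvanish n hn _ (by simp)
      · exact hvanish n hn _ (by simp)
    · obtain ⟨m, rfl⟩ := Int.eq_ofNat_of_zero_le hn
      simpa using (hstate m).2.2.2.2.2.1
  have htwo : ∀ n : ℤ, HirotaType br δ τ (ω + n * δ) ![1, 1, 0] := by
    intro n
    rcases lt_or_ge n 0 with hn | hn
    · refine hirotaType_of_forall_eq_zero fun i => Or.inr ?_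
      fin_cases i
      · exact hvanish (n - 1) (by omega) _ (by simp; ring)
      · exact hvanish (n - 1) (by omega) _ (by simp; ring)
      · exact hvanish n hn _ (by simp)
    · obtain ⟨m, rfl⟩ := Int.eq_ofNat_of_zero_le hn
      simpa using (hstate m).2.2.2.2.2.2
  refine ⟨τ, ⟨⟨⟨isMeromorphicOn_domainD hδ hmero,
    hirota_of_types hbr hδ hhalf (fun n => hirotaType_zero hbr (hone n)) hone htwo⟩,
    fun n hn => Generically.of_forall (hneg n hn), fun h => hτ₀_ne ?_⟩,
    Generically.of_forall h0eq, Generically.of_forall h1eq⟩, ?_⟩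
  · rw [MeroEq, generically_iff] at *
    filter_upwards [h, eventually_mem_genericFilter _] with x e hx
    rw [← h0eq x hx, e]
  · rintro τ' ⟨hτ', h0', h1'⟩
    -- Uniqueness needs only the base frame for `τ'`.
    have hH : ∀ n : ℤ, Generically (hyperplane (ω + n * δ)) fun x =>
        hirota br δ τ' ![baseA, baseB, baseC] x = 0 := by
      have := hτ'.org.hirota _ hb.frame
      rwa [setOf_six_points (ε := 0) ⟨0, by simp⟩ fun i => ?_, zero_mul, add_zero,
        generically_domainD_iff hδ] at this
      fin_cases i
      · exact ⟨1, by simp [hb.phi_a]⟩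
      · exact ⟨0, by simp [hb.phi_b]⟩
      · exact ⟨0, by simp [hb.phi_c]⟩
    have huniq : ∀ n : ℕ, (Generically (hyperplane (ω + n * δ)) fun x => τ' x = τ x) ∧
        Generically (hyperplane (ω + (n + 1 : ℕ) * δ)) fun x => τ' x = τ x := by
      intro n
      induction n with
      | zero =>
        simp only [CharP.cast_eq_zero, zero_mul, add_zero, zero_add, Nat.cast_one, one_mul]
        rw [MeroEq, generically_iff] at h0' h1'
        constructor
        · rw [generically_iff]
          filter_upwards [h0', eventually_mem_genericFilter _] with x e hx
          rw [e, h0eq x hx]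
        · rw [generically_iff]
          filter_upwards [h1', eventually_mem_genericFilter _] with x e hx
          rw [e, h1eq x hx]
      | succ n ih =>
        refine ⟨ih.2, ?_⟩
        set κ : ℂ := ω + (n + 1 : ℕ) * δ with hκ
        have e1 : ω + (n : ℂ) * δ = κ - δ := by rw [hκ]; push_cast; ring
        have e3 : ω + ((n + 1 + 1 : ℕ) : ℂ) * δ = κ + δ := by rw [hκ]; push_cast; ring
        have hp := (hstate n).2.2.2.1
        rw [e1] at hp ih
        rw [e3]
        have d1 := hH (n + 1 : ℕ)
        have d2 := hb.generically (hone (n + 1 : ℕ))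
        rw [Int.cast_natCast, ← hκ] at d1 d2
        have d3 := nextTau_denominator_ne_zero hbr hp
        have d4 := ih.1.shift (κ := κ) (-(δ • baseA)) (by simp [hb.phi_a]; ring)
        have d5 := fun v (hv : phi ⬝ᵥ v = 0) => ih.2.shift (κ := κ) v (by simp [hv])
        have d6 := d5 (δ • baseB) (by simp [hb.phi_b])
        have d7 := d5 (-(δ • baseB)) (by simp [hb.phi_b])
        have d8 := d5 (δ • baseC) (by simp [hb.phi_c])
        have d9 := d5 (-(δ • baseC)) (by simp [hb.phi_c])
        have hgen : Generically (hyperplane κ) fun x =>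
            τ' (x + δ • baseA) = τ (x + δ • baseA) := by
          rw [generically_iff] at *
          filter_upwards [d1, d2, d3, d4, d6, d7, d8, d9] with x d1 d2 d3 d4 d6 d7 d8 d9
          rw [← sub_eq_add_neg] at d4 d7 d9
          simp only [hirota, Matrix.cons_val, tauPM, d4, d6, d7, d8, d9] at d1 d2
          -- By induction `τ'` and `τ` agree on the two lower hyperplanes, so the two base equations
          -- differ only by `[(b±c|x)] τ(x-δa)` times the difference of the values at `x + δa`.
          refine mul_left_cancel₀ d3 ?_
          linear_combination d1 - d2
        have := hgen.shift (κ := κ + δ) (-(δ • baseA)) (by simp [hb.phi_a])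
        simpa using this
    rw [MeroEq, generically_domainD_iff hδ]
    intro n
    rcases lt_or_ge n 0 with hn | hn
    · have := hτ'.neg_eq_zero n hn
      rw [MeroEq, generically_iff] at this
      rw [generically_iff]
      filter_upwards [this, eventually_mem_genericFilter _] with x e hx
      rw [e, hneg n hn x hx]
      rfl
    · obtain ⟨m, rfl⟩ := Int.eq_ofNat_of_zero_le hn
      simpa using (huniq m).1
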